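/- **Setting.** Let $H\ge 2$. A Markov transition model $M=(\mathcal X,\mathcal A,T,H,\rho)$ has a finite layered state space $\mathcal X=\mathcal X_1\sqcup\dots\sqcup\mathcal X_H$, a finite action set $\mathcal A$, transition probabilities $T(\cdot\mid x,a)\in\Delta(\mathcal X_{h+1})$ for $x\in\mathcal X_h$, $h<H$, and an initial distribution $\rho\in\Delta(\mathcal X_1)$; an MDP has in addition reward distributions on $[-1,1]$ for all $(x,a)$. $d^\pi_h$ denotes the occupancy measure of a policy $\pi$ in layer $h$. An offline distribution is $\mu=(\mu_1,\dots,\mu_{H-1})$ with $\mu_h\in\Delta(\mathcal X_h\times\mathcal A)$; it is admissible if there is a policy $\pi_b$ with $\mu_h(x,a)=d_h^{\pi_b}(x,a)$ for all $h\le H-1$. An offline sample consists of independent tuples $(x_h,a_h,r_h,x_{h+1}')$, $h=1,\dots,H-1$, with $(x_h,a_h)\sim\mu_h$, $r_h$ drawn from the reward distribution of $(x_h,a_h)$ and $x'_{h+1}\sim T(\cdot\mid x_h,a_h)$. An OPE problem $\mathfrak g=(M^{\mathfrak g},\pi_e^{\mathfrak g},\mu^{\mathfrak g},\mathcal F^{\mathfrak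 g})$ consists of an MDP, a deterministic evaluation policy, an offline distribution and a class of functions $\mathcal X\times\mathcal A\to[-1,1]$; the task is to estimate the value $V^{\mathfrak g}=V^{\pi_e^{\mathfrak g}}(\rho;M^{\mathfrak g})$ from i.i.d. offline samples. It is realizable if $Q^{\pi_e^{\mathfrak g}}\in\mathcal F^{\mathfrak g}$. Let $$\mathsf C(M,\mu)=\max_{h\le H-1}\max_{x\in\mathcal X_h,a}\frac{d_h^{\pi_e}(x,a)}{\mu_h(x,a)} .$$ An aggregation scheme $\Phi$ consists of partitions $\Phi_h$ of the $\mathcal X_h$. Put $$\bar T(\phi'\mid\phi)=\frac{\sum_{x\in\phi}\sum_{x'\in\phi'}\mu_h(x,\pi_e(x))\,T(x'\mid x,\pi_e(x))}{\sum_{x\in\phi}\mu_h(x,\pi_e(x))}\qquad(\phi\in\Phi_h,\ \phi'\in\Phi_{h+1}),$$ $\bar d_1(\phi)=\sum_{x\in\phi}\rho(x)$, $\bar d_{h+1}(\phi')=\sum_{\phi\in\Phi_h}\bar d_h(\phi)\bar T(\phi'\mid\phi)$, and $$\bar{\mathsf C}_\epsilon=\bar{\mathsf C}_\epsilon(M,\Phi,\mu)=\max_{h\le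 H-1}\ \max_{\mathcal I\subseteq\Phi_h,\ \sum_{\phi\in\mathcal I}\bar d_h(\phi)\ge\epsilon}\ \frac{\sum_{\phi\in\mathcal I}\bar d_h(\phi)}{\sum_{\phi\in\mathcal I}\sum_{x\in\phi}\mu_h(x,\pi_e(x))}.$$ Quotients in $\mathsf C$ and $\bar{\mathsf C}_\epsilon$ take values in $[0,\infty]$, and $0/0=0$ throughout. **Theorem.** Let $\epsilon\in(0,1)$, let $M,\Phi,\mu$ be as above, and let $\pi_e$ be a deterministic policy that is constant on every $\phi\in\Phi$. Let $0<K<\infty$ with $K\le\bar{\mathsf C}_\epsilon(M,\Phi,\mu)$ (so $K=\bar{\mathsf C}_\epsilon$ is allowed if it is finite). Then there is a class $\mathfrak G$ of realizable OPE problems on a common finite layered observation space, with a common evaluation policy and a common function class $\mathcal F$, such that: 1. *(Block structure.)* The observation space is partitioned into sets $\mathcal O(\phi)$, $\phi\in\Phi$, and one further observation for each of $3H$ new states $u_h,v_h,w_h$, $h\le H$. Each $\mathfrak g\in\mathfrak G$ is a block MDP with uniform emissions: a decoder, depending on $\mathfrak g$, divides each $\mathcal O(\phi)$ equally among the states $x\in\phi$.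 Its latent dynamics moves from $x\in\mathcal X$ to $x'\in\mathcal X$ with probability $(1-\tfrac2H)T(x'\mid x,a)$ and otherwise to $u_{h+1}$ or $v_{h+1}$; $u_h,v_h,w_h$ move to $w_{h+1}$. The initial distribution is the lift of $\rho$. The reward distribution depends only on the latent state and the action; its mean is $1,-1,0$ in $u_h,v_h,w_h$, and $0$ in the states of $\mathcal X_H$. The evaluation policy is the lift of $\pi_e$ on observations of states in $\mathcal X$, and there $\mu^{\mathfrak g}_h$ is the lift of $c_h\mu_h$ for some $c_h\in[\tfrac18,1]$. 2. $|\mathcal F|=2$ and $Q^{\pi_e^{\mathfrak g}}(\cdot;M^{\mathfrak g})\in\mathcal F$ for all $\mathfrak g\in\mathfrak G$. Moreover there is a set $\mathcal F_W$ of two pairs $(f,W)$, whose first components form $\mathcal F$, such that $(Q^{\pi_e^{\mathfrak g}},W^{\mathfrak g})\in\mathcal F_W$ for all $\mathfrak g$, where $W^{\mathfrak g}(h)=\sum_x\mu^{\mathfrak g}_h(x,\pi_e^{\mathfrak g}(x))Q^{\pi_e^{\mathfrak g}}(x,\pi_e^{\mathfrak g}(x))$, $h\le H-1$. 3. $f(o,\cdot)=f(o',\cdot)$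 for all $f\in\mathcal F$ and all observations $o,o'$ in the same $\mathcal O(\phi)$. 4. $\tfrac18\mathsf C(M,\mu)\le\mathsf C(M^{\mathfrak g},\mu^{\mathfrak g})\le 6\,\mathsf C(M,\mu)$ for all $\mathfrak g\in\mathfrak G$. 5. If $\mu$ is admissible for $M$, then $\mu^{\mathfrak g}$ is admissible for $M^{\mathfrak g}$ for all $\mathfrak g\in\mathfrak G$. 6. For every $n$ and every (possibly randomised) algorithm that maps $n$ offline samples to an estimate $\widehat V$, there is $\mathfrak g\in\mathfrak G$ for which $$\Pr\Big[\,|\widehat V-V^{\mathfrak g}|>\frac{\epsilon}{8H}\Big]\ \ge\ \frac12-\frac{n\epsilon}{HK}.$$ In particular the failure probability is at least $\tfrac12-o(1)$ when $n=o(HK/\epsilon)$. 7. Every (possibly randomised) algorithm that uses $n$ offline samples and satisfies $\mathbb E\,|\widehat V-V^{\mathfrak g}|\le\frac{\epsilon}{32H}$ for all $\mathfrak g\in\mathfrak G$ has $n\ge\frac{HK}{4\epsilon}$; with $K=\bar{\mathsf C}_\epsilon$ this is $n=\Omega(H\bar{\mathsf C}_\epsilon/\epsilon)$. -/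

import Mathlib

open MeasureTheory ProbabilityTheory
open scoped ENNReal

namespace AggOPE

noncomputable section

/-- A finite Markov transition model of horizon `H`. The state space is layered: the state `x`
lives in layer `layer x`, one of `1, …, H`. No transition leaves the last layer. -/
structure MTM (S A : Type*) [Fintype S] (H : ℕ) where
  layer : S → ℕ
  layer_pos : ∀ x, 1 ≤ layer x
  layer_le : ∀ x, layer x ≤ H
  T : S → A → S → ℝ
  T_nonneg : ∀ x a x', 0 ≤ T x a x'
  T_layer : ∀ x a x', T x a x' ≠ 0 → layer x' = layer x + 1
  T_sum : ∀ x a, layer x < H → ∑ x', T x a x' = 1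
  ρ : S → ℝ
  ρ_nonneg : ∀ x, 0 ≤ ρ x
  ρ_layer : ∀ x, ρ x ≠ 0 → layer x = 1
  ρ_sum : ∑ x, ρ x = 1

/-- A Markov decision process: a transition model together with a reward distribution on
`[-1, 1]` for every state-action pair. -/
structure MDP (S A : Type*) [Fintype S] (H : ℕ) extends MTM S A H where
  reward : S → A → Measure ℝ
  reward_prob : ∀ x a, IsProbabilityMeasure (reward x a)
  reward_mem : ∀ x a, ∀ᵐ s ∂(reward x a), s ∈ Set.Icc (-1 : ℝ) 1

/-- A Markovian randomised policy. As a state determines its layer, non-stationary policies are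
included. -/
structure Policy (S A : Type*) [Fintype A] where
  prob : S → A → ℝ
  nonneg : ∀ x a, 0 ≤ prob x a
  sum_one : ∀ x, ∑ a, prob x a = 1

open Classical in
/-- The randomised policy that takes the action `π x` in the state `x` with probability one. -/
def Policy.det {S A : Type*} [Fintype A] (π : S → A) : Policy S A where
  prob x a := if a = π x then 1 else 0
  nonneg x a := by split_ifs <;> norm_num
  sum_one x := by simp

section Basic

variable {S A : Type*} [Fintype S] [Fintype A] {H : ℕ}

/-- The state occupancy measure `d_h^π(x; M)`, for `h = 1, 2, …` (layers start at `1`). -/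
def MTM.occ (M : MTM S A H) (π : Policy S A) : ℕ → S → ℝ
  | 0 => fun _ => 0
  | 1 => M.ρ
  | (h + 2) => fun x' => ∑ x, ∑ a, M.occ π (h + 1) x * π.prob x a * M.T x a x'

/-- The state-action occupancy measure `d_h^π(x, a; M) = d_h^π(x; M) π(a | x)`. -/
def MTM.occSA (M : MTM S A H) (π : Policy S A) (h : ℕ) (x : S) (a : A) : ℝ :=
  M.occ π h x * π.prob x a

/-- The expected reward `r(x, a)`. -/
def MDP.meanReward (M : MDP S A H) (x : S) (a : A) : ℝ := ∫ s, s ∂(M.reward x a)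

/-- The expected total reward of `k` steps of the policy `π` that start with the action `a` in
the state `x`. -/
def MDP.qSteps (M : MDP S A H) (π : Policy S A) : ℕ → S → A → ℝ
  | 0 => fun _ _ => 0
  | (k + 1) => fun x a =>
      M.meanReward x a + ∑ x', M.T x a x' * ∑ a', π.prob x' a' * M.qSteps π k x' a'

/-- The state-action value function `Q_h^π(x, a; M)` with `h = layer x`: the expected sum of the
`H - h + 1` rewards that are collected in the layers `h, …, H`. -/
def MDP.Q (M : MDP S A H) (π : Policy S A) (x : S) (a : A) : ℝ :=
  M.qSteps π (H + 1 - M.layer x) x a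

/-- The value `V^π(ρ; M)` of the policy `π`. -/
def MDP.V (M : MDP S A H) (π : Policy S A) : ℝ :=
  ∑ x, M.ρ x * ∑ a, π.prob x a * M.Q π x a

/-- `μ = (μ_1, …, μ_{H-1})`, where `μ_h` is a probability distribution on pairs of a state of
layer `h` and an action. -/
structure IsOfflineDist (M : MTM S A H) (μ : ℕ → S → A → ℝ) : Prop where
  nonneg : ∀ h x a, 0 ≤ μ h x a
  support : ∀ h x a, μ h x a ≠ 0 → M.layer x = h ∧ 1 ≤ h ∧ h < H
  sum_one : ∀ h, 1 ≤ h → h < H → ∑ x, ∑ a, μ h x a = 1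

/-- The offline distribution is the occupancy measure of some policy. -/
def IsAdmissible (M : MTM S A H) (μ : ℕ → S → A → ℝ) : Prop :=
  ∃ πb : Policy S A, ∀ h, 1 ≤ h → h < H → ∀ x a, μ h x a = M.occSA πb h x a

/-- The quotient of two non-negative reals in `[0, ∞]`: `0 / 0 = 0`, and `p / 0 = ∞` for
`p > 0`. -/
def ratio (p q : ℝ) : ℝ≥0∞ := ENNReal.ofReal p / ENNReal.ofReal q

/-- The concentrability coefficient `C(M, μ, π)`. -/
def conc (M : MTM S A H) (μ : ℕ → S → A → ℝ) (π : S → A) : ℝ≥0∞ :=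
  ⨆ h ∈ Finset.Icc 1 (H - 1), ⨆ x : S, ⨆ (_ : M.layer x = h), ⨆ a : A,
    ratio (M.occSA (Policy.det π) h x a) (μ h x a)

/-- A state aggregation scheme: a partition of every layer. -/
structure AggScheme (M : MTM S A H) where
  parts : Finset (Finset S)
  nonempty : ∀ φ ∈ parts, φ.Nonempty
  disjoint : ∀ φ ∈ parts, ∀ φ' ∈ parts, ∀ x, x ∈ φ → x ∈ φ' → φ = φ'
  cover : ∀ x, ∃ φ ∈ parts, x ∈ φ
  layered : ∀ φ ∈ parts, ∀ x ∈ φ, ∀ y ∈ φ, M.layer x = M.layer y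

/-- `Φ_h`, the aggregates of layer `h`. -/
def AggScheme.atLayer {M : MTM S A H} (Φ : AggScheme M) (h : ℕ) : Finset (Finset S) :=
  Φ.parts.filter fun φ => ∀ x ∈ φ, M.layer x = h

/-- The aggregated transition probability from the aggregate `φ` of layer `h` to the aggregate
`φ'`; the quotient is `0` where the denominator vanishes. -/
def aggT (M : MTM S A H) (μ : ℕ → S → A → ℝ) (π : Policy S A) (h : ℕ) (φ φ' : Finset S) : ℝ :=
  (∑ x ∈ φ, ∑ x' ∈ φ', ∑ a, π.prob x a * μ h x a * M.T x a x') /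
    (∑ x ∈ φ, ∑ a, π.prob x a * μ h x a)

/-- The aggregated occupancy measure, for `h = 1, 2, …`. -/
def aggOcc (M : MTM S A H) (Φ : AggScheme M) (μ : ℕ → S → A → ℝ) (π : Policy S A) :
    ℕ → Finset S → ℝ
  | 0 => fun _ => 0
  | 1 => fun φ => ∑ x ∈ φ, M.ρ x
  | (h + 2) => fun φ' =>
      ∑ φ ∈ Φ.atLayer (h + 1), aggOcc M Φ μ π (h + 1) φ * aggT M μ π (h + 1) φ φ'

/-- The aggregated concentrability coefficient of a deterministic policy. -/
def aggConc (M : MTM S A H) (Φ : AggScheme M) (μ : ℕ → S → A → ℝ) (π : S → A) (ε : ℝ) : ℝ≥0∞ :=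
  ⨆ h ∈ Finset.Icc 1 (H - 1), ⨆ I : Finset (Finset S), ⨆ (_ : I ⊆ Φ.atLayer h),
    ⨆ (_ : ε ≤ ∑ φ ∈ I, aggOcc M Φ μ (Policy.det π) h φ),
      ratio (∑ φ ∈ I, aggOcc M Φ μ (Policy.det π) h φ) (∑ φ ∈ I, ∑ x ∈ φ, μ h x (π x))

end Basic

/-- An offline policy evaluation problem: an MDP, a deterministic evaluation policy, an offline
distribution, and a class of functions from state-action pairs to `[-1, 1]`. -/
structure OPEProblem (S A : Type*) [Fintype S] [Fintype A] (H : ℕ) where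
  M : MDP S A H
  πe : S → A
  μ : ℕ → S → A → ℝ
  offline : IsOfflineDist M.toMTM μ
  F : Set (S → A → ℝ)
  F_mem : ∀ f ∈ F, ∀ x a, f x a ∈ Set.Icc (-1 : ℝ) 1

/-- One tuple `(x, a, s, x')` of a state, an action, a reward and a next state, stored as
`((x, a, x'), s)`. -/
def Sample (S A : Type*) := (S × A × S) × ℝ

/-- The discrete σ-algebra on `(x, a, x')` times the Borel σ-algebra on the reward. -/
instance (S A : Type*) : MeasurableSpace (Sample S A) :=
  @Prod.instMeasurableSpace (S × A × S) ℝ ⊤ inferInstance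

/-- A dataset of `n` offline samples; each sample has one tuple for each layer
`1, …, H - 1` (layer `h` has the index `h - 1`). -/
abbrev Dataset (S A : Type*) (H n : ℕ) := Fin (H - 1) → Fin n → Sample S A

namespace OPEProblem

variable {S A : Type*} [Fintype S] [Fintype A] {H : ℕ}

/-- `Q^{π_e}`. -/
def Q (g : OPEProblem S A H) : S → A → ℝ := g.M.Q (Policy.det g.πe)

/-- The number `V^{π_e}(ρ)` that is to be estimated. -/
def value (g : OPEProblem S A H) : ℝ := g.M.V (Policy.det g.πe)

/-- The `W`-function `W(h) = ∑_x μ_h(x, π_e(x)) Q(x, π_e(x))`, for `1 ≤ h ≤ H - 1`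
(it is `0` for other `h`). -/
def W (g : OPEProblem S A H) (h : ℕ) : ℝ := ∑ x, g.μ h x (g.πe x) * g.Q x (g.πe x)

/-- The law of a tuple of layer `h`: `(x, a) ∼ μ_h`, and then, independently, the reward is drawn
from `r(x, a)` and the next state from `T(· | x, a)`. -/
def sampleLaw (g : OPEProblem S A H) (h : ℕ) : Measure (Sample S A) :=
  ∑ x, ∑ a, ∑ x', ENNReal.ofReal (g.μ h x a * g.M.T x a x') •
    Measure.map (β := Sample S A) (fun s => ((x, a, x'), s)) (g.M.reward x a)

/-- The law of a dataset: all tuples are independent. -/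
def dataLaw (g : OPEProblem S A H) (n : ℕ) : Measure (Dataset S A H n) :=
  Measure.pi fun i => Measure.pi fun _ => g.sampleLaw (i.val + 1)

/-- The probability that the (randomised) algorithm `alg`, run on a random dataset of `n`
samples, does not estimate the value of the evaluation policy up to precision `δ`. -/
def failProb (g : OPEProblem S A H) {n : ℕ} (alg : Kernel (Dataset S A H n) ℝ) (δ : ℝ) : ℝ≥0∞ :=
  ∫⁻ D, alg D {v | δ < |v - g.value|} ∂(g.dataLaw n)

/-- The expected absolute error of the (randomised) algorithm `alg`, run on a random dataset of
`n` samples. -/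
def expError (g : OPEProblem S A H) {n : ℕ} (alg : Kernel (Dataset S A H n) ℝ) : ℝ≥0∞ :=
  ∫⁻ D, ∫⁻ v, ENNReal.ofReal |v - g.value| ∂(alg D) ∂(g.dataLaw n)

end OPEProblem

/-- The augmented latent state space: the original states, and three new states `u_h`, `v_h`,
`w_h` for each layer `h = 1, …, H`, which are the elements `(h - 1, 0)`, `(h - 1, 1)`,
`(h - 1, 2)` of the second summand. -/
abbrev Aug (X : Type*) (H : ℕ) := X ⊕ (Fin H × Fin 3)

section Lift

variable {X A O : Type*} [Fintype X] [Fintype A] [Fintype O] {H : ℕ}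

/-- The latent MDP `L` has the dynamics of `M`, except that every original state moves with
probability `2 / H` to the new states `u` and `v` of the next layer, from where the process goes
on to the new states `w` for ever. The new states `u`, `v`, `w` have expected reward
`1`, `-1`, `0`, and original states of the last layer (whose rewards are not part of the data)
have expected reward `0`. -/
structure IsAugmentation (M : MTM X A H) (L : MDP (Aug X H) A H) : Prop where
  layer_old : ∀ x, L.layer (.inl x) = M.layer x
  layer_new : ∀ i j, L.layer (.inr (i, j)) = i.val + 1
  ρ_old : ∀ x, L.ρ (.inl x) = M.ρ x
  T_old : ∀ x a x', L.T (.inl x) a (.inl x') = (1 - 2 / (H : ℝ)) * M.T x a x'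
  T_old_w : ∀ x a i, L.T (.inl x) a (.inr (i, 2)) = 0
  T_new : ∀ i j a i', i'.val = i.val + 1 → L.T (.inr (i, j)) a (.inr (i', 2)) = 1
  reward_u : ∀ i a, L.meanReward (.inr (i, 0)) a = 1
  reward_v : ∀ i a, L.meanReward (.inr (i, 1)) a = -1
  reward_w : ∀ i a, L.meanReward (.inr (i, 2)) a = 0
  reward_last : ∀ x a, M.layer x = H → L.meanReward (.inl x) a = 0

/-- The observations are labelled by the aggregates of `Φ` and by the new states. A decoder maps
the observations with label `φ` to the states in `φ`, in such a way that all states in `φ` are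
the image of the same (positive) number of observations. Each new state has one observation. -/
structure IsDecoder {M : MTM X A H} (Φ : AggScheme M) (lab : O → Φ.parts ⊕ (Fin H × Fin 3))
    (ψ : O → Aug X H) : Prop where
  old : ∀ o φ, lab o = .inl φ → ∃ x ∈ φ.1, ψ o = .inl x
  new : ∀ o j, lab o = .inr j → ψ o = .inr j
  unique : ∀ j, ∃! o, ψ o = .inr j
  pos : ∀ x, 0 < Nat.card {o // ψ o = .inl x}
  balanced : ∀ φ : Φ.parts, ∀ x ∈ φ.1,
    φ.1.card * Nat.card {o // ψ o = .inl x} = Nat.card {o // lab o = .inl φ}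

/-- `g` is the block problem over the latent MDP `L` with decoder `ψ`: a latent state emits an
observation that is uniform on its block, and the evaluation policy and the offline distribution
are the lifts of the latent ones. -/
structure IsBlock (L : MDP (Aug X H) A H) (πL : Aug X H → A) (μL : ℕ → Aug X H → A → ℝ)
    (ψ : O → Aug X H) (g : OPEProblem O A H) : Prop where
  layer : ∀ o, g.M.layer o = L.layer (ψ o)
  ρ : ∀ o, g.M.ρ o = L.ρ (ψ o) / Nat.card {o' // ψ o' = ψ o}
  T : ∀ o a o', g.M.T o a o' = L.T (ψ o) a (ψ o') / Nat.card {o'' // ψ o'' = ψ o'}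
  reward : ∀ o a, g.M.reward o a = L.reward (ψ o) a
  πe : ∀ o, g.πe o = πL (ψ o)
  μ : ∀ h o a, g.μ h o a = μL h (ψ o) a / Nat.card {o' // ψ o' = ψ o}

/-- `g` is a block problem whose latent model is an augmentation of `M`, whose evaluation policy
extends `π`, and whose offline distribution is `μ` on the original states of each layer, up to a
factor in `[1/8, 1]`. -/
def IsLift {M : MTM X A H} (Φ : AggScheme M) (π : X → A) (μ : ℕ → X → A → ℝ)
    (lab : O → Φ.parts ⊕ (Fin H × Fin 3)) (g : OPEProblem O A H) : Prop :=
  ∃ (L : MDP (Aug X H) A H) (πL : Aug X H → A) (μL : ℕ → Aug X H → A → ℝ) (ψ : O → Aug X H)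
    (c : ℕ → ℝ),
    IsAugmentation M L ∧ IsDecoder Φ lab ψ ∧ IsBlock L πL μL ψ g ∧
    (∀ x, πL (.inl x) = π x) ∧
    (∀ h, c h ∈ Set.Icc (1 / 8 : ℝ) 1) ∧
    (∀ h x a, μL h (.inl x) a = c h * μ h x a)

end Lift

end

end AggOPE

open AggOPE

/-! The sample complexity is governed by a layer `h₀` and a set `I` of aggregates that carries
aggregated mass `d ≥ ε` but data mass `mI ≤ d / K` (`exists_of_le_aggConc`). Pay a reward `r` on `I`
in the aggregated dynamics, damped by `1 - 2/H` per step, and let `f` be the resulting value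
function (`aggValue`). It is constant on aggregates, but it is not a value function of `M`. The
augmentation repairs this: a state moves to `u` or `v` with probabilities `(1 ± b)/H`, which pays
`2b/H` in expectation, and the bias `b` is chosen so that Bellman's equation for `f` holds exactly.
Replacing `b` by `-b` replaces `f` by `-f`. So two functions realize all the problems, and the
values are `± surv H h₀ * r * d`.

The sign of `b` is hard to see. Before layer `h₀`, the function `f` on an aggregate is the
`μ`-weighted average of the one-step backups of its states, so `b` averages to zero there. After
`h₀` it vanishes. What survives averaging (`sum_cell_bias`) is `H/2 * r` on `I`, for the evaluation
action only. An averaged tuple reveals the sign with probability at most `η = r * mI * surv H h₀`,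
of order `ε / (H * K)`, and only in layer `h₀`, through the transition, and in layer `h₀ + 1`,
through the data mass of `u` and `v` (`sum_abs_expect_obsTuple_le`).

The averaging is enforced by hiding the states. The observations are `m` copies of the state space,
and the decoder permutes each copy within the aggregates, independently and uniformly. If no copy
occurs in two tuples, the mixture over decoders is the product of the averaged tuple laws. A large
`m` makes collisions unlikely, so the two mixtures overlap (`mixture_overlap`,
`two_mul_le_overlap`), and Le Cam's method (`exists_le_failProb`) concludes. The bound in
expectation follows by Markov's inequality. -/

open scoped BigOperators

namespace AggOPE

/-! ### Overlap of mixtures of product distributions -/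

section Mixture

theorem one_sub_sum_le_prod {ι : Type*} [DecidableEq ι] (s : Finset ι) (x t : ι → ℝ) (h0 : ∀ i, 0 ≤ x i) (h1 : ∀ i, x i ≤ 1)
    (ht : ∀ i, 1 - t i ≤ x i) : 1 - ∑ i ∈ s, t i ≤ ∏ i ∈ s, x i := by
  induction s using Finset.induction_on with
  | empty => simp
  | insert i s his ih =>
    rw [Finset.prod_insert his, Finset.sum_insert his]
    have hp : ∏ i ∈ s, x i ≤ 1 := Finset.prod_le_one (fun i _ => h0 i) fun i _ => h1 i
    nlinarith [h0 i, h1 i, ht i]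

variable {κ G ι Z : Type*} [Fintype κ] [DecidableEq κ] [Fintype G] [Nonempty G]

/-- Under the uniform distribution on a product, functions of disjoint sets of coordinates are
uncorrelated. -/
theorem expect_mul_of_disjoint_coords (J : Finset κ) (f g : (κ → G) → ℝ)
    (hf : ∀ ω ω', (∀ j ∈ J, ω j = ω' j) → f ω = f ω')
    (hg : ∀ ω ω', (∀ j ∉ J, ω j = ω' j) → g ω = g ω') :
    𝔼 ω, f ω * g ω = (𝔼 ω, f ω) * 𝔼 ω, g ω := by
  classical
  -- Exchanging the coordinates outside `J` between two independent copies is an involution. It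
  -- turns the product of `f` and `g` at independent points into their product at a single point.
  let e : ((κ → G) × (κ → G)) ≃ ((κ → G) × (κ → G)) :=
    { toFun := fun p => (J.piecewise p.1 p.2, J.piecewise p.2 p.1)
      invFun := fun p => (J.piecewise p.1 p.2, J.piecewise p.2 p.1)
      left_inv := fun p => by
        ext j <;> by_cases hj : j ∈ J <;> simp [hj]
      right_inv := fun p => by
        ext j <;> by_cases hj : j ∈ J <;> simp [hj] }
  have h1 : (∑ ω, f ω) * ∑ ω, g ω = Fintype.card (κ → G) * ∑ ω, f ω * g ω := by
    rw [Finset.sum_mul_sum, ← Fintype.sum_prod_type' (fun ω ω' => f ω * g ω')]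
    have : ∀ p : (κ → G) × (κ → G), f p.1 * g p.2 = f (e p).1 * g (e p).1 := fun p => by
      rw [hf p.1 (e p).1 (fun j hj => by simp [e, hj]),
        hg p.2 (e p).1 (fun j hj => by simp [e, hj])]
    rw [Finset.sum_congr rfl fun p _ => this p,
      Equiv.sum_comp e (fun p => f p.1 * g p.1), Fintype.sum_prod_type, Finset.sum_comm]
    simp
  have hc : (Fintype.card (κ → G) : ℝ) ≠ 0 := by exact_mod_cast Fintype.card_ne_zero
  simp only [Fintype.expect_eq_sum_div_card]
  rw [div_mul_div_comm, h1]
  field_simp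

theorem expect_prod_of_disjoint_coords (s : Finset ι) (keys : ι → Finset κ)
    (hd : ∀ i ∈ s, ∀ k ∈ s, i ≠ k → Disjoint (keys i) (keys k)) (p : ι → (κ → G) → ℝ)
    (hp : ∀ i, ∀ ω ω', (∀ j ∈ keys i, ω j = ω' j) → p i ω = p i ω') :
    𝔼 ω, ∏ i ∈ s, p i ω = ∏ i ∈ s, 𝔼 ω, p i ω := by
  classical
  induction s using Finset.induction_on with
  | empty => simp
  | insert i s his ih =>
    simp only [Finset.prod_insert his]
    rw [expect_mul_of_disjoint_coords (keys i) (p i) _ (hp i), ih]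
    · exact fun a ha b hb => hd a (Finset.mem_insert_of_mem ha) b (Finset.mem_insert_of_mem hb)
    · intro ω ω' h
      refine Finset.prod_congr rfl fun k hk => hp k _ _ fun j hj => h j fun hji => ?_
      have hik : i ≠ k := fun h => his (h ▸ hk)
      exact Finset.disjoint_left.1
        (hd i (Finset.mem_insert_self _ _) k (Finset.mem_insert_of_mem hk) hik) hji hj

variable [Fintype ι] [DecidableEq ι] [Fintype Z]

/-- Under a product distribution, collisions of keys are unlikely if each key is. -/
theorem sum_collision_le (q : ι → Z → ℝ) (hq : ∀ i z, 0 ≤ q i z) (hq1 : ∀ i, ∑ z, q i z = 1)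
    (keys : Z → Finset κ) (r : ℝ) (hr : ∀ i j, ∑ z, (if j ∈ keys z then q i z else 0) ≤ r)
    (B : (ι → Z) → Prop) [DecidablePred B]
    (hB : ∀ D, B D → ∃ i k, i ≠ k ∧ ¬ Disjoint (keys (D i)) (keys (D k))) :
    ∑ D : ι → Z, (if B D then ∏ i, q i (D i) else 0)
      ≤ (Fintype.card ι : ℝ) ^ 2 * Fintype.card κ * r ^ 2 := by
  -- Union bound over the two places `i`, `k` and the shared key `j`: `F` restricts the factors `i`
  -- and `k` to the values with key `j`, so that by independence the product sums to at most `r ^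
  -- 2`.
  let F : ι → ι → κ → ι → Z → ℝ := fun i k j l z =>
    if l = i ∨ l = k then (if j ∈ keys z then q l z else 0) else q l z
  have hF : ∀ i k j l z, 0 ≤ F i k j l z := by
    intro i k j l z
    simp only [F]
    split_ifs <;> first | exact hq _ _ | exact le_rfl
  have h1 : ∀ D : ι → Z, (if B D then ∏ i, q i (D i) else 0)
      ≤ ∑ i, ∑ k, ∑ j, if i ≠ k then ∏ l, F i k j l (D l) else 0 := by
    intro D
    have hnn : ∀ i k j, 0 ≤ if i ≠ k then ∏ l, F i k j l (D l) else 0 := fun i k j => by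
      split_ifs
      · exact Finset.prod_nonneg fun l _ => hF _ _ _ _ _
      · exact le_rfl
    split_ifs with h
    · obtain ⟨i, k, hik, hj⟩ := hB D h
      obtain ⟨j, hji, hjk⟩ := Finset.not_disjoint_iff.1 hj
      calc ∏ l, q l (D l) = if i ≠ k then ∏ l, F i k j l (D l) else 0 := by
            rw [if_pos hik]
            refine Finset.prod_congr rfl fun l _ => ?_
            simp only [F]
            split_ifs with h1 h2
            · rfl
            · rcases h1 with rfl | rfl <;> contradiction
            · rfl
        _ ≤ ∑ j, if i ≠ k then ∏ l, F i k j l (D l) else 0 :=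
            Finset.single_le_sum (f := fun j => if i ≠ k then ∏ l, F i k j l (D l) else 0)
              (fun j _ => hnn i k j) (Finset.mem_univ j)
        _ ≤ ∑ k, ∑ j, if i ≠ k then ∏ l, F i k j l (D l) else 0 :=
            Finset.single_le_sum
              (f := fun k => ∑ j, if i ≠ k then ∏ l, F i k j l (D l) else 0)
              (fun k _ => Finset.sum_nonneg fun j _ => hnn i k j) (Finset.mem_univ k)
        _ ≤ _ :=
            Finset.single_le_sum
              (f := fun i => ∑ k, ∑ j, if i ≠ k then ∏ l, F i k j l (D l) else 0)
              (fun i _ => Finset.sum_nonneg fun k _ => Finset.sum_nonneg fun j _ => hnn i k j)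
              (Finset.mem_univ i)
    · exact Finset.sum_nonneg fun i _ => Finset.sum_nonneg fun k _ =>
        Finset.sum_nonneg fun j _ => hnn i k j
  have h2 : ∀ i k j, ∑ D : ι → Z, (if i ≠ k then ∏ l, F i k j l (D l) else 0) ≤ r ^ 2 := by
    intro i k j
    split_ifs with hik
    · rw [← Fintype.piFinset_univ, ← Finset.prod_univ_sum]
      calc ∏ l, ∑ z, F i k j l z ≤ ∏ l, if l = i ∨ l = k then r else 1 := by
            refine Finset.prod_le_prod (fun l _ => Finset.sum_nonneg fun z _ => hF _ _ _ _ _)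
              fun l _ => ?_
            simp only [F]
            split_ifs with h
            · exact hr l j
            · exact (hq1 l).le
        _ = r ^ 2 := by
            rw [Finset.prod_ite]
            simp only [Finset.prod_const, one_pow, mul_one]
            congr 1
            have : (Finset.univ.filter fun l => l = i ∨ l = k) = {i, k} := by ext; simp
            rw [this, Finset.card_pair hik]
    · simp; positivity
  calc _ ≤ ∑ D : ι → Z, ∑ i, ∑ k, ∑ j, if i ≠ k then ∏ l, F i k j l (D l) else 0 :=
        Finset.sum_le_sum fun D _ => h1 D
    _ = ∑ i, ∑ k, ∑ j, ∑ D : ι → Z, if i ≠ k then ∏ l, F i k j l (D l) else 0 := by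
        rw [Finset.sum_comm]
        refine Finset.sum_congr rfl fun i _ => ?_
        rw [Finset.sum_comm]
        refine Finset.sum_congr rfl fun k _ => ?_
        rw [Finset.sum_comm]
    _ ≤ ∑ i : ι, ∑ k : ι, ∑ j : κ, r ^ 2 :=
        Finset.sum_le_sum fun i _ => Finset.sum_le_sum fun k _ =>
          Finset.sum_le_sum fun j _ => h2 i k j
    _ = _ := by simp; ring

/-- Two uniform mixtures of product distributions overlap if the mixed one-coordinate marginals
do, and if collisions of keys are unlikely. -/
theorem mixture_overlap (p p' : ι → (κ → G) → Z → ℝ) (hp : ∀ i ω z, 0 ≤ p i ω z)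
    (hp' : ∀ i ω z, 0 ≤ p' i ω z)
    (hp1 : ∀ i ω, ∑ z, p i ω z = 1) (hp1' : ∀ i ω, ∑ z, p' i ω z = 1)
    (keys : Z → Finset κ)
    (hk : ∀ i z ω ω', (∀ j ∈ keys z, ω j = ω' j) → p i ω z = p i ω' z)
    (hk' : ∀ i z ω ω', (∀ j ∈ keys z, ω j = ω' j) → p' i ω z = p' i ω' z)
    (r : ℝ) (hr : ∀ i ω j, ∑ z, (if j ∈ keys z then p i ω z else 0) ≤ r)
    (t : ι → ℝ)
    (ht : ∀ i, ∑ z, |(𝔼 ω, p i ω z) - 𝔼 ω, p' i ω z| ≤ 2 * t i) :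
    1 - ∑ i, t i - (Fintype.card ι : ℝ) ^ 2 * Fintype.card κ * r ^ 2
      ≤ ∑ D : ι → Z, min (𝔼 ω, ∏ i, p i ω (D i)) (𝔼 ω, ∏ i, p' i ω (D i)) := by
  classical
  set q : ι → Z → ℝ := fun i z => 𝔼 ω, p i ω z with hqd
  set q' : ι → Z → ℝ := fun i z => 𝔼 ω, p' i ω z with hqd'
  have hq : ∀ i z, 0 ≤ q i z := fun i z => Finset.expect_nonneg fun ω _ => hp i ω z
  have hq' : ∀ i z, 0 ≤ q' i z := fun i z => Finset.expect_nonneg fun ω _ => hp' i ω z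
  have hq1 : ∀ i, ∑ z, q i z = 1 := fun i => by
    simp only [hqd]
    rw [← Finset.expect_sum_comm]
    simp [hp1]
  have hq1' : ∀ i, ∑ z, q' i z = 1 := fun i => by
    simp only [hqd']
    rw [← Finset.expect_sum_comm]
    simp [hp1']
  let B : (ι → Z) → Prop := fun D => ∃ i k, i ≠ k ∧ ¬ Disjoint (keys (D i)) (keys (D k))
  have hbad := sum_collision_le q hq hq1 keys r (fun i j => by
    have : ∀ z, (if j ∈ keys z then q i z else 0) = 𝔼 ω, if j ∈ keys z then p i ω z else 0 := by
      intro z; split_ifs <;> simp [hqd]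
    rw [Finset.sum_congr rfl fun z _ => this z, ← Finset.expect_sum_comm]
    exact Finset.expect_le Finset.univ_nonempty fun ω _ => hr i ω j) B fun D h => h
  -- With a collision the left side is nonpositive. Without one, each mixture is the product of its
  -- marginals at `D`, and a product of minima is below both products.
  have hmin : ∀ D : ι → Z, (∏ i, min (q i (D i)) (q' i (D i)))
      - (if B D then ∏ i, q i (D i) else 0)
      ≤ min (𝔼 ω, ∏ i, p i ω (D i)) (𝔼 ω, ∏ i, p' i ω (D i)) := by
    intro D
    have hm : ∏ i, min (q i (D i)) (q' i (D i)) ≤ ∏ i, q i (D i) :=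
      Finset.prod_le_prod (fun i _ => le_min (hq _ _) (hq' _ _)) fun i _ => min_le_left _ _
    have hm' : ∏ i, min (q i (D i)) (q' i (D i)) ≤ ∏ i, q' i (D i) :=
      Finset.prod_le_prod (fun i _ => le_min (hq _ _) (hq' _ _)) fun i _ => min_le_right _ _
    split_ifs with h
    · refine le_trans (sub_nonpos.2 hm) (le_min ?_ ?_)
      · exact Finset.expect_nonneg fun ω _ => Finset.prod_nonneg fun i _ => hp _ _ _
      · exact Finset.expect_nonneg fun ω _ => Finset.prod_nonneg fun i _ => hp' _ _ _
    · have hd : ∀ i ∈ Finset.univ, ∀ k ∈ Finset.univ, i ≠ k →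
          Disjoint (keys (D i)) (keys (D k)) := fun i _ k _ hik => by
        by_contra hc
        exact h ⟨i, k, hik, hc⟩
      rw [expect_prod_of_disjoint_coords _ (fun i => keys (D i)) hd (fun i ω => p i ω (D i))
          fun i => hk i (D i),
        expect_prod_of_disjoint_coords _ (fun i => keys (D i)) hd (fun i ω => p' i ω (D i))
          fun i => hk' i (D i), sub_zero]
      exact le_min hm hm'
  have hprod : 1 - ∑ i, t i ≤ ∏ i, ∑ z, min (q i z) (q' i z) := by
    refine one_sub_sum_le_prod _ _ _ (fun i => Finset.sum_nonneg fun z _ => le_min (hq _ _) (hq' _ _))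
      (fun i => (Finset.sum_le_sum fun z _ => min_le_left _ _).trans (hq1 i).le) fun i => ?_
    -- The overlap of two probability vectors is one minus half their ℓ¹ distance.
    have : ∀ z, min (q i z) (q' i z) = (q i z + q' i z - |q i z - q' i z|) / 2 := fun z => by
      rcases le_total (q i z) (q' i z) with h | h
      · rw [min_eq_left h, abs_of_nonpos (by linarith)]; ring
      · rw [min_eq_right h, abs_of_nonneg (by linarith)]; ring
    rw [Finset.sum_congr rfl fun z _ => this z, ← Finset.sum_div, Finset.sum_sub_distrib,
      Finset.sum_add_distrib, hq1, hq1']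
    have := ht i
    linarith
  have := Finset.sum_le_sum fun D (_ : D ∈ (Finset.univ : Finset (ι → Z))) => hmin D
  have hsum : ∏ i, ∑ z, min (q i z) (q' i z) = ∑ D : ι → Z, ∏ i, min (q i (D i)) (q' i (D i)) := by
    rw [Finset.prod_univ_sum, Fintype.piFinset_univ]
  rw [Finset.sum_sub_distrib, ← hsum] at this
  linarith

end Mixture

/-! ### Datasets with deterministic rewards as finite sums -/

section DiscreteData

/-- Each factor is the pushforward under `t` of a finite measure on `Z` with the discrete σ-algebra.
Hence so is the product, and an integral over a finite discrete space is a sum. -/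
theorem lintegral_pi_pi_sum_dirac {ι κ Z W : Type*} [Fintype ι] [Fintype κ] [Fintype Z]
    [DecidableEq ι] [DecidableEq κ] [MeasurableSpace W] (w : ι → Z → ℝ≥0∞) (hw : ∀ i z, w i z ≠ ∞) (t : Z → W)
    (F : (ι → κ → W) → ℝ≥0∞) (hF : Measurable F) :
    ∫⁻ D, F D ∂(Measure.pi fun i => Measure.pi fun _ : κ => ∑ z, w i z • Measure.dirac (t z))
      = ∑ D : ι → κ → Z, (∏ i, ∏ k, w i (D i k)) * F (fun i k => t (D i k)) := by
  let _ : MeasurableSpace Z := ⊤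
  let q : ι → Measure Z := fun i => ∑ z, w i z • Measure.dirac z
  have hfin : ∀ i, IsFiniteMeasure (q i) := fun i => ⟨by
    simp only [q, Measure.finsetSum_apply, Measure.smul_apply, smul_eq_mul]
    exact ENNReal.sum_lt_top.2 fun z _ => by simpa using (hw i z).lt_top⟩
  have ht : Measurable t := measurable_from_top
  have hmap : ∀ i, ∑ z, w i z • Measure.dirac (t z) = (q i).map t := by
    intro i
    ext s hs
    rw [Measure.map_apply ht hs]
    simp only [q, Measure.finsetSum_apply, Measure.smul_apply,
      Measure.dirac_apply' _ hs, Measure.dirac_apply' _ (ht hs)]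
    rfl
  have hsingle : ∀ i z, q i {z} = w i z := by
    intro i z
    simp only [q, Measure.finsetSum_apply, Measure.smul_apply, smul_eq_mul]
    rw [Finset.sum_eq_single z]
    · simp
    · intro b _ hb
      simp [hb]
    · simp
  have hinner : ∀ i, (Measure.pi fun _ : κ => ∑ z, w i z • Measure.dirac (t z))
      = (Measure.pi fun _ : κ => q i).map (fun D k => t (D k)) := by
    intro i
    simp only [hmap]
    exact (Measure.pi_map_pi (fun _ => ht.aemeasurable)).symm
  have hm : ∀ _ : ι, Measurable (fun (D : κ → Z) k => t (D k)) := fun _ =>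
    measurable_pi_lambda _ fun k => ht.comp (measurable_pi_apply k)
  have houter : (Measure.pi fun i => Measure.pi fun _ : κ => ∑ z, w i z • Measure.dirac (t z))
      = (Measure.pi fun i => Measure.pi fun _ : κ => q i).map (fun D i k => t (D i k)) := by
    simp only [hinner]
    exact (Measure.pi_map_pi (fun i => (hm i).aemeasurable)).symm
  have hmm : Measurable (fun (D : ι → κ → Z) i k => t (D i k)) :=
    measurable_pi_lambda _ fun i => (hm i).comp (measurable_pi_apply i)
  rw [houter, lintegral_map hF hmm, lintegral_fintype]
  refine Finset.sum_congr rfl fun D _ => ?_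
  rw [Measure.pi_singleton, mul_comm]
  congr 1
  refine Finset.prod_congr rfl fun i _ => ?_
  rw [Measure.pi_singleton]
  exact Finset.prod_congr rfl fun k _ => hsingle _ _

variable {S A : Type*} [Fintype S] [Fintype A] {H : ℕ}

/-- The tuple with a given discrete part and with a reward that is a function of the state. -/
def Sample.tag (r : S → ℝ) (z : S × A × S) : Sample S A := (z, r z.1)

namespace OPEProblem

/-- The probability of the discrete part `(x, a, x')` of a tuple of layer `h`. -/
def tupleProb (g : OPEProblem S A H) (h : ℕ) (z : S × A × S) : ℝ :=
  g.μ h z.1 z.2.1 * g.M.T z.1 z.2.1 z.2.2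

theorem tupleProb_nonneg (g : OPEProblem S A H) (h : ℕ) (z : S × A × S) : 0 ≤ g.tupleProb h z :=
  mul_nonneg (g.offline.nonneg _ _ _) (g.M.T_nonneg _ _ _)

theorem tupleProb_sum (g : OPEProblem S A H) (h : ℕ) (h1 : 1 ≤ h) (hH : h < H) :
    ∑ z, g.tupleProb h z = 1 := by
  simp only [tupleProb, Fintype.sum_prod_type]
  rw [← g.offline.sum_one h h1 hH]
  refine Finset.sum_congr rfl fun x _ => Finset.sum_congr rfl fun a _ => ?_
  rw [← Finset.mul_sum]
  by_cases h0 : g.μ h x a = 0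
  · simp [h0]
  · rw [g.M.T_sum x a (by rw [(g.offline.support h x a h0).1]; exact hH), mul_one]

/-- The dataset with given discrete parts and with rewards that are a function of the state. -/
def tagged (r : S → ℝ) {n : ℕ} (D : Fin (H - 1) × Fin n → S × A × S) : Dataset S A H n :=
  fun i k => Sample.tag r (D (i, k))

/-- A reward that is a function of the observed state adds no randomness, so the dataset is
determined by its discrete part. This reduces the lower bound to finite probability. -/
theorem lintegral_dataLaw (g : OPEProblem S A H) (r : S → ℝ)
    (hr : ∀ x a, g.M.reward x a = Measure.dirac (r x)) (n : ℕ) (F : Dataset S A H n → ℝ≥0∞)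
    (hF : Measurable F) :
    ∫⁻ D, F D ∂(g.dataLaw n) = ∑ D : Fin (H - 1) × Fin n → S × A × S,
      ENNReal.ofReal (∏ i, g.tupleProb (i.1.val + 1) (D i)) * F (tagged r D) := by
  have hs : ∀ h, g.sampleLaw h = ∑ z : S × A × S, ENNReal.ofReal (g.tupleProb h z) •
      Measure.dirac (Sample.tag r z) := by
    intro h
    have hm : ∀ z : S × A × S, Measurable (β := Sample S A) (fun s => (z, s)) := fun z =>
      @measurable_prodMk_left (S × A × S) ℝ ⊤ _ z
    simp only [sampleLaw, Fintype.sum_prod_type, hr]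
    refine Finset.sum_congr rfl fun x _ => Finset.sum_congr rfl fun a _ =>
      Finset.sum_congr rfl fun x' _ => ?_
    rw [Measure.map_dirac' (hm _)]
    rfl
  simp only [dataLaw, hs]
  rw [lintegral_pi_pi_sum_dirac (fun (i : Fin (H - 1)) z => ENNReal.ofReal (g.tupleProb (i.val + 1) z))
    (fun _ _ => ENNReal.ofReal_ne_top) (Sample.tag r) F hF]
  rw [← Equiv.sum_comp (Equiv.curry (Fin (H - 1)) (Fin n) (S × A × S))]
  refine Finset.sum_congr rfl fun D _ => ?_
  rw [ENNReal.ofReal_prod_of_nonneg fun i _ => g.tupleProb_nonneg _ _, Fintype.prod_prod_type]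
  rfl

theorem failProb_eq (g : OPEProblem S A H) (r : S → ℝ)
    (hr : ∀ x a, g.M.reward x a = Measure.dirac (r x)) {n : ℕ}
    (alg : Kernel (Dataset S A H n) ℝ) [IsMarkovKernel alg] (δ : ℝ) :
    g.failProb alg δ = ENNReal.ofReal (∑ D : Fin (H - 1) × Fin n → S × A × S,
      (∏ i, g.tupleProb (i.1.val + 1) (D i)) *
        (alg (tagged r D)).real {v | δ < |v - g.value|}) := by
  have hB : MeasurableSet {v : ℝ | δ < |v - g.value|} :=
    measurableSet_lt measurable_const (by fun_prop)
  have hP : ∀ D : Fin (H - 1) × Fin n → S × A × S, 0 ≤ ∏ i, g.tupleProb (i.1.val + 1) (D i) :=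
    fun D => Finset.prod_nonneg fun i _ => g.tupleProb_nonneg _ _
  rw [failProb, g.lintegral_dataLaw r hr n _ (Kernel.measurable_coe alg hB),
    ENNReal.ofReal_sum_of_nonneg fun D _ => mul_nonneg (hP D) measureReal_nonneg]
  refine Finset.sum_congr rfl fun D _ => ?_
  rw [ENNReal.ofReal_mul (hP D), ofReal_measureReal]

/-- Markov's inequality for the error of an algorithm. -/
theorem failProb_le_expError (g : OPEProblem S A H) {n : ℕ} (alg : Kernel (Dataset S A H n) ℝ)
    (δ : ℝ) : ENNReal.ofReal δ * g.failProb alg δ ≤ g.expError alg := by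
  have hB : MeasurableSet {v : ℝ | δ < |v - g.value|} :=
    measurableSet_lt measurable_const (by fun_prop)
  rw [failProb, ← lintegral_const_mul _ (Kernel.measurable_coe alg hB)]
  refine lintegral_mono fun D => ?_
  refine le_trans (mul_le_mul_right (measure_mono fun v hv => ?_) _)
    (mul_meas_ge_le_lintegral (by fun_prop) _)
  exact ENNReal.ofReal_le_ofReal (le_of_lt hv)

end OPEProblem

end DiscreteData

/-! ### Block MDPs with uniform emissions -/

noncomputable section BlockModel

variable {S A O : Type*} [Fintype S] [Fintype A] [Fintype O] {H : ℕ}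

theorem Policy.det_prob_mul_sum {S A : Type*} [Fintype A] (π : S → A) (x : S) (F : A → ℝ) :
    ∑ a, (Policy.det π).prob x a * F a = F (π x) := by
  classical
  simp only [Policy.det, ite_mul, one_mul, zero_mul]
  rw [Finset.sum_eq_single (π x)] <;> simp +contextual

theorem MTM.occ_nonneg (M : MTM S A H) (π : Policy S A) : ∀ h x, 0 ≤ M.occ π h x
  | 0, _ => le_rfl
  | 1, x => M.ρ_nonneg x
  | h + 2, _ => Finset.sum_nonneg fun x _ => Finset.sum_nonneg fun a _ =>
      mul_nonneg (mul_nonneg (M.occ_nonneg π (h + 1) x) (π.nonneg x a)) (M.T_nonneg _ _ _)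

theorem MTM.layer_of_occ_ne_zero (M : MTM S A H) (π : Policy S A) :
    ∀ h x, M.occ π h x ≠ 0 → M.layer x = h
  | 0, _, h => absurd rfl h
  | 1, x, h => M.ρ_layer x h
  | h + 2, x', h0 => by
      obtain ⟨x, _, hx⟩ := Finset.exists_ne_zero_of_sum_ne_zero h0
      obtain ⟨a, _, ha⟩ := Finset.exists_ne_zero_of_sum_ne_zero hx
      rw [M.T_layer x a x' (right_ne_zero_of_mul ha), M.layer_of_occ_ne_zero π (h + 1) x
        (left_ne_zero_of_mul (left_ne_zero_of_mul ha))]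

theorem MTM.sum_occSA (M : MTM S A H) (π : Policy S A) (h : ℕ) (x : S) :
    ∑ a, M.occSA π h x a = M.occ π h x := by
  simp only [MTM.occSA, ← Finset.mul_sum, π.sum_one, mul_one]

theorem MTM.occSA_nonneg (M : MTM S A H) (π : Policy S A) (h : ℕ) (x : S) (a : A) :
    0 ≤ M.occSA π h x a := mul_nonneg (M.occ_nonneg π h x) (π.nonneg x a)

theorem MTM.sum_occ (M : MTM S A H) (π : Policy S A) :
    ∀ h, 1 ≤ h → h ≤ H → ∑ x, M.occ π h x = 1
  | 1, _, _ => M.ρ_sum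
  | h + 2, _, hH => by
      rw [← M.sum_occ π (h + 1) (by omega) (by omega)]
      simp only [MTM.occ]
      rw [Finset.sum_comm]
      refine Finset.sum_congr rfl fun x _ => ?_
      rw [Finset.sum_comm]
      simp only [← Finset.mul_sum]
      refine Eq.trans ?_ (M.sum_occSA π (h + 1) x)
      refine Finset.sum_congr rfl fun a _ => ?_
      by_cases h0 : M.occ π (h + 1) x = 0
      · simp [h0, MTM.occSA]
      · rw [M.T_sum x a (by rw [M.layer_of_occ_ne_zero π _ _ h0]; omega), mul_one]
        rfl

/-- The number of observations of a latent state. -/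
def fiberCard (ψ : O → S) (s : S) : ℝ := (Nat.card {o // ψ o = s} : ℝ)

theorem fiberCard_pos {S O : Type*} [Fintype O] {ψ : O → S} (hψ : Function.Surjective ψ) (s : S) : 0 < fiberCard ψ s := by
  obtain ⟨o, ho⟩ := hψ s
  have : Nonempty {o // ψ o = s} := ⟨⟨o, ho⟩⟩
  exact Nat.cast_pos.2 Nat.card_pos

/-- The weight of a latent state is shared equally by its observations. All transfers between the
block MDP and its latent model rest on this identity. -/
theorem sum_div_fiberCard {ψ : O → S} (hψ : Function.Surjective ψ) (F : S → ℝ) :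
    ∑ o, F (ψ o) / fiberCard ψ (ψ o) = ∑ s, F s := by
  classical
  rw [← Finset.sum_fiberwise (s := Finset.univ) (g := ψ)]
  refine Finset.sum_congr rfl fun s _ => ?_
  have : ∀ o ∈ Finset.univ.filter (fun o => ψ o = s),
      F (ψ o) / fiberCard ψ (ψ o) = F s / fiberCard ψ s := fun o ho => by
    rw [(Finset.mem_filter.1 ho).2]
  rw [Finset.sum_congr rfl this, Finset.sum_const, nsmul_eq_mul]
  have hc : ((Finset.univ.filter fun o => ψ o = s).card : ℝ) = fiberCard ψ s := by
    rw [fiberCard, Nat.card_eq_fintype_card, Fintype.card_subtype]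
  rw [hc, mul_div_cancel₀ _ (fiberCard_pos hψ s).ne']

/-- The block MDP over `L` with decoder `ψ` and uniform emissions. -/
def blockMDP (L : MDP S A H) (ψ : O → S) (hψ : Function.Surjective ψ) : MDP O A H where
  layer o := L.layer (ψ o)
  layer_pos o := L.layer_pos _
  layer_le o := L.layer_le _
  T o a o' := L.T (ψ o) a (ψ o') / fiberCard ψ (ψ o')
  T_nonneg o a o' := div_nonneg (L.T_nonneg _ _ _) (Nat.cast_nonneg _)
  T_layer o a o' h := L.T_layer _ a _ (div_ne_zero_iff.1 h).1
  T_sum o a h := by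
    rw [sum_div_fiberCard hψ (fun s => L.T (ψ o) a s)]
    exact L.T_sum _ _ h
  ρ o := L.ρ (ψ o) / fiberCard ψ (ψ o)
  ρ_nonneg o := div_nonneg (L.ρ_nonneg _) (Nat.cast_nonneg _)
  ρ_layer o h := L.ρ_layer _ (div_ne_zero_iff.1 h).1
  ρ_sum := by
    rw [sum_div_fiberCard hψ L.ρ]
    exact L.ρ_sum
  reward o a := L.reward (ψ o) a
  reward_prob _ _ := L.reward_prob _ _
  reward_mem _ _ := L.reward_mem _ _

/-- The policy that decodes the observation and acts as a latent policy does. -/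
def Policy.lift (π : Policy S A) (ψ : O → S) : Policy O A where
  prob o a := π.prob (ψ o) a
  nonneg _ _ := π.nonneg _ _
  sum_one _ := π.sum_one _

theorem Policy.det_comp {S A O : Type*} [Fintype A] (π : S → A) (ψ : O → S) :
    Policy.det (fun o => π (ψ o)) = (Policy.det π).lift ψ := rfl

theorem blockMDP_occ (L : MDP S A H) {ψ : O → S} (hψ : Function.Surjective ψ) (π : Policy S A) :
    ∀ h o, (blockMDP L ψ hψ).occ (π.lift ψ) h o = L.occ π h (ψ o) / fiberCard ψ (ψ o)
  | 0, o => by simp [MTM.occ]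
  | 1, o => rfl
  | h + 2, o' => by
      simp only [MTM.occ, Finset.sum_div]
      rw [← sum_div_fiberCard hψ
        (fun s => ∑ a, L.occ π (h + 1) s * π.prob s a * L.T s a (ψ o') / fiberCard ψ (ψ o'))]
      refine Finset.sum_congr rfl fun o _ => ?_
      rw [Finset.sum_div]
      refine Finset.sum_congr rfl fun a _ => ?_
      rw [blockMDP_occ L hψ π (h + 1) o]
      simp only [blockMDP, Policy.lift]
      ring

theorem blockMDP_qSteps (L : MDP S A H) {ψ : O → S} (hψ : Function.Surjective ψ) (π : Policy S A) :
    ∀ k o a, (blockMDP L ψ hψ).qSteps (π.lift ψ) k o a = L.qSteps π k (ψ o) a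
  | 0, _, _ => rfl
  | k + 1, o, a => by
      simp only [MDP.qSteps]
      congr 1
      rw [← sum_div_fiberCard hψ]
      refine Finset.sum_congr rfl fun o' _ => ?_
      have hi : ∑ a', (π.lift ψ).prob o' a' * (blockMDP L ψ hψ).qSteps (π.lift ψ) k o' a'
          = ∑ a', π.prob (ψ o') a' * L.qSteps π k (ψ o') a' :=
        Finset.sum_congr rfl fun a' _ => by rw [blockMDP_qSteps L hψ π k]; rfl
      rw [hi, mul_div_right_comm]
      rfl

theorem blockMDP_Q (L : MDP S A H) {ψ : O → S} (hψ : Function.Surjective ψ) (π : Policy S A)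
    (o : O) (a : A) : (blockMDP L ψ hψ).Q (π.lift ψ) o a = L.Q π (ψ o) a :=
  blockMDP_qSteps L hψ π _ o a

theorem blockMDP_V (L : MDP S A H) {ψ : O → S} (hψ : Function.Surjective ψ) (π : Policy S A) :
    (blockMDP L ψ hψ).V (π.lift ψ) = L.V π := by
  simp only [MDP.V]
  rw [← sum_div_fiberCard hψ]
  refine Finset.sum_congr rfl fun o _ => ?_
  simp only [blockMDP_Q]
  simp only [blockMDP, Policy.lift]
  ring

/-- The lift of a latent offline distribution. -/
def liftDist (μ : ℕ → S → A → ℝ) (ψ : O → S) (h : ℕ) (o : O) (a : A) : ℝ :=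
  μ h (ψ o) a / fiberCard ψ (ψ o)

theorem isOfflineDist_lift (L : MDP S A H) {ψ : O → S} (hψ : Function.Surjective ψ)
    {μ : ℕ → S → A → ℝ} (hμ : IsOfflineDist L.toMTM μ) :
    IsOfflineDist (blockMDP L ψ hψ).toMTM (liftDist μ ψ) where
  nonneg h o a := div_nonneg (hμ.nonneg _ _ _) (Nat.cast_nonneg _)
  support h o a h0 := hμ.support h (ψ o) a (div_ne_zero_iff.1 h0).1
  sum_one h h1 hH := by
    simp only [liftDist, ← Finset.sum_div]
    rw [sum_div_fiberCard hψ (fun s => ∑ a, μ h s a)]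
    exact hμ.sum_one h h1 hH

theorem blockMDP_occSA (L : MDP S A H) {ψ : O → S} (hψ : Function.Surjective ψ) (π : Policy S A)
    (h : ℕ) (o : O) (a : A) : (blockMDP L ψ hψ).occSA (π.lift ψ) h o a
      = L.occSA π h (ψ o) a / fiberCard ψ (ψ o) := by
  rw [MTM.occSA, MTM.occSA, blockMDP_occ, Policy.lift]
  ring

theorem isAdmissible_lift (L : MDP S A H) {ψ : O → S} (hψ : Function.Surjective ψ)
    {μ : ℕ → S → A → ℝ} (hμ : IsAdmissible L.toMTM μ) :
    IsAdmissible (blockMDP L ψ hψ).toMTM (liftDist μ ψ) := by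
  obtain ⟨πb, hb⟩ := hμ
  refine ⟨πb.lift ψ, fun h h1 hH o a => ?_⟩
  rw [blockMDP_occSA, liftDist, hb h h1 hH]

theorem ratio_mul_left {c : ℝ} (hc : 0 < c) (p q : ℝ) : ratio (c * p) (c * q) = ratio p q := by
  rw [ratio, ratio, ENNReal.ofReal_mul hc.le, ENNReal.ofReal_mul hc.le]
  exact ENNReal.mul_div_mul_left _ _ (by simpa using hc) ENNReal.ofReal_ne_top

theorem ratio_div_div {c : ℝ} (hc : 0 < c) (p q : ℝ) : ratio (p / c) (q / c) = ratio p q := by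
  rw [div_eq_inv_mul, div_eq_inv_mul, ratio_mul_left (inv_pos.2 hc)]

theorem ratio_le_conc (M : MTM S A H) (μ : ℕ → S → A → ℝ) (π : S → A) {h : ℕ} (h1 : 1 ≤ h)
    (hH : h < H) (x : S) (hx : M.layer x = h) (a : A) :
    ratio (M.occSA (Policy.det π) h x a) (μ h x a) ≤ conc M μ π :=
  le_iSup₂_of_le h (Finset.mem_Icc.2 ⟨h1, by omega⟩) <| le_iSup_of_le x <|
    le_iSup_of_le hx <| le_iSup (fun a => ratio (M.occSA (Policy.det π) h x a) (μ h x a)) a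

theorem conc_le {M : MTM S A H} {μ : ℕ → S → A → ℝ} {π : S → A} {C : ℝ≥0∞}
    (hC : ∀ h, 1 ≤ h → h < H → ∀ x, M.layer x = h → ∀ a,
      ratio (M.occSA (Policy.det π) h x a) (μ h x a) ≤ C) : conc M μ π ≤ C := by
  refine iSup₂_le fun h hh => iSup_le fun x => iSup_le fun hx => iSup_le fun a => ?_
  rw [Finset.mem_Icc] at hh
  exact hC h hh.1 (by omega) x hx a

/-- Occupancy and offline mass of an observation are both the latent ones divided by the same block
size, which cancels. Surjectivity of the decoder ensures that no latent quotient is lost. -/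
theorem conc_block (L : MDP S A H) {ψ : O → S} (hψ : Function.Surjective ψ)
    (μ : ℕ → S → A → ℝ) (π : S → A) :
    conc (blockMDP L ψ hψ).toMTM (liftDist μ ψ) (fun o => π (ψ o)) = conc L.toMTM μ π := by
  refine le_antisymm (conc_le fun h h1 hH o ho a => ?_) (conc_le fun h h1 hH s hs a => ?_)
  · rw [Policy.det_comp, blockMDP_occSA, liftDist, ratio_div_div (fiberCard_pos hψ _)]
    exact ratio_le_conc L.toMTM μ π h1 hH _ ho a
  · obtain ⟨o, rfl⟩ := hψ s
    refine le_trans (le_of_eq ?_) (ratio_le_conc (blockMDP L ψ hψ).toMTM (liftDist μ ψ)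
      (fun o => π (ψ o)) h1 hH o hs a)
    rw [Policy.det_comp π ψ, blockMDP_occSA, liftDist, ratio_div_div (fiberCard_pos hψ _)]

end BlockModel

/-! ### The augmented latent model: flows, concentrability, values -/

noncomputable section Augmentation

theorem MTM.T_eq_zero_of_layer_eq {X A : Type*} [Fintype X] {H : ℕ} (M : MTM X A H) {x : X}
    (hx : M.layer x = H) (a : A) (x' : X) : M.T x a x' = 0 := by
  by_contra h
  have h1 := M.T_layer x a x' h
  have h2 := M.layer_le x'
  omega

theorem sum_fin_ite_val {H : ℕ} (n : ℕ) (F : Fin H → ℝ) (v : ℝ) (hF : ∀ i, i.val = n → F i = v) :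
    ∑ i : Fin H, (if i.val = n then F i else 0) = if n < H then v else 0 := by
  split_ifs with h
  · rw [Finset.sum_eq_single ⟨n, h⟩]
    · rw [if_pos rfl, hF _ rfl]
    · intro i _ hi
      rw [if_neg fun h' => hi (Fin.ext h')]
    · simp
  · refine Finset.sum_eq_zero fun i _ => if_neg ?_
    have := i.isLt
    omega

theorem two_div_le_one {H : ℕ} (hH : 2 ≤ H) : (2 : ℝ) / H ≤ 1 := by
  have : (2 : ℝ) ≤ H := by exact_mod_cast hH
  rw [div_le_one (by linarith)]
  exact this

/-- The survival probability of the original states up to layer `h < H`, extended by a constant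
beyond. -/
def surv (H h : ℕ) : ℝ := (1 - 2 / (H : ℝ)) ^ min (h - 1) (H - 2)

theorem surv_one (H : ℕ) : surv H 1 = 1 := by simp [surv]

theorem surv_zero (H : ℕ) : surv H 0 = 1 := by simp [surv]

theorem surv_succ {H h : ℕ} (h1 : 1 ≤ h) (hh : h + 1 < H) :
    surv H (h + 1) = (1 - 2 / (H : ℝ)) * surv H h := by
  rw [surv, surv, ← pow_succ']
  congr 1
  omega

theorem surv_le_one {H : ℕ} (hH : 2 ≤ H) (h : ℕ) : surv H h ≤ 1 := by
  have := two_div_le_one hH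
  have h0 : (0 : ℝ) ≤ 2 / H := by positivity
  exact pow_le_one₀ (by linarith) (by linarith)

/-- With `k = H - 2` the smallest value is `(1 + 2/k)⁻ᵏ ≥ e⁻²`, and `e² < 15/2`. The constant has to
exceed `1/8`, because the gap between the two values must be strict. -/
theorem le_surv {H : ℕ} (hH : 2 ≤ H) (h : ℕ) : 2 / 15 ≤ surv H h := by
  have h2 := two_div_le_one hH
  have h0 : (0 : ℝ) ≤ 2 / H := by positivity
  have hle : (1 - 2 / (H : ℝ)) ^ (H - 2) ≤ surv H h :=
    pow_le_pow_of_le_one (by linarith) (by linarith) (min_le_right _ _)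
  refine le_trans ?_ hle
  obtain ⟨k, rfl⟩ : ∃ k, H = k + 2 := ⟨H - 2, by omega⟩
  rw [Nat.add_sub_cancel]
  rcases Nat.eq_zero_or_pos k with rfl | hk
  · norm_num
  have hk' : (0 : ℝ) < k := by exact_mod_cast hk
  have h3 : (1 + 2 / (k : ℝ)) ^ k ≤ 15 / 2 := by
    have h4 : 1 + 2 / (k : ℝ) ≤ Real.exp (2 / k) := by
      have := Real.add_one_le_exp (2 / (k : ℝ))
      linarith
    calc (1 + 2 / (k : ℝ)) ^ k ≤ Real.exp (2 / k) ^ k := by gcongr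
      _ = Real.exp 2 := by
          rw [← Real.exp_nat_mul]
          congr 1
          field_simp
      _ = Real.exp 1 ^ 2 := by rw [← Real.exp_nat_mul]; norm_num
      _ ≤ 2.7182818286 ^ 2 := by
          gcongr
          exact Real.exp_one_lt_d9.le
      _ ≤ 15 / 2 := by norm_num
  have h5 : (1 - 2 / ((k + 2 : ℕ) : ℝ)) = (1 + 2 / (k : ℝ))⁻¹ := by
    push_cast
    field_simp
    ring
  rw [h5, inv_pow, le_inv_comm₀ (by norm_num) (by positivity)]
  norm_num
  linarith

theorem surv_pos {H : ℕ} (hH : 2 ≤ H) (h : ℕ) : 0 < surv H h :=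
  lt_of_lt_of_le (by norm_num) (le_surv hH h)

/-- The probabilities to move to the new states `u`, `v`, `w`, with bias `b`. -/
def newProb (H : ℕ) (b : ℝ) : Fin 3 → ℝ := ![(1 + b) / H, (1 - b) / H, 0]

theorem newProb_nonneg (H : ℕ) {b : ℝ} (hb : |b| ≤ 1) (j : Fin 3) : 0 ≤ newProb H b j := by
  have := abs_le.1 hb
  fin_cases j <;> simp [newProb] <;> apply div_nonneg <;> linarith [(Nat.cast_nonneg H : (0 : ℝ) ≤ H)]

theorem newProb_sum (H : ℕ) (b : ℝ) : ∑ j, newProb H b j = 2 / H := by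
  simp [newProb, Fin.sum_univ_three]
  ring

/-- The rewards of the new states `u`, `v`, `w`. -/
def newReward : Fin 3 → ℝ := ![1, -1, 0]

theorem newReward_mem (j : Fin 3) : newReward j ∈ Set.Icc (-1 : ℝ) 1 := by
  fin_cases j <;> simp [newReward]

variable {X A : Type*} [Fintype X] [Fintype A] {H : ℕ}

/-- The transition probabilities of the augmented model. -/
def augT (M : MTM X A H) (b : X → A → ℝ) : Aug X H → A → Aug X H → ℝ
  | .inl x, a, .inl x' => (1 - 2 / (H : ℝ)) * M.T x a x'
  | .inl x, a, .inr (i, j) => if i.val = M.layer x then newProb H (b x a) j else 0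
  | .inr _, _, .inl _ => 0
  | .inr (i, _), _, .inr (i', j') => if i'.val = i.val + 1 ∧ j' = 2 then 1 else 0

/-- The (deterministic) rewards of the augmented model. -/
def augReward : Aug X H → ℝ := Sum.elim (fun _ => 0) fun p => newReward p.2

/-- The augmentation of `M` in which the bias of the transitions to `u` and `v` is `b`. -/
def augMDP (hH : 2 ≤ H) (M : MTM X A H) (b : X → A → ℝ) (hb : ∀ x a, |b x a| ≤ 1) :
    MDP (Aug X H) A H where
  layer := Sum.elim M.layer fun p => p.1.val + 1
  layer_pos := by rintro (x | p) <;> simp [M.layer_pos]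
  layer_le := by
    rintro (x | p)
    · exact M.layer_le x
    · exact p.1.isLt
  T := augT M b
  T_nonneg := by
    have := two_div_le_one hH
    rintro (x | ⟨i, j⟩) a (x' | ⟨i', j'⟩) <;> simp only [augT]
    · exact mul_nonneg (by linarith) (M.T_nonneg _ _ _)
    · split_ifs
      · exact newProb_nonneg H (hb x a) _
      · exact le_rfl
    · exact le_rfl
    · split_ifs <;> norm_num
  T_layer := by
    rintro (x | ⟨i, j⟩) a (x' | ⟨i', j'⟩) h <;> simp only [augT] at h
    · exact M.T_layer x a x' (right_ne_zero_of_mul h)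
    · simp only [Sum.elim_inl, Sum.elim_inr]
      by_contra hc
      exact h (if_neg (by omega))
    · exact absurd rfl h
    · simp only [Sum.elim_inr]
      by_contra hc
      exact h (if_neg (by omega))
  T_sum := by
    rintro (x | ⟨i, j⟩) a h
    · simp only [Sum.elim_inl] at h
      simp only [Fintype.sum_sum_type, augT, Fintype.sum_prod_type, ← Finset.mul_sum, M.T_sum x a h]
      have : ∀ i : Fin H, ∑ j, (if i.val = M.layer x then newProb H (b x a) j else 0)
          = if i.val = M.layer x then 2 / (H : ℝ) else 0 := fun i => by
        split_ifs
        · exact newProb_sum _ _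
        · simp
      simp only [this]
      rw [sum_fin_ite_val _ (fun _ => 2 / (H : ℝ)) _ (fun _ _ => rfl), if_pos h]
      ring
    · simp only [Sum.elim_inr] at h
      simp only [Fintype.sum_sum_type, augT, Fintype.sum_prod_type, Finset.sum_const_zero, zero_add,
        ite_and]
      have : ∀ i' : Fin H, ∑ j' : Fin 3, (if i'.val = i.val + 1 then
          if j' = 2 then (1 : ℝ) else 0 else 0) = if i'.val = i.val + 1 then 1 else 0 := fun i' => by
        split_ifs <;> simp
      simp only [this]
      rw [sum_fin_ite_val _ (fun _ => (1 : ℝ)) _ (fun _ _ => rfl), if_pos h]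
  ρ := Sum.elim M.ρ fun _ => 0
  ρ_nonneg := by rintro (x | p) <;> simp [M.ρ_nonneg]
  ρ_layer := by
    rintro (x | p) h
    · exact M.ρ_layer x h
    · simp at h
  ρ_sum := by simp [M.ρ_sum]
  reward s _ := Measure.dirac (augReward s)
  reward_prob _ _ := inferInstance
  reward_mem := by
    intro s a
    rw [ae_dirac_eq]
    rcases s with x | p
    · simp [augReward]
    · exact newReward_mem p.2

theorem augMDP_meanReward {X A : Type*} [Fintype X] {H : ℕ} (hH : 2 ≤ H) (M : MTM X A H) (b : X → A → ℝ) (hb : ∀ x a, |b x a| ≤ 1)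
    (s : Aug X H) (a : A) : (augMDP hH M b hb).meanReward s a = augReward s := by
  simp [MDP.meanReward, augMDP]

theorem isAugmentation_augMDP {X A : Type*} [Fintype X] {H : ℕ} (hH : 2 ≤ H) (M : MTM X A H) (b : X → A → ℝ)
    (hb : ∀ x a, |b x a| ≤ 1) : IsAugmentation M (augMDP hH M b hb) where
  layer_old _ := rfl
  layer_new _ _ := rfl
  ρ_old _ := rfl
  T_old _ _ _ := rfl
  T_old_w x a i := by simp [augMDP, augT, newProb]
  T_new i j a i' h := by simp [augMDP, augT, h]
  reward_u i a := by simp [augMDP_meanReward, augReward, newReward]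
  reward_v i a := by simp [augMDP_meanReward, augReward, newReward]
  reward_w i a := by simp [augMDP_meanReward, augReward, newReward]
  reward_last x a _ := by simp [augMDP_meanReward, augReward]

/-- A sequence of probability distributions on state-action pairs for the layers `1, …, H - 1`. -/
structure IsFlow (H : ℕ) (ν : ℕ → X → A → ℝ) : Prop where
  nonneg : ∀ h x a, 0 ≤ ν h x a
  zero : ∀ x a, ν 0 x a = 0
  sum_one : ∀ h, 1 ≤ h → h < H → ∑ x, ∑ a, ν h x a = 1

theorem IsOfflineDist.isFlow {M : MTM X A H} {μ : ℕ → X → A → ℝ} (hμ : IsOfflineDist M μ) :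
    IsFlow H μ where
  nonneg := hμ.nonneg
  zero x a := by
    by_contra h
    have := hμ.support 0 x a h
    omega
  sum_one := hμ.sum_one

theorem MTM.isFlow_occSA (M : MTM X A H) (π : Policy X A) : IsFlow H (M.occSA π) where
  nonneg := M.occSA_nonneg π
  zero x a := by simp [MTM.occSA, MTM.occ]
  sum_one h h1 hH := by
    simp only [M.sum_occSA]
    exact M.sum_occ π h h1 hH.le

/-- The mass of the new states `u_h`, `v_h`, `w_h`, if `ν` is the flow through the original
states. -/
def newMass (H : ℕ) (b : X → A → ℝ) (ν : ℕ → X → A → ℝ) (h : ℕ) : Fin 3 → ℝ :=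
  ![surv H (h - 1) / H * ∑ x, ∑ a, ν (h - 1) x a * (1 + b x a),
    surv H (h - 1) / H * ∑ x, ∑ a, ν (h - 1) x a * (1 - b x a),
    1 - surv H (h - 1)]

theorem newMass_nonneg (hH : 2 ≤ H) {b : X → A → ℝ} (hb : ∀ x a, |b x a| ≤ 1)
    {ν : ℕ → X → A → ℝ} (hν : IsFlow H ν) (h : ℕ) (j : Fin 3) : 0 ≤ newMass H b ν h j := by
  have h1 := surv_le_one hH (h - 1)
  have h2 := (surv_pos hH (h - 1)).le
  have hb1 : ∀ x a, 0 ≤ 1 + b x a := fun x a => by have := abs_le.1 (hb x a); linarith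
  have hb2 : ∀ x a, 0 ≤ 1 - b x a := fun x a => by have := abs_le.1 (hb x a); linarith
  fin_cases j
  · exact mul_nonneg (div_nonneg h2 (Nat.cast_nonneg _)) (Finset.sum_nonneg fun x _ =>
      Finset.sum_nonneg fun a _ => mul_nonneg (hν.nonneg _ _ _) (hb1 x a))
  · exact mul_nonneg (div_nonneg h2 (Nat.cast_nonneg _)) (Finset.sum_nonneg fun x _ =>
      Finset.sum_nonneg fun a _ => mul_nonneg (hν.nonneg _ _ _) (hb2 x a))
  · simpa [newMass] using h1

/-- The states `u` and `v` receive the fraction `2/H` of the mass that survives in layer `h - 1`,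
whatever the bias. The state `w` receives all that had left before. -/
theorem newMass_sum (b : X → A → ℝ) {ν : ℕ → X → A → ℝ} (hν : IsFlow H ν) {h : ℕ}
    (h1 : 1 ≤ h) (hh : h < H) : ∑ j, newMass H b ν h j = 1 - surv H h := by
  have key : newMass H b ν h 0 + newMass H b ν h 1
      = surv H (h - 1) * (2 / H) * ∑ x, ∑ a, ν (h - 1) x a := by
    simp only [newMass, Matrix.cons_val_zero, Matrix.cons_val_one]
    rw [← mul_add, ← Finset.sum_add_distrib]
    simp only [← Finset.sum_add_distrib, ← mul_add]
    have : ∀ x a, ν (h - 1) x a * (1 + b x a + (1 - b x a)) = 2 * ν (h - 1) x a := fun x a => by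
      ring
    simp only [this, ← Finset.mul_sum]
    ring
  rw [Fin.sum_univ_three, key]
  simp only [newMass, Matrix.cons_val_two, Matrix.tail_cons, Matrix.head_cons]
  obtain ⟨k, rfl⟩ : ∃ k, h = k + 1 := ⟨h - 1, by omega⟩
  rw [Nat.add_sub_cancel]
  rcases Nat.eq_zero_or_pos k with rfl | hk
  -- In layer 1 nothing has arrived yet: the flow in layer 0 is zero, and `surv` equals 1 at both 0
  -- and 1.
  · simp [hν.zero, surv_zero, surv_one]
  · rw [hν.sum_one k hk (by omega), surv_succ hk hh]
    ring

open Classical in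
/-- The lift of a flow through the original states to the augmented model; the new states take
the action `a₀`. -/
def flowLift (b : X → A → ℝ) (a₀ : A) (ν : ℕ → X → A → ℝ) (h : ℕ) : Aug X H → A → ℝ
  | .inl x, a => surv H h * ν h x a
  | .inr (i, j), a => if i.val + 1 = h ∧ h < H ∧ a = a₀ then newMass H b ν h j else 0

theorem flowLift_nonneg (hH : 2 ≤ H) {b : X → A → ℝ} (hb : ∀ x a, |b x a| ≤ 1) (a₀ : A)
    {ν : ℕ → X → A → ℝ} (hν : IsFlow H ν) (h : ℕ) (s : Aug X H) (a : A) :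
    0 ≤ flowLift b a₀ ν h s a := by
  rcases s with x | ⟨i, j⟩ <;> simp only [flowLift]
  · exact mul_nonneg (surv_pos hH h).le (hν.nonneg _ _ _)
  · split_ifs
    · exact newMass_nonneg hH hb hν h j
    · exact le_rfl

theorem isOfflineDist_flowLift (hH : 2 ≤ H) {M : MTM X A H} {b : X → A → ℝ}
    (hb : ∀ x a, |b x a| ≤ 1) (a₀ : A) {μ : ℕ → X → A → ℝ} (hμ : IsOfflineDist M μ) :
    IsOfflineDist (augMDP hH M b hb).toMTM (flowLift b a₀ μ) where
  nonneg := flowLift_nonneg hH hb a₀ hμ.isFlow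
  support := by
    classical
    rintro h (x | ⟨i, j⟩) a h0 <;> simp only [flowLift] at h0
    · exact hμ.support h x a (right_ne_zero_of_mul h0)
    · by_cases hc : i.val + 1 = h ∧ h < H ∧ a = a₀
      · exact ⟨hc.1, by omega, hc.2.1⟩
      · exact absurd (if_neg hc) h0
  sum_one := by
    classical
    intro h h1 hh
    simp only [Fintype.sum_sum_type, flowLift, Fintype.sum_prod_type, ← Finset.mul_sum,
      hμ.sum_one h h1 hh]
    have h2 : ∀ (i : Fin H) (j : Fin 3),
        ∑ a : A, (if i.val + 1 = h ∧ h < H ∧ a = a₀ then newMass H b μ h j else 0)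
          = if i.val = h - 1 then newMass H b μ h j else 0 := by
      intro i j
      have h3 : ∀ a : A, (i.val + 1 = h ∧ h < H ∧ a = a₀) ↔ (i.val = h - 1 ∧ a = a₀) := fun a => by
        constructor
        · rintro ⟨h4, _, h5⟩
          exact ⟨by omega, h5⟩
        · rintro ⟨h4, h5⟩
          exact ⟨by omega, hh, h5⟩
      simp only [h3, ite_and]
      split_ifs <;> simp
    simp only [h2]
    rw [Finset.sum_comm]
    have h4 : ∀ j : Fin 3, ∑ i : Fin H, (if i.val = h - 1 then newMass H b μ h j else 0)
        = newMass H b μ h j := fun j => by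
      rw [sum_fin_ite_val _ (fun _ => newMass H b μ h j) _ (fun _ _ => rfl), if_pos (by omega)]
    simp only [h4, newMass_sum b hμ.isFlow h1 hh]
    ring

open Classical in
/-- The policy that acts as `π` on the original states and takes `a₀` on the new ones. -/
def augPolicy (H : ℕ) (π : Policy X A) (a₀ : A) : Policy (Aug X H) A where
  prob s a := Sum.elim (fun x => π.prob x a) (fun _ => if a = a₀ then 1 else 0) s
  nonneg := by
    rintro (x | p) a
    · exact π.nonneg x a
    · simp only [Sum.elim_inr]
      split_ifs <;> norm_num
  sum_one := by
    rintro (x | p)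
    · exact π.sum_one x
    · simp

theorem det_elim {X A : Type*} [Fintype A] {H : ℕ} (π : X → A) (a₀ : A) :
    Policy.det (S := Aug X H) (Sum.elim π fun _ => a₀) = augPolicy H (Policy.det π) a₀ := by
  have : (Policy.det (S := Aug X H) (Sum.elim π fun _ => a₀)).prob
      = (augPolicy H (Policy.det π) a₀).prob := by
    funext s a
    rcases s with x | p <;> rfl
  simp only [Policy.det, augPolicy] at this ⊢
  congr

theorem augMDP_occ (hH : 2 ≤ H) (M : MTM X A H) (b : X → A → ℝ) (hb : ∀ x a, |b x a| ≤ 1)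
    (π : Policy X A) (a₀ : A) (h : ℕ) (h1 : 1 ≤ h) (hh : h < H) :
    (∀ x, (augMDP hH M b hb).occ (augPolicy H π a₀) h (.inl x) = surv H h * M.occ π h x) ∧
    ∀ i j, (augMDP hH M b hb).occ (augPolicy H π a₀) h (.inr (i, j))
      = if i.val + 1 = h then newMass H b (M.occSA π) h j else 0 := by
  induction h, h1 using Nat.le_induction with
  | base =>
    constructor
    · intro x
      simp [surv_one, MTM.occ, augMDP]
    · intro i j
      have h0 : newMass H b (M.occSA π) 1 j = 0 := by
        fin_cases j <;> simp [newMass, MTM.occSA, MTM.occ, surv_zero]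
      simp [h0, MTM.occ, augMDP]
  | succ h h1 ih =>
    obtain ⟨ih1, ih2⟩ := ih (by omega)
    obtain ⟨k, rfl⟩ : ∃ k, h = k + 1 := ⟨h - 1, by omega⟩
    have hp : ∀ p : Fin H × Fin 3, ∑ a, (augPolicy H π a₀).prob (.inr p) a = 1 := fun p =>
      (augPolicy H π a₀).sum_one _
    constructor
    · intro x'
      have hT : ∀ p a, (augMDP hH M b hb).T (.inr p) a (.inl x') = 0 := fun _ _ => rfl
      have hT' : ∀ x a, (augMDP hH M b hb).T (.inl x) a (.inl x') = (1 - 2 / (H : ℝ)) * M.T x a x' :=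
        fun _ _ => rfl
      have hπ : ∀ x a, (augPolicy H π a₀).prob (.inl x) a = π.prob x a := fun _ _ => rfl
      rw [MTM.occ]
      simp only [Fintype.sum_sum_type, hT, hT', hπ, ih1, mul_zero, Finset.sum_const_zero, add_zero]
      rw [surv_succ h1 hh, MTM.occ, Finset.mul_sum]
      refine Finset.sum_congr rfl fun x _ => ?_
      rw [Finset.mul_sum]
      refine Finset.sum_congr rfl fun a _ => ?_
      ring
    · intro i j
      have hT : ∀ i' j' a, (augMDP hH M b hb).T (.inr (i', j')) a (.inr (i, j))
          = if i.val = i'.val + 1 ∧ j = 2 then 1 else 0 := fun _ _ _ => rfl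
      have hT' : ∀ x a, (augMDP hH M b hb).T (.inl x) a (.inr (i, j))
          = if i.val = M.layer x then newProb H (b x a) j else 0 := fun _ _ => rfl
      have hπ : ∀ x a, (augPolicy H π a₀).prob (.inl x) a = π.prob x a := fun _ _ => rfl
      rw [MTM.occ]
      simp only [Fintype.sum_sum_type, hT', hT, hπ, ih1]
      have hold : ∀ x a, surv H (k + 1) * M.occ π (k + 1) x * π.prob x a *
          (if i.val = M.layer x then newProb H (b x a) j else 0)
          = if i.val = k + 1 then surv H (k + 1) * (M.occSA π (k + 1) x a * newProb H (b x a) j)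
            else 0 := by
        intro x a
        by_cases h0 : M.occ π (k + 1) x = 0
        · simp [h0, MTM.occSA]
        · rw [M.layer_of_occ_ne_zero π _ _ h0, MTM.occSA]
          split_ifs <;> ring
      -- All new states move to `w`, so only their total mass `1 - surv H (k + 1)` matters.
      have hnew : ∑ p : Fin H × Fin 3, ∑ a,
          (augMDP hH M b hb).occ (augPolicy H π a₀) (k + 1) (.inr p) *
            (augPolicy H π a₀).prob (.inr p) a * (if i.val = p.1.val + 1 ∧ j = 2 then 1 else 0)
          = if i.val = k + 1 ∧ j = 2 then 1 - surv H (k + 1) else 0 := by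
        have h3 : ∀ p : Fin H × Fin 3, ∑ a,
          (augMDP hH M b hb).occ (augPolicy H π a₀) (k + 1) (.inr p) *
            (augPolicy H π a₀).prob (.inr p) a * (if i.val = p.1.val + 1 ∧ j = 2 then 1 else 0)
          = if p.1.val = k then (if i.val = k + 1 ∧ j = 2 then
              newMass H b (M.occSA π) (k + 1) p.2 else 0) else 0 := by
          rintro ⟨i', j'⟩
          rw [← Finset.sum_mul, ← Finset.mul_sum, hp, mul_one, ih2]
          by_cases hk : i'.val = k
          · simp [hk]
          · simp [hk]
        simp only [h3, Fintype.sum_prod_type]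
        rw [Finset.sum_comm]
        have h4 : ∀ j' : Fin 3, ∑ i' : Fin H, (if i'.val = k then (if i.val = k + 1 ∧ j = 2 then
              newMass H b (M.occSA π) (k + 1) j' else 0) else 0)
            = if i.val = k + 1 ∧ j = 2 then newMass H b (M.occSA π) (k + 1) j' else 0 := fun j' => by
          rw [sum_fin_ite_val _ (fun _ => _) _ (fun _ _ => rfl), if_pos (by omega)]
        simp only [h4]
        split_ifs
        · exact newMass_sum b (M.isFlow_occSA π) h1 (by omega)
        · simp
      simp only [hold]
      have hnew' := hnew
      simp only [Fintype.sum_prod_type] at hnew' ⊢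
      rw [hnew']
      by_cases hi : i.val = k + 1
      · simp only [hi, if_true, true_and]
        simp only [← Finset.mul_sum]
        fin_cases j
        · simp [newMass, newProb, mul_div_assoc', ← Finset.sum_div]
          ring
        · simp [newMass, newProb, mul_div_assoc', ← Finset.sum_div]
          ring
        · simp [newMass, newProb]
      · simp [hi]

/-- This is what dictates the form of `newMass`: the lift of an occupancy measure is again an
occupancy measure. It gives admissibility when applied to the behaviour policy, and concentrability
when applied to the evaluation policy. -/
theorem augMDP_occSA (hH : 2 ≤ H) (M : MTM X A H) (b : X → A → ℝ) (hb : ∀ x a, |b x a| ≤ 1)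
    (π : Policy X A) (a₀ : A) (h : ℕ) (h1 : 1 ≤ h) (hh : h < H) (s : Aug X H) (a : A) :
    (augMDP hH M b hb).occSA (augPolicy H π a₀) h s a = flowLift b a₀ (M.occSA π) h s a := by
  classical
  obtain ⟨ho, hn⟩ := augMDP_occ hH M b hb π a₀ h h1 hh
  rcases s with x | ⟨i, j⟩
  · rw [MTM.occSA, ho, flowLift, MTM.occSA]
    simp only [augPolicy, Sum.elim_inl]
    ring
  · rw [MTM.occSA, hn, flowLift]
    simp only [augPolicy, Sum.elim_inr]
    by_cases h1 : i.val + 1 = h <;> by_cases h2 : a = a₀ <;> simp [h1, h2, hh]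

theorem isAdmissible_flowLift (hH : 2 ≤ H) (M : MTM X A H) (b : X → A → ℝ)
    (hb : ∀ x a, |b x a| ≤ 1) (a₀ : A) {μ : ℕ → X → A → ℝ} (hμ : IsOfflineDist M μ)
    (ha : IsAdmissible M μ) : IsAdmissible (augMDP hH M b hb).toMTM (flowLift b a₀ μ) := by
  obtain ⟨πb, hπb⟩ := ha
  refine ⟨augPolicy H πb a₀, fun h h1 hh s a => ?_⟩
  rw [augMDP_occSA hH M b hb πb a₀ h h1 hh]
  -- The lift in layer `h` also reads the flow in layer `h - 1`, hence layer 0 is needed as well.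
  have hz : ∀ h, h < H → μ h = M.occSA πb h := fun h hh => by
    funext x a
    rcases Nat.eq_zero_or_pos h with rfl | h1
    · rw [hμ.isFlow.zero, (M.isFlow_occSA πb).zero]
    · exact hπb h h1 hh x a
  rcases s with x | ⟨i, j⟩ <;> simp only [flowLift, newMass, hz h hh, hz (h - 1) (by omega)]

theorem ratio_le_iff {p q : ℝ} (hp : 0 ≤ p) (hq : 0 ≤ q) {C : ℝ} (hC : 0 ≤ C) :
    ratio p q ≤ ENNReal.ofReal C ↔ p ≤ C * q := by
  rw [ratio]
  rcases hq.eq_or_lt with rfl | hq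
  · rcases hp.eq_or_lt with rfl | hp
    · simp
    · simp only [ENNReal.ofReal_zero, mul_zero, hp.not_ge, iff_false, not_le]
      rw [ENNReal.div_zero (by simpa using hp)]
      exact ENNReal.ofReal_lt_top
  · rw [ENNReal.div_le_iff (by simpa using hq) ENNReal.ofReal_ne_top, ← ENNReal.ofReal_mul hC,
      ENNReal.ofReal_le_ofReal_iff (by positivity)]

theorem occSA_le_mul {M : MTM X A H} {μ : ℕ → X → A → ℝ} (hμ : IsOfflineDist M μ) {π : X → A}
    {C : ℝ} (hC : 0 ≤ C) (hc : conc M μ π ≤ ENNReal.ofReal C) {h : ℕ} (hh : h < H) (x : X) (a : A) :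
    M.occSA (Policy.det π) h x a ≤ C * μ h x a := by
  by_cases h0 : M.occSA (Policy.det π) h x a = 0
  · rw [h0]
    exact mul_nonneg hC (hμ.nonneg _ _ _)
  · have hl := M.layer_of_occ_ne_zero _ h x (left_ne_zero_of_mul h0)
    have h1 : 1 ≤ h := hl ▸ M.layer_pos x
    exact (ratio_le_iff (M.occSA_nonneg _ _ _ _) (hμ.nonneg _ _ _) hC).1
      ((ratio_le_conc M μ π h1 hh x hl a).trans hc)

/-- On original states the common factor `surv` cancels. The masses of `u` and `v` are linear in the
flow with nonnegative coefficients, so they inherit any bound `d ≤ C * μ`. The mass of `w` does not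
depend on the flow, so there `C ≥ 1` suffices. -/
theorem conc_augMDP (hH : 2 ≤ H) (M : MTM X A H) (b : X → A → ℝ) (hb : ∀ x a, |b x a| ≤ 1)
    (a₀ : A) {μ : ℕ → X → A → ℝ} (hμ : IsOfflineDist M μ) (π : X → A) :
    conc (augMDP hH M b hb).toMTM (flowLift b a₀ μ) (Sum.elim π fun _ => a₀) = conc M μ π := by
  refine le_antisymm (conc_le fun h h1 hh s hs a => ?_) (conc_le fun h h1 hh x hx a => ?_)
  · rw [det_elim, augMDP_occSA hH M b hb _ a₀ h h1 hh]
    rcases eq_or_ne (conc M μ π) ⊤ with htop | htop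
    · rw [htop]
      exact le_top
    set C := (conc M μ π).toReal with hCd
    have hC : 0 ≤ C := ENNReal.toReal_nonneg
    have hCe : conc M μ π = ENNReal.ofReal C := (ENNReal.ofReal_toReal htop).symm
    have hd : ∀ h, h < H → ∀ x a, M.occSA (Policy.det π) h x a ≤ C * μ h x a := fun h hh x a =>
      occSA_le_mul hμ hC hCe.le hh x a
    -- Sum `d ≤ C * μ` over layer 1, where both sides are probability distributions up to the factor
    -- `C`.
    have hC1 : 1 ≤ C := by
      rw [← (M.isFlow_occSA (Policy.det π)).sum_one 1 le_rfl (by omega), ← mul_one C,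
        ← hμ.sum_one 1 le_rfl (by omega), Finset.mul_sum]
      refine Finset.sum_le_sum fun x _ => ?_
      rw [Finset.mul_sum]
      exact Finset.sum_le_sum fun a _ => hd 1 (by omega) x a
    have hs0 := surv_pos hH
    have hb1 : ∀ x a, 0 ≤ 1 + b x a := fun x a => by have := abs_le.1 (hb x a); linarith
    have hb2 : ∀ x a, 0 ≤ 1 - b x a := fun x a => by have := abs_le.1 (hb x a); linarith
    have hsum : ∀ B : X → A → ℝ, (∀ x a, 0 ≤ B x a) →
        surv H (h - 1) / H * ∑ x, ∑ a, M.occSA (Policy.det π) (h - 1) x a * B x a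
          ≤ C * (surv H (h - 1) / H * ∑ x, ∑ a, μ (h - 1) x a * B x a) := by
      intro B hB
      rw [mul_left_comm]
      refine mul_le_mul_of_nonneg_left ?_ (div_nonneg (hs0 _).le (Nat.cast_nonneg _))
      rw [Finset.mul_sum]
      refine Finset.sum_le_sum fun x _ => ?_
      rw [Finset.mul_sum]
      refine Finset.sum_le_sum fun a _ => ?_
      rw [← mul_assoc]
      exact mul_le_mul_of_nonneg_right (hd _ (by omega) x a) (hB x a)
    rw [hCe, ratio_le_iff (flowLift_nonneg hH hb a₀ (M.isFlow_occSA _) _ _ _)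
      (flowLift_nonneg hH hb a₀ hμ.isFlow _ _ _) hC]
    rcases s with x | ⟨i, j⟩ <;> simp only [flowLift]
    · rw [mul_left_comm]
      exact mul_le_mul_of_nonneg_left (hd h hh x a) (hs0 h).le
    · split_ifs
      · fin_cases j
        · exact hsum _ hb1
        · exact hsum _ hb2
        · have := surv_le_one hH (h - 1)
          simp only [newMass, Fin.reduceFinMk, Matrix.cons_val]
          nlinarith
      · simp
  · refine le_trans (le_of_eq ?_) (ratio_le_conc (augMDP hH M b hb).toMTM (flowLift b a₀ μ)
      (Sum.elim π fun _ => a₀) h1 hh (.inl x) hx a)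
    rw [det_elim, augMDP_occSA hH M b hb _ a₀ h h1 hh, flowLift, flowLift,
      ratio_mul_left (surv_pos hH h)]

/-- The extension of a function by the rewards of the new states. -/
def augFun (f : X → A → ℝ) : Aug X H → A → ℝ
  | .inl x, a => f x a
  | .inr (_, j), _ => newReward j

/-- The passage through `u` and `v` pays `2b/H` in expectation, so `hf` and `hf0` are Bellman's
equation on the original states. From a new state only `w` can follow, which is worth nothing, so
its value is its own reward. -/
theorem augMDP_Q (hH : 2 ≤ H) (M : MTM X A H) (b : X → A → ℝ) (hb : ∀ x a, |b x a| ≤ 1)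
    (π : X → A) (a₀ : A) (f : X → A → ℝ)
    (hf : ∀ x a, M.layer x < H →
      f x a = (1 - 2 / (H : ℝ)) * ∑ x', M.T x a x' * f x' (π x') + 2 / H * b x a)
    (hf0 : ∀ x a, M.layer x = H → f x a = 0) (s : Aug X H) (a : A) :
    (augMDP hH M b hb).Q (Policy.det (Sum.elim π fun _ => a₀)) s a = augFun f s a := by
  set L := augMDP hH M b hb with hL
  set πL : Aug X H → A := Sum.elim π fun _ => a₀ with hπL
  have key : ∀ k s a, L.layer s + k = H + 1 →
      L.qSteps (Policy.det πL) k s a = augFun f s a := by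
    intro k
    induction k with
    | zero =>
      intro s a hs
      have := L.layer_le s
      omega
    | succ k ih =>
      intro s a hs
      have h1 : ∑ s', L.T s a s' * ∑ a', (Policy.det πL).prob s' a' *
          L.qSteps (Policy.det πL) k s' a' = ∑ s', L.T s a s' * augFun f s' (πL s') := by
        refine Finset.sum_congr rfl fun s' _ => ?_
        rw [Policy.det_prob_mul_sum]
        by_cases h0 : L.T s a s' = 0
        · simp [h0]
        · rw [ih s' _ (by rw [L.T_layer s a s' h0]; omega)]
      rw [MDP.qSteps]
      beta_reduce
      rw [h1, hL, augMDP_meanReward, ← hL, Fintype.sum_sum_type]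
      rcases s with x | ⟨i, j⟩
      · have h2 : ∑ p : Fin H × Fin 3, L.T (.inl x) a (.inr p) * augFun f (.inr p) (πL (.inr p))
            = if M.layer x < H then 2 / H * b x a else 0 := by
          simp only [Fintype.sum_prod_type]
          have h3 : ∀ i : Fin H, ∑ j, L.T (.inl x) a (.inr (i, j)) *
              augFun f (.inr (i, j)) (πL (.inr (i, j)))
              = if i.val = M.layer x then 2 / H * b x a else 0 := by
            intro i
            change ∑ j, (if i.val = M.layer x then newProb H (b x a) j else 0) * newReward j = _
            split_ifs
            · simp [Fin.sum_univ_three, newProb, newReward]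
              ring
            · simp
          simp only [h3]
          exact sum_fin_ite_val _ (fun _ => 2 / H * b x a) _ fun _ _ => rfl
        have h4 : ∑ x', L.T (.inl x) a (.inl x') * augFun (H := H) f (.inl x') (πL (.inl x'))
            = (1 - 2 / (H : ℝ)) * ∑ x', M.T x a x' * f x' (π x') := by
          rw [Finset.mul_sum]
          exact Finset.sum_congr rfl fun x' _ => mul_assoc _ _ _
        rw [h2, h4]
        simp only [augReward, Sum.elim_inl, augFun, zero_add]
        rcases (M.layer_le x).lt_or_eq with hx | hx
        · rw [if_pos hx, hf x a hx]
        · rw [if_neg (by omega), hf0 x a hx]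
          simp [M.T_eq_zero_of_layer_eq hx]
      · have h2 : ∀ x', L.T (.inr (i, j)) a (.inl x') = 0 := fun _ => rfl
        have h3 : ∀ p : Fin H × Fin 3, L.T (.inr (i, j)) a (.inr p) *
            augFun f (.inr p) (πL (.inr p)) = 0 := by
          rintro ⟨i', j'⟩
          change (if i'.val = i.val + 1 ∧ j' = 2 then (1 : ℝ) else 0) * newReward j' = 0
          split_ifs with h
          · simp [h.2, newReward]
          · simp
        rw [Finset.sum_eq_zero fun x' _ => by rw [h2, zero_mul], Finset.sum_eq_zero fun p _ => h3 p]
        simp [augReward, augFun]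
  refine key _ s a ?_
  have := L.layer_le s
  omega

theorem augMDP_V (hH : 2 ≤ H) (M : MTM X A H) (b : X → A → ℝ) (hb : ∀ x a, |b x a| ≤ 1)
    (π : X → A) (a₀ : A) (f : X → A → ℝ)
    (hf : ∀ x a, M.layer x < H →
      f x a = (1 - 2 / (H : ℝ)) * ∑ x', M.T x a x' * f x' (π x') + 2 / H * b x a)
    (hf0 : ∀ x a, M.layer x = H → f x a = 0) :
    (augMDP hH M b hb).V (Policy.det (Sum.elim π fun _ => a₀)) = ∑ x, M.ρ x * f x (π x) := by
  simp only [MDP.V, Policy.det_prob_mul_sum, augMDP_Q hH M b hb π a₀ f hf hf0,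
    Fintype.sum_sum_type]
  simp [augMDP, augFun]

end Augmentation

/-! ### The value function of the aggregated dynamics and its bias -/

noncomputable section AggregatedValue

variable {X A : Type*} [Fintype X] {H : ℕ} {M : MTM X A H}

/-- The aggregate of a state. -/
def AggScheme.cell (Φ : AggScheme M) (x : X) : Finset X := (Φ.cover x).choose

theorem AggScheme.cell_mem_parts (Φ : AggScheme M) (x : X) : Φ.cell x ∈ Φ.parts :=
  (Φ.cover x).choose_spec.1

theorem AggScheme.mem_cell (Φ : AggScheme M) (x : X) : x ∈ Φ.cell x :=
  (Φ.cover x).choose_spec.2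

theorem AggScheme.cell_eq (Φ : AggScheme M) {φ : Finset X} (hφ : φ ∈ Φ.parts) {x : X}
    (hx : x ∈ φ) : Φ.cell x = φ :=
  Φ.disjoint _ (Φ.cell_mem_parts x) _ hφ x (Φ.mem_cell x) hx

theorem AggScheme.cell_eq_cell (Φ : AggScheme M) {x y : X} (h : y ∈ Φ.cell x) :
    Φ.cell y = Φ.cell x := Φ.cell_eq (Φ.cell_mem_parts x) h

theorem AggScheme.layer_eq (Φ : AggScheme M) {x y : X} (h : Φ.cell x = Φ.cell y) :
    M.layer x = M.layer y :=
  Φ.layered _ (Φ.cell_mem_parts y) x (h ▸ Φ.mem_cell x) y (Φ.mem_cell y)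

theorem AggScheme.mem_atLayer (Φ : AggScheme M) {h : ℕ} {φ : Finset X} :
    φ ∈ Φ.atLayer h ↔ φ ∈ Φ.parts ∧ ∀ x ∈ φ, M.layer x = h := by
  simp only [AggScheme.atLayer, Finset.mem_filter]

theorem AggScheme.sum_atLayer (Φ : AggScheme M) (h : ℕ) (g : X → ℝ)
    (hg : ∀ x, g x ≠ 0 → M.layer x = h) : ∑ φ ∈ Φ.atLayer h, ∑ x ∈ φ, g x = ∑ x, g x := by
  classical
  rw [← Finset.sum_biUnion]
  · refine Finset.sum_subset (Finset.subset_univ _) fun x _ hx => ?_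
    by_contra h0
    refine hx (Finset.mem_biUnion.2 ⟨Φ.cell x, Φ.mem_atLayer.2 ⟨Φ.cell_mem_parts x, ?_⟩,
      Φ.mem_cell x⟩)
    intro y hy
    rw [Φ.layer_eq (Φ.cell_eq_cell hy), hg x h0]
  · intro φ hφ φ' hφ' hne
    refine Finset.disjoint_left.2 fun x hx hx' => hne ?_
    exact Φ.disjoint φ (Φ.mem_atLayer.1 hφ).1 φ' (Φ.mem_atLayer.1 hφ').1 x hx hx'

theorem MTM.abs_sum_T_mul_le (M : MTM X A H) (x : X) (a : A) (g : X → ℝ) {r : ℝ} (hr : 0 ≤ r)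
    (hg : ∀ x, |g x| ≤ r) : |∑ x', M.T x a x' * g x'| ≤ r := by
  have h1 : ∑ x', M.T x a x' ≤ 1 := by
    rcases (M.layer_le x).lt_or_eq with h | h
    · exact (M.T_sum x a h).le
    · simp [M.T_eq_zero_of_layer_eq h]
  calc |∑ x', M.T x a x' * g x'| ≤ ∑ x', |M.T x a x' * g x'| := Finset.abs_sum_le_sum_abs _ _
    _ ≤ ∑ x', M.T x a x' * r := Finset.sum_le_sum fun x' _ => by
        rw [abs_mul, abs_of_nonneg (M.T_nonneg _ _ _)]
        exact mul_le_mul_of_nonneg_left (hg x') (M.T_nonneg _ _ _)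
    _ = (∑ x', M.T x a x') * r := by rw [Finset.sum_mul]
    _ ≤ r := mul_le_of_le_one_left hr h1

variable (Φ : AggScheme M) (μ : ℕ → X → A → ℝ) (π : X → A) (h₀ : ℕ) (I : Finset (Finset X))
  (r : ℝ)

open Classical in
/-- The value function of the aggregated dynamics for `k` steps, if a reward `r` is collected in
the aggregates in `I` of layer `h₀`. -/
def valueSteps : ℕ → X → A → ℝ
  | 0 => fun x a => if M.layer x = h₀ ∧ Φ.cell x ∈ I ∧ a = π x then r else 0
  | k + 1 => fun x a =>
      (∑ y ∈ Φ.cell x, μ (M.layer x) y a *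
        ((1 - 2 / (H : ℝ)) * ∑ x', M.T y a x' * valueSteps k x' (π x'))) /
          ∑ y ∈ Φ.cell x, μ (M.layer x) y a

/-- The value function of the aggregated dynamics, if a reward `r` is collected in the aggregates
in `I` of layer `h₀`. -/
def aggValue (x : X) (a : A) : ℝ :=
  if M.layer x ≤ h₀ then valueSteps Φ μ π h₀ I r (h₀ - M.layer x) x a else 0

/-- The bias between `u` and `v` that makes `aggValue` the value function of the augmented
model. -/
def bias (x : X) (a : A) : ℝ :=
  H / 2 * (aggValue Φ μ π h₀ I r x a
    - (1 - 2 / (H : ℝ)) * ∑ x', M.T x a x' * aggValue Φ μ π h₀ I r x' (π x'))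

open Classical in
/-- The bias that cannot be averaged out over the aggregates. -/
def coreBias (x : X) (a : A) : ℝ :=
  if M.layer x = h₀ ∧ Φ.cell x ∈ I ∧ a = π x then H / 2 * r else 0

variable {μ π h₀ I r}

-- The defining formulas read the state only through its layer, its aggregate and, in layer `h₀`,
-- its evaluation action. The last is where the policy has to be constant on aggregates.
variable (μ h₀ I r) in
theorem aggValue_congr (hπ : ∀ φ ∈ Φ.parts, ∀ x ∈ φ, ∀ y ∈ φ, π x = π y) {x y : X}
    (h : Φ.cell x = Φ.cell y) (a : A) :
    aggValue Φ μ π h₀ I r x a = aggValue Φ μ π h₀ I r y a := by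
  have hl := Φ.layer_eq h
  have hp : π x = π y := hπ _ (Φ.cell_mem_parts y) x (h ▸ Φ.mem_cell x) y (Φ.mem_cell y)
  rw [aggValue, aggValue, hl]
  congr 1
  cases h₀ - M.layer y with
  | zero =>
    simp only [valueSteps]
    congr 1
    rw [hl, h, hp]
  | succ k => simp only [valueSteps, hl, h]

variable (h₀ I) in
theorem abs_valueSteps_le (hH : 2 ≤ H) (hμ : ∀ h x a, 0 ≤ μ h x a) (hr : 0 ≤ r) :
    ∀ k x a, |valueSteps Φ μ π h₀ I r k x a| ≤ r
  | 0, x, a => by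
      simp only [valueSteps]
      split_ifs
      · rw [abs_of_nonneg hr]
      · simpa using hr
  | k + 1, x, a => by
      simp only [valueSteps]
      have h2 := two_div_le_one hH
      have h3 : (0 : ℝ) ≤ 2 / H := by positivity
      have hD : 0 ≤ ∑ y ∈ Φ.cell x, μ (M.layer x) y a := Finset.sum_nonneg fun y _ => hμ _ _ _
      rw [abs_div, abs_of_nonneg hD]
      refine div_le_of_le_mul₀ hD hr ?_
      refine (Finset.abs_sum_le_sum_abs _ _).trans ?_
      rw [Finset.mul_sum]
      refine Finset.sum_le_sum fun y _ => ?_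
      rw [abs_mul, abs_of_nonneg (hμ _ _ _), mul_comm r]
      refine mul_le_mul_of_nonneg_left ?_ (hμ _ _ _)
      rw [abs_mul, abs_of_nonneg (by linarith)]
      have := M.abs_sum_T_mul_le y a (fun x' => valueSteps Φ μ π h₀ I r k x' (π x')) hr
        fun x' => abs_valueSteps_le hH hμ hr k x' _
      nlinarith

variable (h₀ I) in
theorem abs_aggValue_le (hH : 2 ≤ H) (hμ : ∀ h x a, 0 ≤ μ h x a) (hr : 0 ≤ r) (x : X) (a : A) :
    |aggValue Φ μ π h₀ I r x a| ≤ r := by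
  rw [aggValue]
  split_ifs
  · exact abs_valueSteps_le Φ h₀ I hH hμ hr _ x a
  · simpa using hr

theorem aggValue_of_gt {x : X} (hx : h₀ < M.layer x) (a : A) : aggValue Φ μ π h₀ I r x a = 0 :=
  if_neg (by omega)

theorem aggValue_of_lt {x : X} (hx : M.layer x < h₀) (a : A) :
    aggValue Φ μ π h₀ I r x a = (∑ y ∈ Φ.cell x, μ (M.layer x) y a *
        ((1 - 2 / (H : ℝ)) * ∑ x', M.T y a x' * aggValue Φ μ π h₀ I r x' (π x'))) /
          ∑ y ∈ Φ.cell x, μ (M.layer x) y a := by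
  obtain ⟨k, hk⟩ : ∃ k, h₀ - M.layer x = k + 1 := ⟨h₀ - M.layer x - 1, by omega⟩
  rw [aggValue, if_pos hx.le, hk]
  simp only [valueSteps]
  congr 1
  refine Finset.sum_congr rfl fun y hy => ?_
  congr 2
  refine Finset.sum_congr rfl fun x' _ => ?_
  by_cases h0 : M.T y a x' = 0
  · simp [h0]
  · have h1 := M.T_layer y a x' h0
    rw [Φ.layer_eq (Φ.cell_eq_cell hy)] at h1
    rw [aggValue, if_pos (by omega), show h₀ - M.layer x' = k by omega]

theorem bellman_bias (hH : 2 ≤ H) (x : X) (a : A) : aggValue Φ μ π h₀ I r x a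
    = (1 - 2 / (H : ℝ)) * ∑ x', M.T x a x' * aggValue Φ μ π h₀ I r x' (π x')
      + 2 / H * bias Φ μ π h₀ I r x a := by
  have : (0 : ℝ) < H := by exact_mod_cast (by omega : 0 < H)
  rw [bias, ← mul_assoc, div_mul_div_comm, mul_comm 2 (H : ℝ), div_self (by positivity)]
  ring

-- The function and its backup are both bounded by `r`, so the bias is at most `H/2 * 2r = H * r`.
-- The condition `H * r ≤ 1` thus makes `(1 ± b)/H` nonnegative.
variable (h₀ I) in
theorem abs_bias_le (hH : 2 ≤ H) (hμ : ∀ h x a, 0 ≤ μ h x a) (hr : 0 ≤ r) (hr1 : H * r ≤ 1)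
    (x : X) (a : A) : |bias Φ μ π h₀ I r x a| ≤ 1 := by
  have h2 := two_div_le_one hH
  have h3 : (0 : ℝ) ≤ 2 / H := by positivity
  have h4 := abs_le.1 (M.abs_sum_T_mul_le x a (fun x' => aggValue Φ μ π h₀ I r x' (π x')) hr
    fun x' => abs_aggValue_le Φ h₀ I hH hμ hr _ _)
  have h5 := abs_le.1 (abs_aggValue_le (π := π) Φ h₀ I hH hμ hr x a)
  rw [bias, abs_mul, abs_of_nonneg (by positivity)]
  have h6 : |aggValue Φ μ π h₀ I r x a - (1 - 2 / (H : ℝ)) *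
      ∑ x', M.T x a x' * aggValue Φ μ π h₀ I r x' (π x')| ≤ 2 * r := by
    rw [abs_le]
    constructor <;> nlinarith
  have h7 : (0 : ℝ) ≤ H / 2 := by positivity
  nlinarith

open Classical in
theorem aggValue_at {x : X} (hx : M.layer x = h₀) (a : A) :
    aggValue Φ μ π h₀ I r x a = if Φ.cell x ∈ I ∧ a = π x then r else 0 := by
  rw [aggValue, if_pos hx.le, hx, Nat.sub_self, valueSteps]
  simp only [hx, true_and]

theorem sum_T_aggValue_of_ge {x : X} (hx : h₀ ≤ M.layer x) (a : A) :
    ∑ x', M.T x a x' * aggValue Φ μ π h₀ I r x' (π x') = 0 := by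
  refine Finset.sum_eq_zero fun x' _ => ?_
  by_cases h0 : M.T x a x' = 0
  · simp [h0]
  · rw [aggValue_of_gt Φ (by rw [M.T_layer x a x' h0]; omega), mul_zero]

variable [Fintype A]

/-- Within each aggregate, the bias averages to the core bias. -/
theorem sum_cell_bias (hμ : IsOfflineDist M μ)
    (hπ : ∀ φ ∈ Φ.parts, ∀ x ∈ φ, ∀ y ∈ φ, π x = π y) (h : ℕ) (x : X) (a : A) :
    ∑ y ∈ Φ.cell x, μ h y a * (bias Φ μ π h₀ I r y a - coreBias Φ π h₀ I r y a) = 0 := by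
  by_cases hx : M.layer x = h
  swap
  · refine Finset.sum_eq_zero fun y hy => ?_
    have : μ h y a = 0 := by
      by_contra h0
      exact hx ((Φ.layer_eq (Φ.cell_eq_cell hy)).symm.trans (hμ.support h y a h0).1)
    rw [this, zero_mul]
  have hly : ∀ y ∈ Φ.cell x, M.layer y = h := fun y hy =>
    (Φ.layer_eq (Φ.cell_eq_cell hy)).trans hx
  rcases lt_trichotomy h h₀ with hlt | heq | hgt
  -- Before layer `h₀` the value `N / D` on the aggregate is the `μ`-average of the backups, so
  -- their deviations from it cancel.
  · have hc : ∀ y ∈ Φ.cell x, coreBias Φ π h₀ I r y a = 0 := fun y hy =>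
      if_neg (by rw [hly y hy]; omega)
    set D := ∑ y ∈ Φ.cell x, μ h y a with hD
    set N := ∑ y ∈ Φ.cell x, μ h y a *
      ((1 - 2 / (H : ℝ)) * ∑ x', M.T y a x' * aggValue Φ μ π h₀ I r x' (π x')) with hN
    have hF : aggValue Φ μ π h₀ I r x a = N / D := by
      rw [aggValue_of_lt Φ (by omega), hx]
    -- If `D = 0`, all weights vanish and `N = 0` too, in accordance with `0 / 0 = 0`.
    have hDN : D * (N / D) = N := by
      by_cases h0 : D = 0
      · have h1 : ∀ y ∈ Φ.cell x, μ h y a = 0 :=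
          (Finset.sum_eq_zero_iff_of_nonneg fun y _ => hμ.nonneg _ _ _).1 h0
        rw [h0, zero_mul, hN, Finset.sum_eq_zero]
        intro y hy
        rw [h1 y hy, zero_mul]
      · field_simp
    have : ∀ y ∈ Φ.cell x, μ h y a * (bias Φ μ π h₀ I r y a - coreBias Φ π h₀ I r y a)
        = H / 2 * (μ h y a * (N / D)) - H / 2 * (μ h y a *
      ((1 - 2 / (H : ℝ)) * ∑ x', M.T y a x' * aggValue Φ μ π h₀ I r x' (π x'))) := fun y hy => by
      rw [hc y hy, bias, aggValue_congr Φ μ h₀ I r hπ (Φ.cell_eq_cell hy) a, hF]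
      ring
    rw [Finset.sum_congr rfl this, Finset.sum_sub_distrib, ← Finset.mul_sum, ← Finset.mul_sum,
      ← Finset.sum_mul, ← hD, ← hN, hDN, sub_self]
  -- In layer `h₀` nothing is collected later, so the backup is zero and the bias equals the core
  -- bias pointwise.
  · refine Finset.sum_eq_zero fun y hy => ?_
    have hl : M.layer y = h₀ := (hly y hy).trans heq
    rw [bias, sum_T_aggValue_of_ge Φ hl.ge, aggValue_at Φ hl, coreBias]
    by_cases hc : Φ.cell y ∈ I ∧ a = π y
    · rw [if_pos hc, if_pos ⟨hl, hc⟩]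
      ring
    · rw [if_neg hc, if_neg fun h => hc h.2]
      ring
  · refine Finset.sum_eq_zero fun y hy => ?_
    have hl : h₀ < M.layer y := by rw [hly y hy]; exact hgt
    rw [bias, sum_T_aggValue_of_ge Φ hl.le, aggValue_of_gt Φ hl, coreBias, if_neg (by omega)]
    simp

theorem aggT_det (h : ℕ) (φ φ' : Finset X) : aggT M μ (Policy.det π) h φ φ'
    = (∑ x ∈ φ, ∑ x' ∈ φ', μ h x (π x) * M.T x (π x) x') / ∑ x ∈ φ, μ h x (π x) := by
  simp only [aggT, mul_assoc, Policy.det_prob_mul_sum]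

/-- The expected value in layer `h`, under the aggregated occupancy measure. -/
theorem sum_aggOcc_mul_aggValue
    (hπ : ∀ φ ∈ Φ.parts, ∀ x ∈ φ, ∀ y ∈ φ, π x = π y) (hI : I ⊆ Φ.atLayer h₀) (h1 : 1 ≤ h₀) :
    ∑ x, M.ρ x * aggValue Φ μ π h₀ I r x (π x)
      = (1 - 2 / (H : ℝ)) ^ (h₀ - 1) * (r * ∑ φ ∈ I, aggOcc M Φ μ (Policy.det π) h₀ φ) := by
  classical
  let v : Finset X → ℝ := fun φ =>
    if hφ : φ.Nonempty then aggValue Φ μ π h₀ I r hφ.choose (π hφ.choose) else 0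
  have hv : ∀ φ ∈ Φ.parts, ∀ x ∈ φ, v φ = aggValue Φ μ π h₀ I r x (π x) := by
    intro φ hφ x hx
    have hn : φ.Nonempty := ⟨x, hx⟩
    simp only [v, dif_pos hn]
    rw [hπ φ hφ _ hn.choose_spec x hx]
    exact aggValue_congr Φ μ h₀ I r hπ (by rw [Φ.cell_eq hφ hn.choose_spec, Φ.cell_eq hφ hx]) _
  -- The values on aggregates are pulled back by the same kernel `aggT` that pushes `aggOcc`
  -- forward. The conventions for a vanishing denominator agree.
  have hstep : ∀ h, h < h₀ → ∀ φ ∈ Φ.atLayer h, v φ = (1 - 2 / (H : ℝ)) *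
      ∑ φ' ∈ Φ.atLayer (h + 1), aggT M μ (Policy.det π) h φ φ' * v φ' := by
    intro h hh φ hφ
    obtain ⟨hφp, hφl⟩ := Φ.mem_atLayer.1 hφ
    obtain ⟨x, hx⟩ := Φ.nonempty φ hφp
    have hπx : ∀ y ∈ φ, π y = π x := fun y hy => hπ φ hφp y hy x hx
    rw [hv φ hφp x hx, aggValue_of_lt Φ (by rw [hφl x hx]; exact hh), Φ.cell_eq hφp hx, hφl x hx]
    simp only [aggT_det, div_mul_eq_mul_div]
    rw [← Finset.sum_div, mul_div_assoc']
    congr 1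
    · rw [Finset.mul_sum]
      have h2 : ∀ φ' ∈ Φ.atLayer (h + 1), (1 - 2 / (H : ℝ)) *
          ((∑ y ∈ φ, ∑ x' ∈ φ', μ h y (π y) * M.T y (π y) x') * v φ')
          = ∑ y ∈ φ, ∑ x' ∈ φ', (1 - 2 / (H : ℝ)) * (μ h y (π x) * (M.T y (π x) x' *
            aggValue Φ μ π h₀ I r x' (π x'))) := by
        intro φ' hφ'
        rw [Finset.sum_mul, Finset.mul_sum]
        refine Finset.sum_congr rfl fun y hy => ?_
        rw [Finset.sum_mul, Finset.mul_sum]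
        refine Finset.sum_congr rfl fun x' hx' => ?_
        rw [hv φ' (Φ.mem_atLayer.1 hφ').1 x' hx', hπx y hy]
        ring
      rw [Finset.sum_congr rfl h2, Finset.sum_comm]
      refine Finset.sum_congr rfl fun y hy => ?_
      rw [Φ.sum_atLayer (h + 1) (fun x' => (1 - 2 / (H : ℝ)) * (μ h y (π x) * (M.T y (π x) x' *
            aggValue Φ μ π h₀ I r x' (π x'))))]
      · rw [Finset.mul_sum, Finset.mul_sum]
        refine Finset.sum_congr rfl fun x' _ => ?_
        ring
      · intro x' h0
        rw [M.T_layer y (π x) x' fun hT => h0 (by simp [hT]), hφl y hy]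
    · exact Finset.sum_congr rfl fun y hy => by rw [hπx y hy]
  -- By this duality the pairing of occupancy and value can be moved forward layer by layer, with
  -- one factor `1 - 2/H` per step, until it reaches the reward on `I`.
  have hJ : ∀ k, k < h₀ → ∑ x, M.ρ x * aggValue Φ μ π h₀ I r x (π x)
      = (1 - 2 / (H : ℝ)) ^ k *
        ∑ φ ∈ Φ.atLayer (k + 1), aggOcc M Φ μ (Policy.det π) (k + 1) φ * v φ := by
    intro k
    induction k with
    | zero =>
      intro _
      rw [pow_zero, one_mul, ← Φ.sum_atLayer 1 _ fun x h0 => M.ρ_layer x (left_ne_zero_of_mul h0)]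
      refine Finset.sum_congr rfl fun φ hφ => ?_
      simp only [aggOcc]
      rw [Finset.sum_mul]
      exact Finset.sum_congr rfl fun x hx => by rw [hv φ (Φ.mem_atLayer.1 hφ).1 x hx]
    | succ k ih =>
      intro hk
      rw [ih (by omega), pow_succ, mul_assoc]
      congr 1
      rw [Finset.sum_congr rfl fun φ hφ => by rw [hstep (k + 1) (by omega) φ hφ]]
      simp only [aggOcc, Finset.sum_mul]
      rw [Finset.sum_comm, Finset.mul_sum]
      refine Finset.sum_congr rfl fun φ _ => ?_
      rw [mul_left_comm, Finset.mul_sum]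
      congr 1
      refine Finset.sum_congr rfl fun φ' _ => ?_
      ring
  rw [hJ (h₀ - 1) (by omega), Nat.sub_add_cancel h1]
  congr 1
  have h2 : ∀ φ ∈ Φ.atLayer h₀, aggOcc M Φ μ (Policy.det π) h₀ φ * v φ
      = if φ ∈ I then r * aggOcc M Φ μ (Policy.det π) h₀ φ else 0 := by
    intro φ hφ
    obtain ⟨hφp, hφl⟩ := Φ.mem_atLayer.1 hφ
    obtain ⟨x, hx⟩ := Φ.nonempty φ hφp
    rw [hv φ hφp x hx, aggValue_at Φ (hφl x hx), Φ.cell_eq hφp hx]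
    simp only [and_true]
    split_ifs <;> ring
  rw [Finset.sum_congr rfl h2, ← Finset.sum_filter, Finset.filter_mem_eq_inter,
    Finset.inter_eq_right.2 hI, Finset.mul_sum]

end AggregatedValue

/-! ### Random decoders and the hard problems -/

noncomputable section RandomDecoder

variable {X A : Type*} [Fintype X] {H : ℕ} {M : MTM X A H}

/-- The permutations of the states that preserve the aggregates. -/
def AggScheme.cellPerm (Φ : AggScheme M) : Subgroup (Equiv.Perm X) where
  carrier := {σ | ∀ x, Φ.cell (σ x) = Φ.cell x}
  mul_mem' hσ hσ' x := (hσ _).trans (hσ' x)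
  one_mem' _ := rfl
  inv_mem' {σ} hσ x := by
    have := hσ (σ⁻¹ x)
    rwa [show σ (σ⁻¹ x) = x by simp, eq_comm] at this

instance (Φ : AggScheme M) : Fintype Φ.cellPerm := Fintype.ofFinite _

theorem AggScheme.mem_cell_iff (Φ : AggScheme M) {x y : X} :
    y ∈ Φ.cell x ↔ Φ.cell y = Φ.cell x :=
  ⟨Φ.cell_eq_cell, fun h => h ▸ Φ.mem_cell y⟩

theorem AggScheme.sum_cell_perm (Φ : AggScheme M) (σ : Φ.cellPerm) (x : X) (F : X → ℝ) :
    ∑ y ∈ Φ.cell x, F (σ.1 y) = ∑ y ∈ Φ.cell x, F y := by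
  refine Finset.sum_equiv σ.1 (fun y => ?_) fun y _ => rfl
  rw [Φ.mem_cell_iff, Φ.mem_cell_iff, σ.2 y]

/-- A function that averages to zero over each aggregate averages to zero over the decoders. -/
theorem AggScheme.expect_perm_eq_zero (Φ : AggScheme M) {m : ℕ} (F : X → ℝ)
    (hF : ∀ x, ∑ y ∈ Φ.cell x, F y = 0) (j : Fin m) (x : X) :
    𝔼 τ : Fin m → Φ.cellPerm, F ((τ j).1 x) = 0 := by
  classical
  -- Right multiplication by the transposition of two states of one aggregate permutes the decoders,
  -- so the expectation is constant on the aggregate.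
  have h1 : ∀ y ∈ Φ.cell x, 𝔼 τ : Fin m → Φ.cellPerm, F ((τ j).1 y)
      = 𝔼 τ : Fin m → Φ.cellPerm, F ((τ j).1 x) := by
    intro y hy
    have hs : Equiv.swap x y ∈ Φ.cellPerm := by
      intro z
      rcases eq_or_ne z x with rfl | hzx
      · rw [Equiv.swap_apply_left, Φ.cell_eq_cell hy]
      rcases eq_or_ne z y with rfl | hzy
      · rw [Equiv.swap_apply_right, Φ.cell_eq_cell hy]
      · rw [Equiv.swap_apply_of_ne_of_ne hzx hzy]
    refine (Fintype.expect_equiv (Equiv.mulRight (fun _ : Fin m => (⟨_, hs⟩ : Φ.cellPerm))) _ _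
      fun τ => ?_).symm
    simp
  have h2 : ∑ y ∈ Φ.cell x, 𝔼 τ : Fin m → Φ.cellPerm, F ((τ j).1 y) = 0 := by
    rw [← Finset.expect_sum_comm]
    simp [Φ.sum_cell_perm, hF]
  rw [Finset.sum_congr rfl h1, Finset.sum_const, nsmul_eq_mul] at h2
  refine (mul_eq_zero.1 h2).resolve_left ?_
  exact_mod_cast (Finset.card_pos.2 ⟨x, Φ.mem_cell x⟩).ne'

variable {Y : Type} {m : ℕ}

/-- The observations: `m` copies of every original state, and one of every new state. -/
abbrev Obs (Y : Type) (m H : ℕ) := (Y × Fin m) ⊕ (Fin H × Fin 3)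

/-- The decoder that permutes the `j`-th copy of the original states by `τ j`. -/
def decode (Φ : AggScheme M) (e : Y ≃ X) (τ : Fin m → Φ.cellPerm) : Obs Y m H → Aug X H
  | .inl (y, j) => .inl ((τ j).1 (e y))
  | .inr p => .inr p

theorem decode_surjective (Φ : AggScheme M) (e : Y ≃ X) (hm : 0 < m) (τ : Fin m → Φ.cellPerm) :
    Function.Surjective (decode Φ e τ) := by
  rintro (x | p)
  · exact ⟨.inl (e.symm ((τ ⟨0, hm⟩).1.symm x), ⟨0, hm⟩), by simp [decode]⟩
  · exact ⟨.inr p, rfl⟩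

theorem card_decode_inl (Φ : AggScheme M) (e : Y ≃ X) (τ : Fin m → Φ.cellPerm) (x : X) :
    Nat.card {o // decode Φ e τ o = .inl x} = m := by
  let f : Fin m → {o // decode Φ e τ o = .inl x} := fun j =>
    ⟨.inl (e.symm ((τ j).1.symm x), j), by simp [decode]⟩
  have hf : Function.Bijective f := by
    constructor
    · intro j j' h
      have := congrArg Subtype.val h
      simp only [f, Sum.inl.injEq, Prod.mk.injEq] at this
      exact this.2
    · rintro ⟨⟨y, j⟩ | p, h⟩
      · refine ⟨j, Subtype.ext ?_⟩
        simp only [decode, Sum.inl.injEq] at h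
        simp [f, ← h]
      · simp [decode] at h
  rw [← Nat.card_eq_of_bijective f hf, Nat.card_fin]

theorem card_decode_inr (Φ : AggScheme M) (e : Y ≃ X) (τ : Fin m → Φ.cellPerm)
    (p : Fin H × Fin 3) : Nat.card {o // decode Φ e τ o = .inr p} = 1 := by
  rw [Nat.card_eq_one_iff_exists]
  refine ⟨⟨.inr p, rfl⟩, ?_⟩
  rintro ⟨⟨y, j⟩ | q, h⟩
  · simp [decode] at h
  · simp only [decode, Sum.inr.injEq] at h
    simp [h]

/-- The size of the block of an observation. -/
def blockSize (m : ℕ) : Obs Y m H → ℝ := Sum.elim (fun _ => m) fun _ => 1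

theorem fiberCard_decode [Fintype Y] (Φ : AggScheme M) (e : Y ≃ X) (τ : Fin m → Φ.cellPerm)
    (o : Obs Y m H) : fiberCard (decode Φ e τ) (decode Φ e τ o) = blockSize m o := by
  rcases o with ⟨y, j⟩ | p
  · simp only [decode, blockSize, Sum.elim_inl, fiberCard]
    exact_mod_cast card_decode_inl Φ e τ _
  · simp only [blockSize, Sum.elim_inr, fiberCard]
    exact_mod_cast card_decode_inr Φ e τ p

/-- The label of an observation. -/
def label (Φ : AggScheme M) (e : Y ≃ X) : Obs Y m H → Φ.parts ⊕ (Fin H × Fin 3)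
  | .inl (y, _) => .inl ⟨Φ.cell (e y), Φ.cell_mem_parts _⟩
  | .inr p => .inr p

theorem isDecoder_decode (Φ : AggScheme M) (e : Y ≃ X) (hm : 0 < m) (τ : Fin m → Φ.cellPerm) :
    IsDecoder Φ (label Φ e) (decode Φ e τ) where
  old := by
    rintro (⟨y, j⟩ | p) φ h
    · simp only [label, Sum.inl.injEq] at h
      refine ⟨_, ?_, rfl⟩
      rw [← h]
      exact Φ.mem_cell_iff.2 ((τ j).2 _)
    · simp [label] at h
  new := by
    rintro (⟨y, j⟩ | p) q h
    · simp [label] at h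
    · simp only [label, Sum.inr.injEq] at h
      simp [decode, h]
  unique p := by
    refine ⟨.inr p, rfl, ?_⟩
    rintro (⟨y, j⟩ | q) h
    · simp [decode] at h
    · simpa [decode] using h
  pos x := by rw [card_decode_inl]; exact hm
  balanced φ x _ := by
    rw [card_decode_inl]
    let f : φ.1 × Fin m → {o : Obs Y m H // label Φ e o = .inl φ} := fun p =>
      ⟨.inl (e.symm p.1.1, p.2), by
        simp only [label, Equiv.apply_symm_apply, Sum.inl.injEq]
        exact Subtype.ext (Φ.cell_eq φ.2 p.1.2)⟩
    have hf : Function.Bijective f := by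
      constructor
      · rintro ⟨x, j⟩ ⟨x', j'⟩ h
        have := congrArg Subtype.val h
        simp only [f, Sum.inl.injEq, Prod.mk.injEq, EmbeddingLike.apply_eq_iff_eq] at this
        exact Prod.ext (Subtype.ext this.1) this.2
      · rintro ⟨⟨y, j⟩ | p, h⟩
        · simp only [label, Sum.inl.injEq] at h
          refine ⟨(⟨e y, by rw [← h]; exact Φ.mem_cell _⟩, j), Subtype.ext ?_⟩
          simp [f]
        · simp [label] at h
    rw [← Nat.card_eq_of_bijective f hf, Nat.card_prod, Nat.card_fin, Nat.card_eq_fintype_card,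
      Fintype.card_coe]

/-- A function on the original states, as a function of the observations. -/
def obsFun (e : Y ≃ X) (f : X → A → ℝ) : Obs Y m H → A → ℝ
  | .inl (y, _), a => f (e y) a
  | .inr p, _ => newReward p.2

/-- Decoders move states only within aggregates, so a function that is constant on aggregates
becomes the same function of the observations for all of them. This is why one function per sign of
the bias is enough. -/
theorem augFun_decode (Φ : AggScheme M) (e : Y ≃ X) (τ : Fin m → Φ.cellPerm) (f : X → A → ℝ)
    (hf : ∀ x y, Φ.cell x = Φ.cell y → ∀ a, f x a = f y a) (o : Obs Y m H) (a : A) :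
    augFun f (decode Φ e τ o) a = obsFun e f o a := by
  rcases o with ⟨y, j⟩ | p
  · exact hf _ _ ((τ j).2 _) a
  · rfl

/-- The rewards, as a function of the observations. -/
def obsReward : Obs Y m H → ℝ := Sum.elim (fun _ => 0) fun p => newReward p.2

theorem augReward_decode (Φ : AggScheme M) (e : Y ≃ X) (τ : Fin m → Φ.cellPerm) (o : Obs Y m H) :
    augReward (decode Φ e τ o) = obsReward o := by
  rcases o with ⟨y, j⟩ | p <;> rfl

variable [Fintype A] [Fintype Y]

/-- The block problem over the augmentation of `M` with bias `b`. -/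
def blockProblem (hH : 2 ≤ H) (Φ : AggScheme M) (e : Y ≃ X) (hm : 0 < m) {μ : ℕ → X → A → ℝ}
    (hμ : IsOfflineDist M μ) (π : X → A) (a₀ : A) (F : Set (Obs Y m H → A → ℝ))
    (hF : ∀ f ∈ F, ∀ x a, f x a ∈ Set.Icc (-1 : ℝ) 1) (b : X → A → ℝ) (hb : ∀ x a, |b x a| ≤ 1)
    (τ : Fin m → Φ.cellPerm) : OPEProblem (Obs Y m H) A H where
  M := blockMDP (augMDP hH M b hb) (decode Φ e τ) (decode_surjective Φ e hm τ)
  πe o := (Sum.elim π fun _ => a₀ : Aug X H → A) (decode Φ e τ o)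
  μ := liftDist (flowLift b a₀ μ) (decode Φ e τ)
  offline := isOfflineDist_lift _ _ (isOfflineDist_flowLift hH hb a₀ hμ)
  F := F
  F_mem := hF

section

variable (hH : 2 ≤ H) (Φ : AggScheme M) (e : Y ≃ X) (hm : 0 < m) {μ : ℕ → X → A → ℝ}
    (hμ : IsOfflineDist M μ) (π : X → A) (a₀ : A) (F : Set (Obs Y m H → A → ℝ))
    (hF : ∀ f ∈ F, ∀ x a, f x a ∈ Set.Icc (-1 : ℝ) 1) (b : X → A → ℝ) (hb : ∀ x a, |b x a| ≤ 1)
    (τ : Fin m → Φ.cellPerm)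

theorem blockProblem_isLift :
    IsLift Φ π μ (label Φ e) (blockProblem hH Φ e hm hμ π a₀ F hF b hb τ) := by
  refine ⟨augMDP hH M b hb, Sum.elim π fun _ => a₀, flowLift b a₀ μ, decode Φ e τ, surv H,
    isAugmentation_augMDP hH M b hb, isDecoder_decode Φ e hm τ, ?_, fun _ => rfl, fun h => ?_,
    fun _ _ _ => rfl⟩
  · exact ⟨fun _ => rfl, fun _ => rfl, fun _ _ _ => rfl, fun _ _ => rfl, fun _ => rfl,
      fun _ _ _ => rfl⟩
  · exact ⟨(by norm_num : (1 : ℝ) / 8 ≤ 2 / 15).trans (le_surv hH h), surv_le_one hH h⟩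

theorem blockProblem_πe (hπ : ∀ x y, Φ.cell x = Φ.cell y → π x = π y) (o : Obs Y m H) :
    (blockProblem hH Φ e hm hμ π a₀ F hF b hb τ).πe o
      = Sum.elim (fun p : Y × Fin m => π (e p.1)) (fun _ => a₀) o := by
  rcases o with ⟨y, j⟩ | p
  · exact hπ _ _ ((τ j).2 _)
  · rfl

theorem blockProblem_conc :
    conc (blockProblem hH Φ e hm hμ π a₀ F hF b hb τ).M.toMTM
      (blockProblem hH Φ e hm hμ π a₀ F hF b hb τ).μ
      (blockProblem hH Φ e hm hμ π a₀ F hF b hb τ).πe = conc M μ π :=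
  (conc_block _ (decode_surjective Φ e hm τ) _ _).trans (conc_augMDP hH M b hb a₀ hμ π)

theorem blockProblem_isAdmissible (ha : IsAdmissible M μ) :
    IsAdmissible (blockProblem hH Φ e hm hμ π a₀ F hF b hb τ).M.toMTM
      (blockProblem hH Φ e hm hμ π a₀ F hF b hb τ).μ :=
  isAdmissible_lift _ (decode_surjective Φ e hm τ) (isAdmissible_flowLift hH M b hb a₀ hμ ha)

/-- The reward depends neither on the decoder nor on the bias, so rewards carry no information about
the problem beyond the observations. -/
theorem blockProblem_reward (o : Obs Y m H) (a : A) :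
    (blockProblem hH Φ e hm hμ π a₀ F hF b hb τ).M.reward o a = Measure.dirac (obsReward o) := by
  rw [← augReward_decode Φ e τ]
  rfl

variable (f : X → A → ℝ)
    (hfb : ∀ x a, M.layer x < H →
      f x a = (1 - 2 / (H : ℝ)) * ∑ x', M.T x a x' * f x' (π x') + 2 / H * b x a)
    (hf0 : ∀ x a, M.layer x = H → f x a = 0)

include hfb hf0

theorem blockProblem_value :
    (blockProblem hH Φ e hm hμ π a₀ F hF b hb τ).value = ∑ x, M.ρ x * f x (π x) :=
  (blockMDP_V _ (decode_surjective Φ e hm τ) _).trans (augMDP_V hH M b hb π a₀ f hfb hf0)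

theorem blockProblem_Q (hf : ∀ x y, Φ.cell x = Φ.cell y → ∀ a, f x a = f y a) :
    (blockProblem hH Φ e hm hμ π a₀ F hF b hb τ).Q = obsFun e f := by
  funext o a
  rw [← augFun_decode Φ e τ f hf]
  exact (blockMDP_Q _ (decode_surjective Φ e hm τ) _ _ _).trans (augMDP_Q hH M b hb π a₀ f hfb hf0 _ _)

/-- On the right the decoder has dropped out, so there is only one `W`-function for each sign of the
bias. -/
theorem blockProblem_W (h : ℕ) :
    (blockProblem hH Φ e hm hμ π a₀ F hF b hb τ).W h
      = ∑ s : Aug X H, flowLift b a₀ μ h s ((Sum.elim π fun _ => a₀ : Aug X H → A) s) *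
          augFun f s ((Sum.elim π fun _ => a₀ : Aug X H → A) s) := by
  rw [← sum_div_fiberCard (decode_surjective Φ e hm τ)]
  refine Finset.sum_congr rfl fun o _ => ?_
  rw [show (blockProblem hH Φ e hm hμ π a₀ F hF b hb τ).Q o
      ((blockProblem hH Φ e hm hμ π a₀ F hF b hb τ).πe o)
    = augFun f (decode Φ e τ o) ((Sum.elim π fun _ => a₀ : Aug X H → A) (decode Φ e τ o)) from
    (blockMDP_Q _ (decode_surjective Φ e hm τ) _ _ _).trans (augMDP_Q hH M b hb π a₀ f hfb hf0 _ _)]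
  exact div_mul_eq_mul_div _ _ _

end

end RandomDecoder

/-! ### The law of one tuple, averaged over decoders -/

noncomputable section TupleLaw

variable {X A : Type*} [Fintype X] [Fintype A] {H : ℕ} {M : MTM X A H} {Y : Type} [Fintype Y] {m : ℕ}

/-- The copies that an observation of an original state belongs to. -/
def obsKey : Obs Y m H → Finset (Fin m)
  | .inl (_, j) => {j}
  | .inr _ => ∅

/-- The copies that occur in a tuple. -/
def tupleKeys (z : Obs Y m H × A × Obs Y m H) : Finset (Fin m) := obsKey z.1 ∪ obsKey z.2.2

/-- The probability of the discrete part of a tuple in a block problem. -/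
def obsTuple (Φ : AggScheme M) (e : Y ≃ X) (μ : ℕ → X → A → ℝ) (a₀ : A) (b : X → A → ℝ) (h : ℕ)
    (τ : Fin m → Φ.cellPerm) (z : Obs Y m H × A × Obs Y m H) : ℝ :=
  flowLift b a₀ μ h (decode Φ e τ z.1) z.2.1 / blockSize m z.1 *
    (augT M b (decode Φ e τ z.1) z.2.1 (decode Φ e τ z.2.2) / blockSize m z.2.2)

theorem blockProblem_tupleProb (hH : 2 ≤ H) (Φ : AggScheme M) (e : Y ≃ X) (hm : 0 < m)
    {μ : ℕ → X → A → ℝ} (hμ : IsOfflineDist M μ) (π : X → A) (a₀ : A)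
    (F : Set (Obs Y m H → A → ℝ)) (hF : ∀ f ∈ F, ∀ x a, f x a ∈ Set.Icc (-1 : ℝ) 1)
    (b : X → A → ℝ) (hb : ∀ x a, |b x a| ≤ 1) (τ : Fin m → Φ.cellPerm) (h : ℕ)
    (z : Obs Y m H × A × Obs Y m H) :
    (blockProblem hH Φ e hm hμ π a₀ F hF b hb τ).tupleProb h z = obsTuple Φ e μ a₀ b h τ z := by
  rw [obsTuple, ← fiberCard_decode Φ e τ, ← fiberCard_decode Φ e τ]
  rfl

omit [Fintype A] [Fintype Y] in
theorem decode_congr (Φ : AggScheme M) (e : Y ≃ X) {τ τ' : Fin m → Φ.cellPerm} {o : Obs Y m H}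
    (h : ∀ j ∈ obsKey o, τ j = τ' j) : decode Φ e τ o = decode Φ e τ' o := by
  rcases o with ⟨y, j⟩ | p
  · simp only [decode, h j (Finset.mem_singleton_self j)]
  · rfl

-- A tuple consults only the permutations of the copies in which it lies. These copies are the keys
-- of `mixture_overlap`.
omit [Fintype Y] in
theorem obsTuple_congr (Φ : AggScheme M) (e : Y ≃ X) (μ : ℕ → X → A → ℝ) (a₀ : A)
    (b : X → A → ℝ) (h : ℕ) {τ τ' : Fin m → Φ.cellPerm} {z : Obs Y m H × A × Obs Y m H}
    (hz : ∀ j ∈ tupleKeys z, τ j = τ' j) :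
    obsTuple Φ e μ a₀ b h τ z = obsTuple Φ e μ a₀ b h τ' z := by
  rw [obsTuple, obsTuple, decode_congr Φ e fun j hj => hz j (Finset.mem_union_left _ hj),
    decode_congr Φ e fun j hj => hz j (Finset.mem_union_right _ hj)]

theorem MTM.sum_T_le_one {S A : Type*} [Fintype S] (L : MTM S A H) (s : S) (a : A) :
    ∑ s', L.T s a s' ≤ 1 := by
  rcases (L.layer_le s).lt_or_eq with h | h
  · exact (L.T_sum s a h).le
  · simp [L.T_eq_zero_of_layer_eq h]

omit [Fintype A] in
theorem sum_obsKey (Φ : AggScheme M) (e : Y ≃ X) (τ : Fin m → Φ.cellPerm) (j : Fin m)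
    (F : Aug X H → ℝ) :
    ∑ o : Obs Y m H, (if j ∈ obsKey o then F (decode Φ e τ o) / blockSize m o else 0)
      = (∑ x, F (.inl x)) / m := by
  rw [Fintype.sum_sum_type, Fintype.sum_prod_type]
  simp only [obsKey, Finset.notMem_empty, if_false, Finset.sum_const_zero, add_zero,
    Finset.mem_singleton, Finset.sum_ite_eq, Finset.mem_univ, if_true, decode, blockSize,
    Sum.elim_inl]
  rw [← Finset.sum_div, ← Equiv.sum_comp (e.trans (τ j).1)]
  rfl

/-- Emissions are uniform, so each of the two observations of a tuple lies in the copy `j` with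
probability at most `1 / m`. -/
theorem sum_tupleKeys_le (hH : 2 ≤ H) (Φ : AggScheme M) (e : Y ≃ X) (hm : 0 < m)
    {μ : ℕ → X → A → ℝ} (hμ : IsOfflineDist M μ) (a₀ : A) (b : X → A → ℝ)
    (hb : ∀ x a, |b x a| ≤ 1) (τ : Fin m → Φ.cellPerm) {h : ℕ} (h1 : 1 ≤ h) (hh : h < H)
    (j : Fin m) :
    ∑ z : Obs Y m H × A × Obs Y m H,
      (if j ∈ tupleKeys z then obsTuple Φ e μ a₀ b h τ z else 0) ≤ 2 / m := by
  set L := augMDP hH M b hb with hL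
  have hT : ∀ s a s', augT M b s a s' = L.T s a s' := fun _ _ _ => rfl
  have hfl : ∀ s a, 0 ≤ flowLift b a₀ μ h s a := flowLift_nonneg hH hb a₀ hμ.isFlow h
  have hbs : ∀ o : Obs Y m H, 0 ≤ blockSize m o := by
    rintro (o | o) <;> simp [blockSize]
  have hm' : (0 : ℝ) < m := by exact_mod_cast hm
  have hoff := isOfflineDist_flowLift hH hb a₀ hμ
  have hnn : ∀ z : Obs Y m H × A × Obs Y m H, 0 ≤ obsTuple Φ e μ a₀ b h τ z := fun z =>
    mul_nonneg (div_nonneg (hfl _ _) (hbs _)) (div_nonneg (L.T_nonneg _ _ _) (hbs _))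
  have hsplit : ∀ z : Obs Y m H × A × Obs Y m H,
      (if j ∈ tupleKeys z then obsTuple Φ e μ a₀ b h τ z else 0)
      ≤ (if j ∈ obsKey z.1 then obsTuple Φ e μ a₀ b h τ z else 0)
        + (if j ∈ obsKey z.2.2 then obsTuple Φ e μ a₀ b h τ z else 0) := by
    intro z
    have := hnn z
    simp only [tupleKeys, Finset.mem_union]
    by_cases c1 : j ∈ obsKey z.1 <;> by_cases c2 : j ∈ obsKey z.2.2 <;> simp [c1, c2, this]
  have hrow : ∀ s a, ∑ o' : Obs Y m H, augT M b s a (decode Φ e τ o') / blockSize m o' ≤ 1 := by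
    intro s a
    have := sum_div_fiberCard (decode_surjective Φ e hm τ) (fun s' => L.T s a s')
    simp only [fiberCard_decode] at this
    simp only [hT, this]
    exact L.sum_T_le_one s a
  have hA : ∑ z : Obs Y m H × A × Obs Y m H,
      (if j ∈ obsKey z.1 then obsTuple Φ e μ a₀ b h τ z else 0) ≤ 1 / m := by
    have h2 : ∀ o : Obs Y m H, ∑ a, ∑ o' : Obs Y m H,
        (if j ∈ obsKey o then obsTuple Φ e μ a₀ b h τ (o, a, o') else 0)
        ≤ if j ∈ obsKey o then (∑ a, flowLift b a₀ μ h (decode Φ e τ o) a) / blockSize m o else 0 := by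
      intro o
      split_ifs
      · rw [Finset.sum_div]
        refine Finset.sum_le_sum fun a _ => ?_
        simp only [obsTuple]
        rw [← Finset.mul_sum]
        exact mul_le_of_le_one_right (div_nonneg (hfl _ _) (hbs _)) (hrow _ a)
      · simp
    simp only [Fintype.sum_prod_type (α₂ := A × Obs Y m H),
      Fintype.sum_prod_type (α₁ := A) (α₂ := Obs Y m H)]
    refine (Finset.sum_le_sum fun o _ => h2 o).trans ?_
    rw [sum_obsKey Φ e τ j (fun s => ∑ a, flowLift b a₀ μ h s a)]
    gcongr
    rw [← hoff.sum_one h h1 hh, Fintype.sum_sum_type]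
    exact le_add_of_nonneg_right (Finset.sum_nonneg fun p _ => Finset.sum_nonneg fun a _ => hfl _ _)
  have hB : ∑ z : Obs Y m H × A × Obs Y m H,
      (if j ∈ obsKey z.2.2 then obsTuple Φ e μ a₀ b h τ z else 0) ≤ 1 / m := by
    have h2 : ∀ o : Obs Y m H, ∑ a, ∑ o' : Obs Y m H,
        (if j ∈ obsKey o' then obsTuple Φ e μ a₀ b h τ (o, a, o') else 0)
        ≤ (∑ a, flowLift b a₀ μ h (decode Φ e τ o) a) / blockSize m o * (1 / m) := by
      intro o
      rw [Finset.sum_div, Finset.sum_mul]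
      refine Finset.sum_le_sum fun a _ => ?_
      simp only [obsTuple, ← mul_ite_zero]
      rw [← Finset.mul_sum]
      refine mul_le_mul_of_nonneg_left ?_ (div_nonneg (hfl _ _) (hbs _))
      rw [sum_obsKey Φ e τ j (fun s' => augT M b (decode Φ e τ o) a s')]
      gcongr
      refine le_trans ?_ (L.sum_T_le_one (decode Φ e τ o) a)
      rw [Fintype.sum_sum_type]
      exact le_add_of_nonneg_right (Finset.sum_nonneg fun p _ => L.T_nonneg _ _ _)
    simp only [Fintype.sum_prod_type (α₂ := A × Obs Y m H),
      Fintype.sum_prod_type (α₁ := A) (α₂ := Obs Y m H)]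
    refine (Finset.sum_le_sum fun o _ => h2 o).trans ?_
    rw [← Finset.sum_mul]
    have := sum_div_fiberCard (decode_surjective Φ e hm τ) (fun s => ∑ a, flowLift b a₀ μ h s a)
    simp only [fiberCard_decode] at this
    rw [this, hoff.sum_one h h1 hh, one_mul]
  refine (Finset.sum_le_sum fun z _ => hsplit z).trans ?_
  rw [Finset.sum_add_distrib]
  refine (add_le_add hA hB).trans (le_of_eq ?_)
  ring

omit [Fintype A] in
theorem AggScheme.sum_eq_zero_of_cell (Φ : AggScheme M) (g : X → ℝ)
    (hg : ∀ x, ∑ y ∈ Φ.cell x, g y = 0) : ∑ x, g x = 0 := by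
  classical
  rw [← Finset.sum_fiberwise (s := Finset.univ) (g := Φ.cell)]
  refine Finset.sum_eq_zero fun c _ => ?_
  by_cases hc : ∃ x, Φ.cell x = c
  · obtain ⟨x, rfl⟩ := hc
    rw [← hg x]
    refine Finset.sum_congr ?_ fun _ _ => rfl
    ext y
    simp [Φ.mem_cell_iff]
  · rw [Finset.filter_false_of_mem fun x _ hx => hc ⟨x, hx⟩, Finset.sum_empty]

theorem newProb_sub_newProb_neg (H : ℕ) (b : ℝ) (k : Fin 3) :
    newProb H b k - newProb H (-b) k = 2 * b / H * newReward k := by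
  fin_cases k <;> simp [newProb, newReward] <;> ring

theorem newMass_sub_newMass_neg (b : X → A → ℝ) (ν : ℕ → X → A → ℝ) (h : ℕ)
    (k : Fin 3) : newMass H b ν h k - newMass H (fun x a => -b x a) ν h k
      = 2 * surv H (h - 1) / H * (∑ x, ∑ a, ν (h - 1) x a * b x a) * newReward k := by
  have key : ∀ s : ℝ, ∑ x, ∑ a, ν (h - 1) x a * (1 + s * b x a)
      = ∑ x, ∑ a, ν (h - 1) x a + s * ∑ x, ∑ a, ν (h - 1) x a * b x a := fun s => by
    simp only [Finset.mul_sum, ← Finset.sum_add_distrib]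
    exact Finset.sum_congr rfl fun x _ => Finset.sum_congr rfl fun a _ => by ring
  have k1 := key 1
  have k2 := key (-1)
  simp only [one_mul, neg_mul, ← sub_eq_add_neg] at k1 k2
  fin_cases k <;> simp [newMass, newReward, ← sub_eq_add_neg, k1, k2] <;> ring

theorem sum_abs_newReward : ∑ k, |newReward k| = 2 := by
  simp [newReward, Fin.sum_univ_three]
  norm_num

/-- The total variation distance of the averaged laws of a tuple, for opposite biases. -/
theorem sum_abs_expect_obsTuple_le (Φ : AggScheme M) (e : Y ≃ X) (hm : 0 < m)
    (hH : 2 ≤ H) {μ : ℕ → X → A → ℝ} (hμ : IsOfflineDist M μ) (a₀ : A) (b c : X → A → ℝ)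
    (hc : ∀ x a, 0 ≤ c x a)
    (hbc : ∀ h x a, ∑ y ∈ Φ.cell x, μ h y a * (b y a - c y a) = 0) {h : ℕ} :
    ∑ z : Obs Y m H × A × Obs Y m H, |(𝔼 τ, obsTuple Φ e μ a₀ b h τ z)
        - 𝔼 τ, obsTuple Φ e μ a₀ (fun x a => -b x a) h τ z|
      ≤ 2 * (2 / H * (surv H h * ∑ x, ∑ a, μ h x a * c x a
        + surv H (h - 1) * ∑ x, ∑ a, μ (h - 1) x a * c x a)) := by
  classical
  have hm' : (0 : ℝ) < m := by exact_mod_cast hm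
  have hs : ∀ h, 0 < surv H h := surv_pos hH
  simp only [← Finset.expect_sub_distrib]
  set D : (Fin m → Φ.cellPerm) → Obs Y m H × A × Obs Y m H → ℝ := fun τ z =>
    obsTuple Φ e μ a₀ b h τ z - obsTuple Φ e μ a₀ (fun x a => -b x a) h τ z with hD
  have hE : ∀ (p : Y × Fin m) a, 𝔼 τ : Fin m → Φ.cellPerm,
      μ h ((τ p.2).1 (e p.1)) a * b ((τ p.2).1 (e p.1)) a
      = 𝔼 τ : Fin m → Φ.cellPerm, μ h ((τ p.2).1 (e p.1)) a * c ((τ p.2).1 (e p.1)) a := by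
    intro p a
    have := Φ.expect_perm_eq_zero (m := m) (fun y => μ h y a * (b y a - c y a)) (fun x => hbc h x a)
      p.2 (e p.1)
    simp only [mul_sub, Finset.expect_sub_distrib] at this
    linarith
  have hEn : ∀ (p : Y × Fin m) a, 0 ≤ 𝔼 τ : Fin m → Φ.cellPerm,
      μ h ((τ p.2).1 (e p.1)) a * c ((τ p.2).1 (e p.1)) a := fun p a =>
    Finset.expect_nonneg fun τ _ => mul_nonneg (hμ.nonneg _ _ _) (hc _ _)
  -- Neither the offline mass of original states nor the transitions among them involve the bias.
  have h1 : ∀ (p : Y × Fin m) a (p' : Y × Fin m), 𝔼 τ, D τ (.inl p, a, .inl p') = 0 := by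
    intro p a p'
    have : ∀ τ, D τ (.inl p, a, .inl p') = 0 := fun τ => sub_self _
    simp [this]
  -- The difference is linear in the bias, so averaging over the decoders replaces `b` by the core
  -- bias `c`.
  have h2 : ∀ (p : Y × Fin m) a (q : Fin H × Fin 3), 𝔼 τ, D τ (.inl p, a, .inr q)
      = (if q.1.val = M.layer (e p.1) then 2 * surv H h / (m * H) * newReward q.2 else 0) *
        𝔼 τ : Fin m → Φ.cellPerm, μ h ((τ p.2).1 (e p.1)) a * c ((τ p.2).1 (e p.1)) a := by
    intro p a q
    rw [← hE, Finset.mul_expect]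
    refine Finset.expect_congr rfl fun τ _ => ?_
    have hl : M.layer ((τ p.2).1 (e p.1)) = M.layer (e p.1) := Φ.layer_eq ((τ p.2).2 _)
    simp only [hD, obsTuple, decode, flowLift, augT, blockSize, Sum.elim_inl, Sum.elim_inr, hl,
      div_one]
    rw [← mul_sub]
    split_ifs
    · rw [newProb_sub_newProb_neg]
      field_simp
    · ring
  have h3 : ∀ (q : Fin H × Fin 3) a (p' : Y × Fin m), 𝔼 τ, D τ (.inr q, a, .inl p') = 0 := by
    intro p a p'
    have : ∀ τ, D τ (.inr p, a, .inl p') = 0 := fun τ => by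
      simp [hD, obsTuple, decode, augT]
    simp [this]
  -- The offline masses of `u` and `v` in layer `h` reflect the bias of layer `h - 1`. They depend
  -- on its total only, which is already that of `c`, without averaging over decoders.
  have hbcs : ∑ x, ∑ a, μ (h - 1) x a * b x a = ∑ x, ∑ a, μ (h - 1) x a * c x a := by
    rw [← sub_eq_zero, ← Finset.sum_sub_distrib]
    refine Φ.sum_eq_zero_of_cell _ fun x => ?_
    simp only [← Finset.sum_sub_distrib, ← mul_sub]
    rw [Finset.sum_comm]
    exact Finset.sum_eq_zero fun a _ => hbc _ _ _
  set ν := ∑ x, ∑ a, μ (h - 1) x a * c x a with hν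
  have hνn : 0 ≤ ν := Finset.sum_nonneg fun x _ => Finset.sum_nonneg fun a _ =>
    mul_nonneg (hμ.nonneg _ _ _) (hc _ _)
  have h4 : ∀ (q : Fin H × Fin 3) a (q' : Fin H × Fin 3), 𝔼 τ, D τ (.inr q, a, .inr q')
      = (if q.1.val = h - 1 then (if a = a₀ ∧ 1 ≤ h ∧ h < H then
          2 * surv H (h - 1) / H * ν * newReward q.2 else 0) else 0) *
        (if q'.1.val = q.1.val + 1 then (if q'.2 = 2 then 1 else 0) else 0) := by
    rintro ⟨i, k⟩ a ⟨i', k'⟩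
    have : ∀ τ, D τ (.inr (i, k), a, .inr (i', k'))
      = (if i.val = h - 1 then (if a = a₀ ∧ 1 ≤ h ∧ h < H then
          2 * surv H (h - 1) / H * ν * newReward k else 0) else 0) *
        (if i'.val = i.val + 1 then (if k' = 2 then 1 else 0) else 0) := fun τ => by
      simp only [hD, obsTuple, decode, flowLift, augT, blockSize, Sum.elim_inr, div_one,
        ← sub_mul, ite_and (i'.val = i.val + 1)]
      congr 1
      rw [← hbcs, ← newMass_sub_newMass_neg]
      by_cases c1 : i.val + 1 = h ∧ h < H ∧ a = a₀
      · rw [if_pos c1, if_pos c1, if_pos (by omega), if_pos ⟨c1.2.2, by omega, c1.2.1⟩]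
      · rw [if_neg c1, if_neg c1, sub_self]
        split_ifs with c2 c3
        · exact absurd ⟨by omega, c3.2.2, c3.1⟩ c1
        · rfl
        · rfl
    simp [this]
  have hH' : (0 : ℝ) < H := by exact_mod_cast (by omega : 0 < H)
  have hold : ∀ (p : Y × Fin m) a, ∑ q : Fin H × Fin 3, |𝔼 τ, D τ (.inl p, a, .inr q)|
      ≤ 4 * surv H h / (m * H) *
        𝔼 τ : Fin m → Φ.cellPerm, μ h ((τ p.2).1 (e p.1)) a * c ((τ p.2).1 (e p.1)) a := by
    intro p a
    simp only [h2, abs_mul, abs_of_nonneg (hEn p a), ← Finset.sum_mul]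
    refine mul_le_mul_of_nonneg_right ?_ (hEn p a)
    rw [Fintype.sum_prod_type]
    have : ∀ i : Fin H, ∑ k, |if i.val = M.layer (e p.1) then
        2 * surv H h / (m * H) * newReward k else 0|
        = if i.val = M.layer (e p.1) then 4 * surv H h / (m * H) else 0 := by
      intro i
      split_ifs
      · have h5 : 0 ≤ 2 * surv H h / (m * H) := div_nonneg (by linarith [hs h]) (by positivity)
        simp only [abs_mul, abs_of_nonneg h5]
        rw [← Finset.mul_sum, sum_abs_newReward]
        ring
      · simp
    simp only [this]
    rw [sum_fin_ite_val _ (fun _ => 4 * surv H h / (m * H)) _ fun _ _ => rfl]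
    split_ifs
    · exact le_rfl
    · exact div_nonneg (by linarith [hs h]) (by positivity)
  have hnew : ∑ q : Fin H × Fin 3, ∑ a, ∑ q' : Fin H × Fin 3, |𝔼 τ, D τ (.inr q, a, .inr q')|
      ≤ 4 * surv H (h - 1) / H * ν := by
    have hn : 0 ≤ 2 * surv H (h - 1) / H * ν :=
      mul_nonneg (div_nonneg (by linarith [hs (h - 1)]) hH'.le) hνn
    have h5 : ∀ (q : Fin H × Fin 3) a, ∑ q' : Fin H × Fin 3, |𝔼 τ, D τ (.inr q, a, .inr q')|
        ≤ if q.1.val = h - 1 then (if a = a₀ then 2 * surv H (h - 1) / H * ν * |newReward q.2| else 0)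
          else 0 := by
      intro q a
      simp only [h4, abs_mul, ← Finset.mul_sum]
      refine (mul_le_of_le_one_right (abs_nonneg _) ?_).trans ?_
      · rw [Fintype.sum_prod_type]
        have : ∀ i' : Fin H, ∑ k' : Fin 3,
            |if i'.val = q.1.val + 1 then (if k' = 2 then (1 : ℝ) else 0) else 0|
            = if i'.val = q.1.val + 1 then 1 else 0 := fun i' => by
          split_ifs
          · rw [Finset.sum_eq_single 2]
            · simp
            · intro k _ hk
              simp [hk]
            · simp
          · simp
        simp only [this]
        rw [sum_fin_ite_val _ (fun _ => (1 : ℝ)) _ fun _ _ => rfl]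
        split_ifs <;> norm_num
      · by_cases c1 : q.1.val = h - 1 <;> by_cases c2 : a = a₀ <;>
          by_cases c3 : 1 ≤ h ∧ h < H <;>
          simp only [c1, c2, c3, if_true, if_false, false_and, and_false, and_self,
            abs_zero, le_refl]
        · rw [abs_mul, abs_of_nonneg hn]
        · exact mul_nonneg hn (abs_nonneg _)
    refine (Finset.sum_le_sum fun q _ => Finset.sum_le_sum fun a _ => h5 q a).trans ?_
    have h6 : ∀ q : Fin H × Fin 3, ∑ a : A, (if q.1.val = h - 1 then
        (if a = a₀ then 2 * surv H (h - 1) / H * ν * |newReward q.2| else 0) else 0)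
        = if q.1.val = h - 1 then 2 * surv H (h - 1) / H * ν * |newReward q.2| else 0 := fun q => by
      split_ifs <;> simp
    simp only [h6, Fintype.sum_prod_type]
    have h7 : ∀ i : Fin H, ∑ k : Fin 3, (if i.val = h - 1 then
        2 * surv H (h - 1) / H * ν * |newReward k| else 0)
        = if i.val = h - 1 then 4 * surv H (h - 1) / H * ν else 0 := fun i => by
      split_ifs
      · rw [← Finset.mul_sum, sum_abs_newReward]
        ring
      · simp
    simp only [h7]
    rw [sum_fin_ite_val _ (fun _ => 4 * surv H (h - 1) / H * ν) _ fun _ _ => rfl]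
    split_ifs
    · exact le_rfl
    · exact mul_nonneg (div_nonneg (by linarith [hs (h - 1)]) hH'.le) hνn
  have hold' : ∑ p : Y × Fin m, ∑ a, ∑ q : Fin H × Fin 3, |𝔼 τ, D τ (.inl p, a, .inr q)|
      ≤ 4 * surv H h / H * ∑ x, ∑ a, μ h x a * c x a := by
    refine (Finset.sum_le_sum fun p _ => Finset.sum_le_sum fun a _ => hold p a).trans (le_of_eq ?_)
    simp only [← Finset.mul_sum]
    have h8 : ∑ p : Y × Fin m, ∑ a, 𝔼 τ : Fin m → Φ.cellPerm,
        μ h ((τ p.2).1 (e p.1)) a * c ((τ p.2).1 (e p.1)) a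
        = m * ∑ x, ∑ a, μ h x a * c x a := by
      simp only [← Finset.expect_sum_comm]
      have h9 : ∀ τ : Fin m → Φ.cellPerm, ∑ p : Y × Fin m, ∑ a,
          μ h ((τ p.2).1 (e p.1)) a * c ((τ p.2).1 (e p.1)) a
          = m * ∑ x, ∑ a, μ h x a * c x a := by
        intro τ
        rw [Fintype.sum_prod_type, Finset.sum_comm]
        have : ∀ j : Fin m, ∑ y, ∑ a, μ h ((τ j).1 (e y)) a * c ((τ j).1 (e y)) a
            = ∑ x, ∑ a, μ h x a * c x a := fun j =>
          Equiv.sum_comp (e.trans (τ j).1) fun x => ∑ a, μ h x a * c x a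
        simp [this]
      simp [h9]
    rw [h8]
    field_simp
  calc ∑ z : Obs Y m H × A × Obs Y m H, |𝔼 τ, D τ z|
      = ∑ p : Y × Fin m, ∑ a, ∑ q : Fin H × Fin 3, |𝔼 τ, D τ (.inl p, a, .inr q)|
        + ∑ q : Fin H × Fin 3, ∑ a, ∑ q' : Fin H × Fin 3, |𝔼 τ, D τ (.inr q, a, .inr q')| := by
        rw [Fintype.sum_prod_type, Fintype.sum_sum_type]
        congr 1
        · refine Finset.sum_congr rfl fun p _ => ?_
          rw [Fintype.sum_prod_type]
          refine Finset.sum_congr rfl fun a _ => ?_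
          rw [Fintype.sum_sum_type]
          simp only [h1, abs_zero, Finset.sum_const_zero, zero_add]
        · refine Finset.sum_congr rfl fun p _ => ?_
          rw [Fintype.sum_prod_type]
          refine Finset.sum_congr rfl fun a _ => ?_
          rw [Fintype.sum_sum_type]
          simp only [h3, abs_zero, Finset.sum_const_zero, zero_add]
    _ ≤ _ := add_le_add hold' hnew
    _ = _ := by ring

end TupleLaw

/-! ### Le Cam's method and the choice of layer and aggregates -/

section LowerBound

/-- Le Cam's two-point method, for two uniform mixtures of problems. -/
theorem exists_le_failProb {S A Ω : Type*} [Fintype S] [Fintype A] [Fintype Ω] [Nonempty Ω] {H : ℕ}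
    (g g' : Ω → OPEProblem S A H) (ρ : S → ℝ)
    (hρ : ∀ ω x a, (g ω).M.reward x a = Measure.dirac (ρ x))
    (hρ' : ∀ ω x a, (g' ω).M.reward x a = Measure.dirac (ρ x))
    {V V' δ : ℝ} (hV : ∀ ω, (g ω).value = V) (hV' : ∀ ω, (g' ω).value = V')
    (hδ : 2 * δ < |V - V'|) {n : ℕ} (alg : Kernel (Dataset S A H n) ℝ) [IsMarkovKernel alg]
    {q : ℝ} (hq : 2 * q ≤ ∑ D : Fin (H - 1) × Fin n → S × A × S,
      min (𝔼 ω, ∏ i, (g ω).tupleProb (i.1.val + 1) (D i))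
        (𝔼 ω, ∏ i, (g' ω).tupleProb (i.1.val + 1) (D i))) :
    (∃ ω, ENNReal.ofReal q ≤ (g ω).failProb alg δ) ∨
      ∃ ω, ENNReal.ofReal q ≤ (g' ω).failProb alg δ := by
  by_contra! hcon
  obtain ⟨hc, hc'⟩ := hcon
  set t : (Fin (H - 1) × Fin n → S × A × S) → ℝ := fun D =>
    (alg (OPEProblem.tagged ρ D)).real {v | δ < |v - V|} with ht
  set t' : (Fin (H - 1) × Fin n → S × A × S) → ℝ := fun D =>
    (alg (OPEProblem.tagged ρ D)).real {v | δ < |v - V'|} with ht'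
  have htt : ∀ D, 1 ≤ t D + t' D := by
    intro D
    -- No estimate is within `δ` of both values, so the two failure probabilities sum to at least
    -- one on every dataset.
    have hU : {v : ℝ | δ < |v - V|} ∪ {v | δ < |v - V'|} = Set.univ := by
      refine Set.eq_univ_of_forall fun v => ?_
      by_contra h
      simp only [Set.mem_union, Set.mem_ofPred_eq, not_or, not_lt] at h
      have := abs_sub_le V v V'
      rw [abs_sub_comm V v] at this
      linarith [h.1, h.2]
    have := measureReal_union_le (μ := alg (OPEProblem.tagged ρ D))
      {v : ℝ | δ < |v - V|} {v | δ < |v - V'|}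
    rwa [hU, probReal_univ] at this
  have ht0 : ∀ D, 0 ≤ t D := fun D => measureReal_nonneg
  have ht0' : ∀ D, 0 ≤ t' D := fun D => measureReal_nonneg
  have hf : ∀ ω, ∑ D, (∏ i, (g ω).tupleProb (i.1.val + 1) (D i)) * t D < q := by
    intro ω
    have := hc ω
    rw [OPEProblem.failProb_eq (g ω) ρ (hρ ω), hV ω] at this
    exact (ENNReal.ofReal_lt_ofReal_iff_of_nonneg (Finset.sum_nonneg fun D _ =>
      mul_nonneg (Finset.prod_nonneg fun i _ => (g ω).tupleProb_nonneg _ _) (ht0 D))).1 this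
  have hf' : ∀ ω, ∑ D, (∏ i, (g' ω).tupleProb (i.1.val + 1) (D i)) * t' D < q := by
    intro ω
    have := hc' ω
    rw [OPEProblem.failProb_eq (g' ω) ρ (hρ' ω), hV' ω] at this
    exact (ENNReal.ofReal_lt_ofReal_iff_of_nonneg (Finset.sum_nonneg fun D _ =>
      mul_nonneg (Finset.prod_nonneg fun i _ => (g' ω).tupleProb_nonneg _ _) (ht0' D))).1 this
  have he : 𝔼 ω, ∑ D, (∏ i, (g ω).tupleProb (i.1.val + 1) (D i)) * t D < q :=
    Finset.expect_lt (fun ω _ => (hf ω).le)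
      ⟨Classical.arbitrary Ω, Finset.mem_univ _, hf _⟩
  have he' : 𝔼 ω, ∑ D, (∏ i, (g' ω).tupleProb (i.1.val + 1) (D i)) * t' D < q :=
    Finset.expect_lt (fun ω _ => (hf' ω).le)
      ⟨Classical.arbitrary Ω, Finset.mem_univ _, hf' _⟩
  simp only [Finset.expect_sum_comm, ← Finset.expect_mul] at he he'
  have : ∑ D : Fin (H - 1) × Fin n → S × A × S,
      min (𝔼 ω, ∏ i, (g ω).tupleProb (i.1.val + 1) (D i))
        (𝔼 ω, ∏ i, (g' ω).tupleProb (i.1.val + 1) (D i))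
      ≤ ∑ D, (𝔼 ω, ∏ i, (g ω).tupleProb (i.1.val + 1) (D i)) * t D
        + ∑ D, (𝔼 ω, ∏ i, (g' ω).tupleProb (i.1.val + 1) (D i)) * t' D := by
    rw [← Finset.sum_add_distrib]
    refine Finset.sum_le_sum fun D _ => ?_
    set p := 𝔼 ω, ∏ i, (g ω).tupleProb (i.1.val + 1) (D i)
    set p' := 𝔼 ω, ∏ i, (g' ω).tupleProb (i.1.val + 1) (D i)
    have hm : 0 ≤ min p p' := le_min
      (Finset.expect_nonneg fun ω _ => Finset.prod_nonneg fun i _ => (g ω).tupleProb_nonneg _ _)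
      (Finset.expect_nonneg fun ω _ => Finset.prod_nonneg fun i _ => (g' ω).tupleProb_nonneg _ _)
    calc min p p' ≤ min p p' * (t D + t' D) := le_mul_of_one_le_right hm (htt D)
      _ = min p p' * t D + min p p' * t' D := mul_add _ _ _
      _ ≤ p * t D + p' * t' D := add_le_add
          (mul_le_mul_of_nonneg_right (min_le_left _ _) (ht0 D))
          (mul_le_mul_of_nonneg_right (min_le_right _ _) (ht0' D))
  linarith

/-- A finite supremum is attained. Propositions are allowed as indices, and `0 < k` rules out an
empty family, whose supremum is `0`. -/
theorem exists_le_of_le_iSup {ι : Sort*} [Finite ι] {f : ι → ℝ≥0∞} {k : ℝ≥0∞} (hk : 0 < k)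
    (h : k ≤ ⨆ i, f i) : ∃ i, k ≤ f i := by
  by_contra! hc
  rcases isEmpty_or_nonempty ι with hι | hι
  · rw [iSup_of_empty] at h
    exact absurd hk (not_lt.2 h)
  · rw [← iSup_plift_down] at h
    obtain ⟨i, hi⟩ := exists_eq_ciSup_of_finite (f := fun i : PLift ι => f i.down)
    exact absurd (hc i.down) (not_lt.2 (hi ▸ h))

/-- All four nested suprema are over finite index types, hence attained. The conclusion is written
without quotients so that it covers data mass zero, where the ratio is infinite. -/
theorem exists_of_le_aggConc {X A : Type*} [Fintype X] [Fintype A] {H : ℕ} {M : MTM X A H}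
    {Φ : AggScheme M} {μ : ℕ → X → A → ℝ} (hμ : IsOfflineDist M μ) {π : X → A} {ε K : ℝ}
    (hε : 0 < ε) (hK : 0 < K) (h : ENNReal.ofReal K ≤ aggConc M Φ μ π ε) :
    ∃ h₀, 1 ≤ h₀ ∧ h₀ < H ∧ ∃ I ⊆ Φ.atLayer h₀,
      ε ≤ ∑ φ ∈ I, aggOcc M Φ μ (Policy.det π) h₀ φ ∧
      K * ∑ φ ∈ I, ∑ x ∈ φ, μ h₀ x (π x) ≤ ∑ φ ∈ I, aggOcc M Φ μ (Policy.det π) h₀ φ := by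
  have hK' : 0 < ENNReal.ofReal K := ENNReal.ofReal_pos.2 hK
  rw [aggConc, iSup_subtype'] at h
  obtain ⟨⟨h₀, hh⟩, h⟩ := exists_le_of_le_iSup hK' h
  obtain ⟨I, h⟩ := exists_le_of_le_iSup hK' h
  obtain ⟨hI, h⟩ := exists_le_of_le_iSup hK' h
  obtain ⟨hε', h⟩ := exists_le_of_le_iSup hK' h
  rw [Finset.mem_Icc] at hh
  refine ⟨h₀, hh.1, by omega, I, hI, hε', ?_⟩
  set d := ∑ φ ∈ I, aggOcc M Φ μ (Policy.det π) h₀ φ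
  have hm : 0 ≤ ∑ φ ∈ I, ∑ x ∈ φ, μ h₀ x (π x) :=
    Finset.sum_nonneg fun φ _ => Finset.sum_nonneg fun x _ => hμ.nonneg _ _ _
  rcases hm.eq_or_lt with h0 | hpos
  · rw [← h0, mul_zero]
    linarith
  · simp only [ratio] at h
    rw [ENNReal.le_div_iff_mul_le (Or.inl (by simpa using hpos)) (Or.inl ENNReal.ofReal_ne_top),
      ← ENNReal.ofReal_mul hK.le, ENNReal.ofReal_le_ofReal_iff (by linarith)] at h
    exact h

theorem sum_mul_coreBias {X A : Type*} [Fintype X] [Fintype A] {H : ℕ} {M : MTM X A H}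
    (Φ : AggScheme M) {μ : ℕ → X → A → ℝ} (hμ : IsOfflineDist M μ) (π : X → A) {h₀ : ℕ}
    {I : Finset (Finset X)} (hI : I ⊆ Φ.atLayer h₀) (r : ℝ) (h : ℕ) :
    ∑ x, ∑ a, μ h x a * coreBias Φ π h₀ I r x a
      = if h = h₀ then H / 2 * r * ∑ φ ∈ I, ∑ x ∈ φ, μ h₀ x (π x) else 0 := by
  classical
  have h1 : ∀ x, ∑ a, μ h x a * coreBias Φ π h₀ I r x a
      = if h = h₀ ∧ Φ.cell x ∈ I then H / 2 * r * μ h₀ x (π x) else 0 := by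
    intro x
    rw [Finset.sum_eq_single (π x)]
    · rw [coreBias]
      by_cases h0 : μ h x (π x) = 0
      · rw [h0, zero_mul]
        split_ifs with hc
        · rw [← hc.1, h0, mul_zero]
        · rfl
      · have hl := (hμ.support h x _ h0).1
        rw [hl]
        by_cases c1 : h = h₀
        · subst c1
          by_cases c2 : Φ.cell x ∈ I <;> simp [c2, mul_comm]
        · simp [c1]
    · intro a _ ha
      rw [coreBias, if_neg fun hc => ha hc.2.2, mul_zero]
    · simp
  simp only [h1]
  split_ifs with hh
  · subst hh
    rw [← Finset.sum_biUnion, Finset.mul_sum, ← Finset.sum_filter]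
    · refine Finset.sum_congr ?_ fun _ _ => rfl
      ext x
      simp only [true_and, Finset.mem_filter, Finset.mem_univ, Finset.mem_biUnion]
      constructor
      · exact fun hx => ⟨_, hx, Φ.mem_cell x⟩
      · rintro ⟨φ, hφ, hx⟩
        rwa [Φ.cell_eq (Φ.mem_atLayer.1 (hI hφ)).1 hx]
    · intro φ hφ φ' hφ' hne
      refine Finset.disjoint_left.2 fun x hx hx' => hne ?_
      exact Φ.disjoint φ (Φ.mem_atLayer.1 (hI hφ)).1 φ' (Φ.mem_atLayer.1 (hI hφ')).1 x hx hx'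
  · exact Finset.sum_eq_zero fun x _ => if_neg fun hc => hh hc.1

theorem coreBias_nonneg {X A : Type*} [Fintype X] {H : ℕ} {M : MTM X A H}
    (Φ : AggScheme M) (π : X → A) (h₀ : ℕ) (I : Finset (Finset X)) {r : ℝ} (hr : 0 ≤ r)
    (x : X) (a : A) : 0 ≤ coreBias Φ π h₀ I r x a := by
  rw [coreBias]
  split_ifs
  · positivity
  · exact le_rfl

/-- The index `i` stands for layer `i + 1`: the two terms belong to the tuples of layers `h₀` and
`h₀ + 1`. If `h₀ = H - 1`, the second never occurs. -/
theorem sum_fin_layers_le {H : ℕ} (n : ℕ) (h₀ : ℕ) {η : ℝ} (hη : 0 ≤ η) :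
    ∑ i : Fin (H - 1) × Fin n,
      ((if i.1.val + 1 = h₀ then η else 0) + if i.1.val = h₀ then η else 0) ≤ 2 * n * η := by
  have h1 : ∀ k, ∑ i : Fin (H - 1), (if i.val = k then η else 0) ≤ η := fun k => by
    rw [sum_fin_ite_val _ (fun _ => η) _ fun _ _ => rfl]
    split_ifs
    · exact le_rfl
    · exact hη
  have h2 : ∑ i : Fin (H - 1), (if i.val + 1 = h₀ then η else 0) ≤ η := by
    refine le_trans (Finset.sum_le_sum fun i _ => ?_) (h1 (h₀ - 1))
    split_ifs with c1 c2
    · exact le_rfl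
    · omega
    · exact hη
    · exact le_rfl
  rw [Fintype.sum_prod_type_right]
  calc _ ≤ ∑ _ : Fin n, 2 * η := Finset.sum_le_sum fun k _ => by
        rw [Finset.sum_add_distrib]
        linarith [h1 h₀]
    _ = _ := by
        simp
        ring

/-- The averaged laws of the data for opposite biases overlap. -/
theorem two_mul_le_overlap {X A : Type*} [Fintype X] [Fintype A] {H : ℕ} {M : MTM X A H}
    {Y : Type} [Fintype Y] {m : ℕ} (hH : 2 ≤ H) (Φ : AggScheme M) (e : Y ≃ X) (hm : 0 < m)
    {μ : ℕ → X → A → ℝ} (hμ : IsOfflineDist M μ) {π : X → A}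
    (hπ : ∀ φ ∈ Φ.parts, ∀ x ∈ φ, ∀ y ∈ φ, π x = π y) (a₀ : A) {h₀ : ℕ}
    {I : Finset (Finset X)} (hI : I ⊆ Φ.atLayer h₀) {r : ℝ} (hr : 0 ≤ r) (hHr : H * r ≤ 1)
    {x₀ : ℝ} (hx₀ : 0 ≤ x₀)
    (hη : r * (∑ φ ∈ I, ∑ x ∈ φ, μ h₀ x (π x)) * surv H h₀ ≤ x₀ / 2)
    (hmx : 4 * (H : ℝ) ^ 2 ≤ m * x₀ ^ 2) {n : ℕ} (hn : n * x₀ ≤ 1) :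
    2 * (1 / 2 - n * x₀) ≤ ∑ D : Fin (H - 1) × Fin n → Obs Y m H × A × Obs Y m H,
      min (𝔼 τ, ∏ i, obsTuple Φ e μ a₀ (bias Φ μ π h₀ I r) (i.1.val + 1) τ (D i))
        (𝔼 τ, ∏ i, obsTuple Φ e μ a₀ (fun x a => -bias Φ μ π h₀ I r x a) (i.1.val + 1) τ (D i)) := by
  set b := bias Φ μ π h₀ I r with hbd
  set mI := ∑ φ ∈ I, ∑ x ∈ φ, μ h₀ x (π x) with hmI
  have hHpos : (0 : ℝ) < H := by exact_mod_cast (by omega : 0 < H)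
  have hb : ∀ x a, |b x a| ≤ 1 := abs_bias_le Φ h₀ I hH hμ.nonneg hr hHr
  have hb' : ∀ x a, |-b x a| ≤ 1 := fun x a => by rw [abs_neg]; exact hb x a
  have hnn : ∀ (b : X → A → ℝ) (hb : ∀ x a, |b x a| ≤ 1) h (τ : Fin m → Φ.cellPerm) z,
      0 ≤ obsTuple Φ e μ a₀ b h τ z := fun b hb h τ z => by
    rw [← blockProblem_tupleProb hH Φ e hm hμ π a₀ ∅ (fun _ h => absurd h (by simp)) b hb]
    exact OPEProblem.tupleProb_nonneg _ _ _
  have hsum : ∀ (b : X → A → ℝ) (hb : ∀ x a, |b x a| ≤ 1) (i : Fin (H - 1) × Fin n)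
      (τ : Fin m → Φ.cellPerm), ∑ z, obsTuple Φ e μ a₀ b (i.1.val + 1) τ z = 1 := fun b hb i τ => by
    simp only [← blockProblem_tupleProb hH Φ e hm hμ π a₀ ∅ (fun _ h => absurd h (by simp)) b hb]
    exact OPEProblem.tupleProb_sum _ _ (by omega) (by omega)
  have hmI0 : 0 ≤ mI :=
    Finset.sum_nonneg fun φ _ => Finset.sum_nonneg fun x _ => hμ.nonneg _ _ _
  set η := r * mI * surv H h₀ with hηd
  have hη0 : 0 ≤ η := mul_nonneg (mul_nonneg hr hmI0) (surv_pos hH h₀).le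
  have hov := mixture_overlap
    (fun (i : Fin (H - 1) × Fin n) τ z => obsTuple Φ e μ a₀ b (i.1.val + 1) τ z)
    (fun (i : Fin (H - 1) × Fin n) τ z => obsTuple Φ e μ a₀ (fun x a => -b x a) (i.1.val + 1) τ z)
    (fun i τ z => hnn b hb _ τ z) (fun i τ z => hnn _ hb' _ τ z)
    (fun i τ => hsum b hb i τ) (fun i τ => hsum _ hb' i τ) tupleKeys
    (fun i z τ τ' hz => obsTuple_congr Φ e μ a₀ _ _ hz)
    (fun i z τ τ' hz => obsTuple_congr Φ e μ a₀ _ _ hz) (2 / m)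
    (fun i τ j => sum_tupleKeys_le hH Φ e hm hμ a₀ b hb τ (by omega) (by omega) j)
    (fun i => (if i.1.val + 1 = h₀ then η else 0) + if i.1.val = h₀ then η else 0)
    -- The factors `2/H` and `H/2` cancel, which leaves `η = r * mI * surv H h₀` in each of the two
    -- layers.
    (fun i => by
      refine (sum_abs_expect_obsTuple_le Φ e hm hH hμ a₀ b (coreBias Φ π h₀ I r)
        (coreBias_nonneg Φ π h₀ I hr) (sum_cell_bias Φ hμ hπ)).trans (le_of_eq ?_)
      rw [sum_mul_coreBias Φ hμ π hI, sum_mul_coreBias Φ hμ π hI, Nat.add_sub_cancel, ← hmI]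
      congr 1
      rw [mul_add]
      congr 1
      · split_ifs with hc
        · rw [hc, hηd]
          field_simp
        · simp
      · split_ifs with hc
        · rw [hc, hηd]
          field_simp
        · simp)
  refine le_trans ?_ hov
  have hlay := sum_fin_layers_le (H := H) n h₀ hη0
  have hm' : (0 : ℝ) < m := by exact_mod_cast hm
  have hn0 : (0 : ℝ) ≤ n := Nat.cast_nonneg n
  -- With at most `H * n` tuples the collision bound is `4 H² n² / m ≤ (n * x₀)²`, and `n * x₀ ≤ 1`.
  have hbad : (Fintype.card (Fin (H - 1) × Fin n) : ℝ) ^ 2 * Fintype.card (Fin m) * (2 / m) ^ 2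
      ≤ n * x₀ := by
    have h2 : ((H - 1 : ℕ) : ℝ) ≤ H := by exact_mod_cast Nat.sub_le H 1
    rw [Fintype.card_prod, Fintype.card_fin, Fintype.card_fin, Fintype.card_fin, Nat.cast_mul]
    calc (((H - 1 : ℕ) : ℝ) * n) ^ 2 * m * (2 / m) ^ 2
        ≤ ((H : ℝ) * n) ^ 2 * m * (2 / m) ^ 2 := by gcongr
      _ = n ^ 2 * (4 * (H : ℝ) ^ 2) / m := by
          field_simp
          ring
      _ ≤ n ^ 2 * (m * x₀ ^ 2) / m := by gcongr
      _ = (n * x₀) * (n * x₀) := by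
          field_simp
      _ ≤ n * x₀ := mul_le_of_le_one_right (by positivity) hn
  have : n * η ≤ n * (x₀ / 2) := mul_le_mul_of_nonneg_left hη hn0
  linarith

end LowerBound

end AggOPE

/-! ### The lower bound -/

theorem mainTheorem3 {X A : Type*} [Fintype X] [Fintype A] {H : ℕ} (hH : 2 ≤ H)
    (M : MTM X A H) (Φ : AggScheme M) (πe : X → A)
    (hπ : ∀ φ ∈ Φ.parts, ∀ x ∈ φ, ∀ y ∈ φ, πe x = πe y)
    (μ : ℕ → X → A → ℝ) (hμ : IsOfflineDist M μ)
    (ε : ℝ) (hε₀ : 0 < ε) (hε₁ : ε < 1)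
    -- `K` is the aggregated concentrability coefficient where that is finite, and is an
    -- arbitrarily large real number where it is infinite
    (K : ℝ) (hK : 0 < K) (hKC : ENNReal.ofReal K ≤ aggConc M Φ μ πe ε) :
    ∃ (O : Type) (_ : Fintype O) (lab : O → Φ.parts ⊕ (Fin H × Fin 3))
      (πO : O → A) (F : Set (O → A → ℝ)) (FW : Set ((O → A → ℝ) × (ℕ → ℝ)))
      (G : Set (OPEProblem O A H)),
      -- every problem of the class is a block problem over an augmentation of `M`;
      -- all of them share the evaluation policy and the function class
      (∀ g ∈ G, IsLift Φ πe μ lab g ∧ g.πe = πO ∧ g.F = F) ∧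
      -- realizability, with two functions, also jointly with the `W`-function
      F.ncard = 2 ∧ FW.ncard = 2 ∧ F = Prod.fst '' FW ∧
      (∀ g ∈ G, g.Q ∈ F ∧ (g.Q, g.W) ∈ FW) ∧
      -- the functions do not separate observations within an aggregate
      (∀ f ∈ F, ∀ o o', lab o = lab o' → f o = f o') ∧
      -- the standard concentrability coefficient is the original one up to constants
      (∀ g ∈ G, conc M μ πe / 8 ≤ conc g.M.toMTM g.μ g.πe ∧
        conc g.M.toMTM g.μ g.πe ≤ 6 * conc M μ πe) ∧
      -- admissibility is preserved
      (IsAdmissible M μ → ∀ g ∈ G, IsAdmissible g.M.toMTM g.μ) ∧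
      -- the lower bound, in probability
      (∀ (n : ℕ) (alg : Kernel (Dataset O A H n) ℝ) [IsMarkovKernel alg],
        ∃ g ∈ G, ENNReal.ofReal (1 / 2 - n * ε / (H * K)) ≤ g.failProb alg (ε / (8 * H))) ∧
      -- the lower bound, in expectation
      (∀ (n : ℕ) (alg : Kernel (Dataset O A H n) ℝ) [IsMarkovKernel alg],
        (∀ g ∈ G, g.expError alg ≤ ENNReal.ofReal (ε / (32 * H))) →
          H * K / (4 * ε) ≤ n) := by
  classical
  have hHpos : (0 : ℝ) < H := by exact_mod_cast (by omega : 0 < H)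
  obtain ⟨h₀, h1, hh, I, hI, hεd, hKd⟩ := exists_of_le_aggConc hμ hε₀ hK hKC
  -- There is an action because `μ 1` has total mass one.
  obtain ⟨a₀⟩ : Nonempty A := by
    by_contra hA
    rw [not_nonempty_iff] at hA
    have := hμ.sum_one 1 le_rfl (by omega)
    simp at this
  set d := ∑ φ ∈ I, aggOcc M Φ μ (Policy.det πe) h₀ φ with hd
  set mI := ∑ φ ∈ I, ∑ x ∈ φ, μ h₀ x (πe x) with hmI
  have hd0 : 0 < d := hε₀.trans_le hεd
  have hs0 := surv_pos hH h₀
  have hs := le_surv hH h₀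
  -- Normalised so that the values `± surv H h₀ * r * d` are `± 2/15 * (ε / H)`. Since `ε ≤ d` and
  -- `2/15 ≤ surv H h₀`, also `H * r ≤ 1`.
  set r := 2 / 15 * ε / (d * (surv H h₀ * H)) with hr
  have hr0 : 0 < r := by positivity
  have hmI0 : 0 ≤ mI :=
    Finset.sum_nonneg fun φ _ => Finset.sum_nonneg fun x _ => hμ.nonneg _ _ _
  have hHr : H * r ≤ 1 := by
    rw [hr, mul_div_assoc', div_le_one (by positivity)]
    have : ε * (2 / 15) ≤ d * surv H h₀ := mul_le_mul hεd hs (by norm_num) hd0.le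
    nlinarith
  set b := bias Φ μ πe h₀ I r with hbd
  set f := aggValue Φ μ πe h₀ I r with hfd
  have hb : ∀ x a, |b x a| ≤ 1 := abs_bias_le Φ h₀ I hH hμ.nonneg hr0.le hHr
  have hb' : ∀ x a, |-b x a| ≤ 1 := fun x a => by rw [abs_neg]; exact hb x a
  have hfb : ∀ x a, M.layer x < H → f x a
      = (1 - 2 / (H : ℝ)) * ∑ x', M.T x a x' * f x' (πe x') + 2 / H * b x a :=
    fun x a _ => bellman_bias Φ hH x a
  have hfb' : ∀ x a, M.layer x < H → -f x a
      = (1 - 2 / (H : ℝ)) * ∑ x', M.T x a x' * -f x' (πe x') + 2 / H * -b x a := fun x a hx => by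
    rw [hfb x a hx]
    simp only [mul_neg, Finset.sum_neg_distrib]
    ring
  have hf0 : ∀ x a, M.layer x = H → f x a = 0 := fun x a hx => aggValue_of_gt Φ (by omega) a
  have hf0' : ∀ x a, M.layer x = H → -f x a = 0 := fun x a hx => by rw [hf0 x a hx, neg_zero]
  have hfc : ∀ x y, Φ.cell x = Φ.cell y → ∀ a, f x a = f y a := fun x y h a =>
    aggValue_congr Φ μ h₀ I r hπ h a
  have hfc' : ∀ x y, Φ.cell x = Φ.cell y → ∀ a, -f x a = -f y a := fun x y h a => by
    rw [hfc x y h a]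
  have hπc : ∀ x y, Φ.cell x = Φ.cell y → πe x = πe y := fun x y h =>
    hπ _ (Φ.cell_mem_parts y) x (h ▸ Φ.mem_cell x) y (Φ.mem_cell y)
  have hV : ∑ x, M.ρ x * f x (πe x) = 2 / 15 * (ε / H) := by
    rw [hfd, sum_aggOcc_mul_aggValue Φ hπ hI h1, ← hd]
    have : (1 - 2 / (H : ℝ)) ^ (h₀ - 1) = surv H h₀ := by
      rw [surv, min_eq_left (by omega)]
    rw [this, hr]
    field_simp
  have hV' : ∑ x, M.ρ x * -f x (πe x) = -(2 / 15 * (ε / H)) := by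
    rw [← hV, ← Finset.sum_neg_distrib]
    exact Finset.sum_congr rfl fun x _ => by ring
  have hf1 : ∀ x a, f x a ∈ Set.Icc (-1 : ℝ) 1 := fun x a => by
    rw [Set.mem_Icc, ← abs_le]
    refine (abs_aggValue_le Φ h₀ I hH hμ.nonneg hr0.le x a).trans ?_
    have : (1 : ℝ) ≤ H := by exact_mod_cast (by omega : 1 ≤ H)
    nlinarith
  set x₀ := ε / (H * K) with hx₀
  have hx₀pos : 0 < x₀ := by positivity
  -- Enough copies to make the collision probability at most `n * x₀`, for all relevant `n` at once.
  set m : ℕ := ⌈4 * (H : ℝ) ^ 2 / x₀ ^ 2⌉₊ + 1 with hm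
  have hm0 : 0 < m := Nat.succ_pos _
  have hmx : 4 * (H : ℝ) ^ 2 ≤ m * x₀ ^ 2 := by
    rw [← div_le_iff₀ (by positivity)]
    refine (Nat.le_ceil _).trans ?_
    rw [hm]
    push_cast
    linarith
  -- The states are renamed because the observations must live in `Type`, whatever the universe of
  -- `X`.
  let e : Fin (Fintype.card X) ≃ X := (Fintype.equivFin X).symm
  let O := Obs (Fin (Fintype.card X)) m H
  let q : O → A → ℝ := obsFun e f
  let q' : O → A → ℝ := obsFun e fun x a => -f x a
  let F : Set (O → A → ℝ) := {q, q'}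
  have hF : ∀ f ∈ F, ∀ x a, f x a ∈ Set.Icc (-1 : ℝ) 1 := by
    rintro _ (rfl | rfl) (⟨y, j⟩ | p) a
    · exact hf1 _ _
    · exact newReward_mem _
    · have := hf1 (e y) a
      exact ⟨neg_le_neg this.2, neg_le.1 this.1⟩
    · exact newReward_mem _
  let g : (Fin m → Φ.cellPerm) → OPEProblem O A H :=
    blockProblem hH Φ e hm0 hμ πe a₀ F hF b hb
  let g' : (Fin m → Φ.cellPerm) → OPEProblem O A H :=
    blockProblem hH Φ e hm0 hμ πe a₀ F hF (fun x a => -b x a) hb'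
  let w : (X → A → ℝ) → (X → A → ℝ) → ℕ → ℝ := fun b f h =>
    ∑ s : Aug X H, flowLift b a₀ μ h s ((Sum.elim πe fun _ => a₀ : Aug X H → A) s) *
      augFun f s ((Sum.elim πe fun _ => a₀ : Aug X H → A) s)
  have hgQ : ∀ τ, (g τ).Q = q := fun τ =>
    blockProblem_Q hH Φ e hm0 hμ πe a₀ F hF b hb τ f hfb hf0 hfc
  have hgQ' : ∀ τ, (g' τ).Q = q' := fun τ =>
    blockProblem_Q hH Φ e hm0 hμ πe a₀ F hF _ hb' τ _ hfb' hf0' hfc'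
  have hgW : ∀ τ, (g τ).W = w b f := fun τ => funext fun h =>
    blockProblem_W hH Φ e hm0 hμ πe a₀ F hF b hb τ f hfb hf0 h
  have hgW' : ∀ τ, (g' τ).W = w (fun x a => -b x a) (fun x a => -f x a) := fun τ => funext fun h =>
    blockProblem_W hH Φ e hm0 hμ πe a₀ F hF _ hb' τ _ hfb' hf0' h
  -- If the two functions agreed, then `f = 0`, and the value would be zero.
  have hqq : q ≠ q' := by
    intro h
    have hz : ∀ x a, f x a = 0 := fun x a => by
      have := congrFun (congrFun h (.inl (e.symm x, ⟨0, hm0⟩))) a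
      simp only [q, q', obsFun, Equiv.apply_symm_apply] at this
      linarith
    have : 0 < 2 / 15 * (ε / (H : ℝ)) := by positivity
    rw [← hV] at this
    simp [hz] at this
  have hmain : ∀ (n : ℕ) (alg : Kernel (Dataset O A H n) ℝ) [IsMarkovKernel alg],
      ∃ p ∈ Set.range g ∪ Set.range g',
        ENNReal.ofReal (1 / 2 - n * ε / (H * K)) ≤ p.failProb alg (ε / (8 * H)) := by
    intro n alg _
    rw [mul_div_assoc, ← hx₀]
    rcases lt_or_ge 1 (n * x₀) with hn | hn
    · refine ⟨g 1, Or.inl ⟨1, rfl⟩, ?_⟩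
      rw [ENNReal.ofReal_of_nonpos (by linarith)]
      exact zero_le
    -- By `K * mI ≤ d` the left side is at most `2/15 * x₀`.
    have hηx : r * mI * surv H h₀ ≤ x₀ / 2 := by
      have : r * mI * surv H h₀ = 2 / 15 * ε * mI / (d * H) := by
        rw [hr]
        field_simp
      rw [this, hx₀, div_div, div_le_div_iff₀ (by positivity) (by positivity)]
      have := mul_le_mul_of_nonneg_left hKd (by positivity : 0 ≤ ε * H)
      have : 0 ≤ ε * H * (K * mI) := by positivity
      nlinarith
    have hov := two_mul_le_overlap hH Φ e hm0 hμ hπ a₀ hI hr0.le hHr hx₀pos.le hηx hmx hn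
    have hgT : ∀ τ h z, (g τ).tupleProb h z = obsTuple Φ e μ a₀ b h τ z := fun τ h z =>
      blockProblem_tupleProb hH Φ e hm0 hμ πe a₀ F hF b hb τ h z
    have hgT' : ∀ τ h z, (g' τ).tupleProb h z = obsTuple Φ e μ a₀ (fun x a => -b x a) h τ z :=
      fun τ h z => blockProblem_tupleProb hH Φ e hm0 hμ πe a₀ F hF _ hb' τ h z
    have hov' : 2 * (1 / 2 - n * x₀) ≤ ∑ D : Fin (H - 1) × Fin n → O × A × O,
        min (𝔼 τ, ∏ i, (g τ).tupleProb (i.1.val + 1) (D i))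
          (𝔼 τ, ∏ i, (g' τ).tupleProb (i.1.val + 1) (D i)) := by
      simp only [hgT, hgT']
      exact hov
    rcases exists_le_failProb g g' obsReward
      (fun τ => blockProblem_reward hH Φ e hm0 hμ πe a₀ F hF b hb τ)
      (fun τ => blockProblem_reward hH Φ e hm0 hμ πe a₀ F hF _ hb' τ)
      (fun τ => (blockProblem_value hH Φ e hm0 hμ πe a₀ F hF b hb τ f hfb hf0).trans hV)
      (fun τ => (blockProblem_value hH Φ e hm0 hμ πe a₀ F hF _ hb' τ _ hfb' hf0').trans hV')
      -- The gap between the values is `4/15 * (ε / H)`, just above `2δ = 1/4 * (ε / H)`.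
      (δ := ε / (8 * H)) (by
        have : 0 < ε / (H : ℝ) := by positivity
        rw [sub_neg_eq_add, abs_of_pos (by positivity),
          show ε / (8 * (H : ℝ)) = 1 / 8 * (ε / H) by field_simp]
        linarith) alg hov' with ⟨τ, hτ⟩ | ⟨τ, hτ⟩
    · exact ⟨g τ, Or.inl ⟨τ, rfl⟩, hτ⟩
    · exact ⟨g' τ, Or.inr ⟨τ, rfl⟩, hτ⟩
  -- The construction preserves the concentrability coefficient exactly, so both constants have room
  -- to spare.
  have hconc : conc M μ πe / 8 ≤ conc M μ πe ∧ conc M μ πe ≤ 6 * conc M μ πe :=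
    ⟨ENNReal.div_le_of_le_mul (le_mul_of_one_le_right zero_le (by norm_num)),
      le_mul_of_one_le_left zero_le (by norm_num)⟩
  refine ⟨O, inferInstance, label Φ e,
    Sum.elim (fun p => πe (e p.1)) (fun _ => a₀), F,
    {(q, w b f), (q', w (fun x a => -b x a) fun x a => -f x a)}, Set.range g ∪ Set.range g',
    ?_, Set.ncard_pair hqq, Set.ncard_pair fun h => hqq (congrArg Prod.fst h), ?_, ?_, ?_, ?_, ?_,
    hmain, ?_⟩
  · rintro _ (⟨τ, rfl⟩ | ⟨τ, rfl⟩)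
    · exact ⟨blockProblem_isLift .., funext (blockProblem_πe _ _ _ _ _ _ _ _ _ _ _ _ hπc), rfl⟩
    · exact ⟨blockProblem_isLift .., funext (blockProblem_πe _ _ _ _ _ _ _ _ _ _ _ _ hπc), rfl⟩
  · rw [Set.image_pair]
  · rintro _ (⟨τ, rfl⟩ | ⟨τ, rfl⟩)
    · rw [hgQ, hgW]
      exact ⟨Or.inl rfl, Or.inl rfl⟩
    · rw [hgQ', hgW']
      exact ⟨Or.inr rfl, Or.inr rfl⟩
  · have hsep : ∀ f : X → A → ℝ, (∀ x y, Φ.cell x = Φ.cell y → ∀ a, f x a = f y a) →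
        ∀ o o' : O, label Φ e o = label Φ e o' → obsFun e f o = obsFun e f o' := by
      rintro f hfc (⟨y, j⟩ | p) (⟨y', j'⟩ | p') h
      · simp only [label, Sum.inl.injEq, Subtype.mk.injEq] at h
        exact funext fun a => hfc _ _ h a
      · simp [label] at h
      · simp [label] at h
      · simp only [label, Sum.inr.injEq] at h
        rw [h]
    rintro _ (rfl | rfl)
    · exact hsep _ hfc
    · exact hsep _ hfc'
  · rintro _ (⟨τ, rfl⟩ | ⟨τ, rfl⟩)
    · rw [blockProblem_conc]
      exact hconc
    · rw [blockProblem_conc]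
      exact hconc
  · rintro ha _ (⟨τ, rfl⟩ | ⟨τ, rfl⟩)
    · exact blockProblem_isAdmissible _ _ _ _ _ _ _ _ _ _ _ _ ha
    · exact blockProblem_isAdmissible _ _ _ _ _ _ _ _ _ _ _ _ ha
  · intro n alg _ herr
    obtain ⟨p, hp, hfail⟩ := hmain n alg
    have hδ : 0 < ε / (8 * (H : ℝ)) := by positivity
    -- By Markov's inequality an expected error of `ε / (32H)` allows a failure probability of at
    -- most `1/4` at precision `ε / (8H)`, which forces `n * ε / (H * K) ≥ 1/4`.
    have h2 := (mul_le_mul_right hfail (ENNReal.ofReal (ε / (8 * H)))).trans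
      ((p.failProb_le_expError alg _).trans (herr p hp))
    rw [← ENNReal.ofReal_mul hδ.le, ENNReal.ofReal_le_ofReal_iff (by positivity),
      show ε / (32 * (H : ℝ)) = ε / (8 * H) * (1 / 4) by field_simp; norm_num] at h2
    have h3 := le_of_mul_le_mul_left h2 hδ
    have h4 : 1 / 4 ≤ n * ε / (H * K) := by linarith
    rw [le_div_iff₀ (by positivity)] at h4
    rw [div_le_iff₀ (by positivity)]
    linarith
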